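/- Let $-\infty<a<b<\infty$ and let $p,q_0,q_1,r$ be real-valued functions on $(a,b)$ with $p,r>0$ almost everywhere and $p^{-1},q_0,q_1,r\in L^1(a,b)$. For $j=0,1$ put $$\tau_j=\frac1r\Big(-\frac{d}{dx}\,p\,\frac{d}{dx}+q_j\Big),$$ let $\alpha,\beta\in\mathbb R$, and let $H_j$ be the operator $H_jf=\tau_jf$ in $L^2((a,b),r\,dx)$ whose domain consists of all $f\in L^2((a,b),r\,dx)$ such that $f$ and $pf'$ are absolutely continuous on $[a,b]$, $\tau_jf\in L^2((a,b),r\,dx)$, and $$\cos(\alpha)f(a)-\sin(\alpha)\,(pf')(a)=0,\qquad \cos(\beta)f(b)-\sin(\beta)\,(pf')(b)=0 .$$ Then $H_0$ and $H_1$ possess spectral resolutions; write $P_\Omega(H_j)$ for the spectral projection of $H_j$ belonging to a Borel set $\Omega\subseteq\mathbb R$. For $z\in\mathbb R$ let $\psi_{j,-}(z)$ (respectively $\psi_{j,+}(z)$) be a real-valued, not identically vanishing solution of $\tau_ju=zu$ that satisfies the above boundary condition at $a$ (respectively at $b$). If $u$ and $pu'$ are real-valued, absolutely continuous on $[a,b]$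 and have no common zero, a Prüfer angle of $u$ is a continuous function $\theta_u$ on $[a,b]$ with $u=\rho_u\sin\theta_u$ and $pu'=\rho_u\cos\theta_u$ for some $\rho_u>0$. The number of weighted sign flips of two such functions $u_0,u_1$ is $$\#_{(a,b)}(u_0,u_1)=\Big\lceil\frac{\theta_{u_1}(b)-\theta_{u_0}(b)}{\pi}\Big\rceil-\Big\lfloor\frac{\theta_{u_1}(a)-\theta_{u_0}(a)}{\pi}\Big\rfloor-1 ,$$ which does not depend on the choice of the Prüfer angles. Then for all $\lambda_0,\lambda_1\in\mathbb R$ the spaces $\operatorname{Ran}P_{(-\infty,\lambda_1)}(H_1)$ and $\operatorname{Ran}P_{(-\infty,\lambda_0]}(H_0)$ are finite-dimensional, and $$\dim\operatorname{Ran}P_{(-\infty,\lambda_1)}(H_1)-\dim\operatorname{Ran}P_{(-\infty,\lambda_0]}(H_0)=\#_{(a,b)}\big(\psi_{0,+}(\lambda_0),\psi_{1,-}(\lambda_1)\big)=\#_{(a,b)}\big(\psi_{0,-}(\lambda_0),\psi_{1,+}(\lambda_1)\big).$$ -/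

import Mathlib

open MeasureTheory Set

noncomputable section

/-! ### Projection-valued measures and the spectral theorem -/

/-- A projection-valued measure (resolution of the identity) on the Borel sets of `ℝ` with values
in the orthogonal projections of the complex Hilbert space `𝓗`.  Only the values on Borel sets
matter. -/
structure ProjValuedMeasure (𝓗 : Type*) [NormedAddCommGroup 𝓗] [InnerProductSpace ℂ 𝓗]
    [CompleteSpace 𝓗] where
  /-- the projection `P_Ω` attached to a set `Ω` -/
  proj : Set ℝ → 𝓗 →L[ℂ] 𝓗
  isStarProjection : ∀ s, MeasurableSet s → IsStarProjection (proj s)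
  proj_empty : proj ∅ = 0
  proj_univ : proj Set.univ = 1
  proj_inter : ∀ s t, MeasurableSet s → MeasurableSet t → proj (s ∩ t) = proj s * proj t
  /-- countable additivity in the strong operator topology -/
  hasSum_proj : ∀ f : ℕ → Set ℝ, (∀ i, MeasurableSet (f i)) →
    Pairwise (Function.onFun Disjoint f) →
      ∀ x : 𝓗, HasSum (fun i => proj (f i) x) (proj (⋃ i, f i) x)

namespace ProjValuedMeasure

variable {𝓗 : Type*} [NormedAddCommGroup 𝓗] [InnerProductSpace ℂ 𝓗] [CompleteSpace 𝓗]

theorem inner_proj_self (E : ProjValuedMeasure 𝓗) {s : Set ℝ} (hs : MeasurableSet s) (x : 𝓗) :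
    inner ℂ x (E.proj s x) = ((‖E.proj s x‖ ^ 2 : ℝ) : ℂ) := by
  have h := E.isStarProjection s hs
  have h1 : E.proj s (E.proj s x) = E.proj s x := by
    have := congrArg (fun T : 𝓗 →L[ℂ] 𝓗 => T x) h.isIdempotentElem.eq
    simpa using this
  have h2 : inner ℂ (E.proj s x) (E.proj s x) = inner ℂ x (E.proj s (E.proj s x)) := by
    have h3 := ContinuousLinearMap.adjoint_inner_left (E.proj s) (E.proj s x) x
    rw [← ContinuousLinearMap.star_eq_adjoint, h.isSelfAdjoint.star_eq] at h3
    exact h3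
  rw [h1] at h2
  rw [← h2, inner_self_eq_norm_sq_to_K]
  norm_cast

/-- The scalar spectral measure `Ω ↦ ‖P_Ω x‖² = ⟨x, P_Ω x⟩` of a vector `x`. -/
def scalarMeasure (E : ProjValuedMeasure 𝓗) (x : 𝓗) : Measure ℝ :=
  Measure.ofMeasurable (fun s _ => ENNReal.ofReal (‖E.proj s x‖ ^ 2))
    (by simp [E.proj_empty])
    (by
      intro f hf hd
      have h1 := (E.hasSum_proj f hf hd x).mapL (innerSL ℂ x)
      simp only [innerSL_apply_apply, E.inner_proj_self (MeasurableSet.iUnion hf),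
        E.inner_proj_self (hf _)] at h1
      have h2 := Complex.hasSum_ofReal.1 h1
      rw [← h2.tsum_eq, ENNReal.ofReal_tsum_of_nonneg (fun _ => by positivity) h2.summable])

/-- `E` is the spectral resolution of the (unbounded) operator `H`, i.e. `H = ∫ t dE(t)`: the
domain of `H` is `{x | ∫ t² d⟨x, E x⟩ < ∞}`, and `⟨x, H x⟩ = ∫ t d⟨x, E x⟩` for `x` in it (by
polarization this determines `H`). -/
structure IsSpectralResolution (E : ProjValuedMeasure 𝓗) (H : 𝓗 →ₗ.[ℂ] 𝓗) : Prop where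
  mem_domain_iff : ∀ x : 𝓗, x ∈ H.domain ↔ Integrable (fun t : ℝ => t ^ 2) (E.scalarMeasure x)
  inner_apply : ∀ x : H.domain,
    inner ℂ (x : 𝓗) (H x) = ((∫ t, t ∂(E.scalarMeasure (x : 𝓗)) : ℝ) : ℂ)

end ProjValuedMeasure

/-! ### Regular Sturm–Liouville operators -/

namespace SturmLiouville

/-- The coefficients `p, q, r` of `τ = r⁻¹ (-(d/dx) p (d/dx) + q)` are regular on the bounded
interval `(a, b)`: `p, r > 0` and `p⁻¹, q, r ∈ L¹(a, b)`. -/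
structure IsRegular (a b : ℝ) (p q r : ℝ → ℝ) : Prop where
  p_pos : ∀ᵐ x ∂(volume.restrict (Ioo a b)), 0 < p x
  r_pos : ∀ᵐ x ∂(volume.restrict (Ioo a b)), 0 < r x
  integrable_inv_p : IntegrableOn (fun x => (p x)⁻¹) (Ioo a b)
  integrable_q : IntegrableOn q (Ioo a b)
  integrable_r : IntegrableOn r (Ioo a b)

/-- `u` and `w = p u'` are absolutely continuous on `[a, b]` and `τ u = g`, that is
`-(p u')' + q u = r g` almost everywhere on `(a, b)`.  (Scalars `E = ℝ` or `E = ℂ`.) -/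
structure TauEq {E : Type*} [NormedAddCommGroup E] [NormedSpace ℝ E] (a b : ℝ) (p q r : ℝ → ℝ)
    (u w g : ℝ → E) : Prop where
  ac_u : AbsolutelyContinuousOnInterval u a b
  ac_w : AbsolutelyContinuousOnInterval w a b
  deriv_u : ∀ᵐ x ∂(volume.restrict (Ioo a b)), HasDerivAt u ((p x)⁻¹ • w x) x
  deriv_w : ∀ᵐ x ∂(volume.restrict (Ioo a b)), HasDerivAt w (q x • u x - r x • g x) x

/-- The separated boundary condition `cos γ · u(c) - sin γ · (p u')(c) = 0` at `c`, where
`w = p u'`. -/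
def BoundaryCond {E : Type*} [NormedAddCommGroup E] [NormedSpace ℝ E] (c γ : ℝ)
    (u w : ℝ → E) : Prop :=
  Real.cos γ • u c - Real.sin γ • w c = 0

/-- The measure `r dx` on `(a, b)`. -/
def weight (a b : ℝ) (r : ℝ → ℝ) : Measure ℝ :=
  (volume.restrict (Ioo a b)).withDensity (fun x => ENNReal.ofReal (r x))

/-- The Hilbert space `L²((a, b), r dx)`. -/
abbrev L2 (a b : ℝ) (r : ℝ → ℝ) : Type := Lp ℂ 2 (weight a b r)

theorem TauEq.add {E : Type*} [NormedAddCommGroup E] [NormedSpace ℝ E] {a b : ℝ}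
    {p q r : ℝ → ℝ} {u w g u' w' g' : ℝ → E} (h : TauEq a b p q r u w g)
    (h' : TauEq a b p q r u' w' g') : TauEq a b p q r (u + u') (w + w') (g + g') where
  ac_u := h.ac_u.add h'.ac_u
  ac_w := h.ac_w.add h'.ac_w
  deriv_u := by
    filter_upwards [h.deriv_u, h'.deriv_u] with x h1 h2
    simpa [smul_add] using h1.add h2
  deriv_w := by
    filter_upwards [h.deriv_w, h'.deriv_w] with x h1 h2
    convert h1.add h2 using 1
    simp only [Pi.add_apply, smul_add]
    abel

theorem TauEq.const_smul {a b : ℝ} {p q r : ℝ → ℝ} {u w g : ℝ → ℂ}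
    (h : TauEq a b p q r u w g) (c : ℂ) : TauEq a b p q r (c • u) (c • w) (c • g) where
  ac_u := h.ac_u.const_smul c
  ac_w := h.ac_w.const_smul c
  deriv_u := by
    filter_upwards [h.deriv_u] with x h1
    convert h1.const_smul c using 1
    simp only [Pi.smul_apply]
    rw [smul_comm]
  deriv_w := by
    filter_upwards [h.deriv_w] with x h1
    convert h1.const_smul c using 1
    simp only [Pi.smul_apply, smul_sub]
    rw [smul_comm c, smul_comm c]

/-- The graph `{(f, τ f)}` of the Sturm–Liouville operator with the boundary conditions given by
`α` at `a` and `β` at `b`; `f` runs over the functions in `L²((a, b), r dx)` for which `f`, `p f'`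
are absolutely continuous on `[a, b]`, `τ f ∈ L²((a, b), r dx)`, and both boundary conditions
hold. -/
def graph (a b : ℝ) (p q r : ℝ → ℝ) (α β : ℝ) : Submodule ℂ (L2 a b r × L2 a b r) where
  carrier := {F | ∃ u w g : ℝ → ℂ, F.1 =ᵐ[weight a b r] u ∧ F.2 =ᵐ[weight a b r] g ∧
    TauEq a b p q r u w g ∧ BoundaryCond a α u w ∧ BoundaryCond b β u w}
  add_mem' := by
    rintro F G ⟨u, w, g, hu, hg, h, ha, hb⟩ ⟨u', w', g', hu', hg', h', ha', hb'⟩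
    refine ⟨u + u', w + w', g + g', (Lp.coeFn_add _ _).trans (hu.add hu'),
      (Lp.coeFn_add _ _).trans (hg.add hg'), h.add h', ?_, ?_⟩
    · simp only [BoundaryCond, Pi.add_apply, smul_add] at *
      rw [add_sub_add_comm, ha, ha', add_zero]
    · simp only [BoundaryCond, Pi.add_apply, smul_add] at *
      rw [add_sub_add_comm, hb, hb', add_zero]
  zero_mem' := by
    refine ⟨0, 0, 0, Lp.coeFn_zero _ _ _, Lp.coeFn_zero _ _ _, ⟨?_, ?_, ?_, ?_⟩, ?_, ?_⟩
    · exact (LipschitzWith.const (0 : ℂ)).lipschitzOnWith.absolutelyContinuousOnInterval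
    · exact (LipschitzWith.const (0 : ℂ)).lipschitzOnWith.absolutelyContinuousOnInterval
    · exact Filter.Eventually.of_forall fun x => by simp
    · exact Filter.Eventually.of_forall fun x => by simp
    · simp [BoundaryCond]
    · simp [BoundaryCond]
  smul_mem' := by
    rintro c F ⟨u, w, g, hu, hg, h, ha, hb⟩
    refine ⟨c • u, c • w, c • g, (Lp.coeFn_smul _ _).trans (hu.const_smul c),
      (Lp.coeFn_smul _ _).trans (hg.const_smul c), h.const_smul c, ?_, ?_⟩
    · simp only [BoundaryCond, Pi.smul_apply] at *
      rw [smul_comm _ c, smul_comm _ c, ← smul_sub, ha, smul_zero]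
    · simp only [BoundaryCond, Pi.smul_apply] at *
      rw [smul_comm _ c, smul_comm _ c, ← smul_sub, hb, smul_zero]

theorem ae_of_ae_weight {a b : ℝ} {p q r : ℝ → ℝ} (hreg : IsRegular a b p q r) {P : ℝ → Prop}
    (h : ∀ᵐ x ∂(weight a b r), P x) : ∀ᵐ x ∂(volume.restrict (Ioo a b)), P x := by
  have hm : AEMeasurable (fun x => ENNReal.ofReal (r x)) (volume.restrict (Ioo a b)) :=
    hreg.integrable_r.aestronglyMeasurable.aemeasurable.ennreal_ofReal
  filter_upwards [(ae_withDensity_iff' hm).1 h, hreg.r_pos] with x h1 h2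
  exact h1 (by simpa using h2)

theorem eq_zero_of_ae {a b : ℝ} {w : ℝ → ℂ} (hw : ContinuousOn w (Icc a b))
    (h : ∀ᵐ x ∂(volume.restrict (Ioo a b)), w x = 0) : ∀ x ∈ Ioo a b, w x = 0 :=
  Measure.eqOn_open_of_ae_eq (g := fun _ => (0 : ℂ)) h isOpen_Ioo
    (hw.mono Ioo_subset_Icc_self) continuousOn_const

/-- `τ f` is determined by `f`: the graph is single-valued. -/
theorem graph_singleValued {a b : ℝ} (hab : a < b) {p q r : ℝ → ℝ} (hreg : IsRegular a b p q r)
    (α β : ℝ) : ∀ F ∈ graph a b p q r α β, F.1 = 0 → F.2 = 0 := by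
  rintro F ⟨u, w, g, hu, hg, h, -, -⟩ hF
  have hcu : ContinuousOn u (Icc a b) := by simpa [uIcc_of_le hab.le] using h.ac_u.continuousOn
  have hcw : ContinuousOn w (Icc a b) := by simpa [uIcc_of_le hab.le] using h.ac_w.continuousOn
  have hu0 : ∀ x ∈ Ioo a b, u x = 0 := by
    refine eq_zero_of_ae hcu (ae_of_ae_weight hreg ?_)
    rw [hF] at hu
    filter_upwards [hu, Lp.coeFn_zero ℂ 2 (weight a b r)] with x h1 h2
    rw [← h1, h2, Pi.zero_apply]
  have hd : ∀ {v : ℝ → ℂ}, (∀ x ∈ Ioo a b, v x = 0) → ∀ x ∈ Ioo a b, ∀ d,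
      HasDerivAt v d x → d = 0 := by
    intro v hv x hx d hd
    refine hd.unique ((hasDerivAt_const x (0 : ℂ)).congr_of_eventuallyEq ?_)
    filter_upwards [isOpen_Ioo.mem_nhds hx] with y hy using hv y hy
  have hw0 : ∀ x ∈ Ioo a b, w x = 0 := by
    refine eq_zero_of_ae hcw ?_
    filter_upwards [h.deriv_u, hreg.p_pos, ae_restrict_mem measurableSet_Ioo] with x h1 h2 hx
    simpa [h2.ne'] using hd hu0 x hx _ h1
  have hg0 : ∀ᵐ x ∂(volume.restrict (Ioo a b)), g x = 0 := by
    filter_upwards [h.deriv_w, hreg.r_pos, ae_restrict_mem measurableSet_Ioo] with x h1 h2 hx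
    simpa [hu0 x hx, h2.ne'] using hd hw0 x hx _ h1
  have hg1 : ∀ᵐ x ∂(weight a b r), g x = 0 := (withDensity_absolutelyContinuous _ _).ae_le hg0
  refine Lp.ext ?_
  filter_upwards [hg, hg1, Lp.coeFn_zero ℂ 2 (weight a b r)] with x h1 h2 h3
  rw [h1, h2, h3, Pi.zero_apply]

/-- The regular Sturm–Liouville operator `H f = τ f` in `L²((a, b), r dx)` with the separated
boundary conditions `cos α f(a) - sin α (p f')(a) = 0` and `cos β f(b) - sin β (p f')(b) = 0`. -/
def operator (a b : ℝ) (p q r : ℝ → ℝ) (α β : ℝ) : L2 a b r →ₗ.[ℂ] L2 a b r :=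
  (graph a b p q r α β).toLinearPMap

theorem operator_graph {a b : ℝ} (hab : a < b) {p q r : ℝ → ℝ} (hreg : IsRegular a b p q r)
    (α β : ℝ) : (operator a b p q r α β).graph = graph a b p q r α β :=
  Submodule.toLinearPMap_graph_eq _ fun F hF h0 => graph_singleValued hab hreg α β F hF h0

/-- `u` (with `w = p u'`) is a real-valued solution of `τ u = z u`, not identically zero on
`[a, b]`, that satisfies the boundary condition with angle `γ` at `c`.  With `c = a`, `γ = α` it is
a solution `ψ₋(z)`; with `c = b`, `γ = β` it is a solution `ψ₊(z)`. -/
structure IsBoundarySolution (a b : ℝ) (p q r : ℝ → ℝ) (z c γ : ℝ) (u w : ℝ → ℝ) : Prop where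
  tauEq : TauEq a b p q r u w (fun x => z * u x)
  boundary : BoundaryCond c γ u w
  ne_zero : ∃ x ∈ Icc a b, u x ≠ 0

/-- `θ` is a continuous Prüfer angle on `[a, b]` of `u` (with `w = p u'`): `u = ρ sin θ` and
`p u' = ρ cos θ` with `ρ > 0`. -/
def IsPruferAngle (a b : ℝ) (u w θ : ℝ → ℝ) : Prop :=
  ContinuousOn θ (Icc a b) ∧ ∃ ρ : ℝ → ℝ, ∀ x ∈ Icc a b,
    0 < ρ x ∧ u x = ρ x * Real.sin (θ x) ∧ w x = ρ x * Real.cos (θ x)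

/-- The number `#_(c,d)(u₀, u₁)` of weighted sign flips, in terms of Prüfer angles `θ₀` of `u₀` and
`θ₁` of `u₁`. -/
def weightedSignFlips (c d : ℝ) (θ₀ θ₁ : ℝ → ℝ) : ℤ :=
  ⌈(θ₁ d - θ₀ d) / Real.pi⌉ - ⌊(θ₁ c - θ₀ c) / Real.pi⌋ - 1

end SturmLiouville

end

/-! Write a real solution of τu = μu as u = ρ sin θ, pu' = ρ cos θ. The angle satisfies a scalar
equation without ρ, θ' = p⁻¹ cos² θ + (μr - q) sin² θ, and the boundary condition with angle γ at c
says that θ(c) ∈ γ + πℤ. Since only α and β modulo π matter, take 0 ≤ α < π and 0 < β ≤ π. Let θ_μ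
start at θ_μ(a) = α and put Θ(μ) = θ_μ(b). Then μ is an eigenvalue, necessarily simple, exactly when
Θ(μ) ∈ β + πℤ. The function Θ is strictly increasing (`IsPruferSolution.lt_of_lt`), continuous
(`IsPruferSolution.abs_sub_le`), positive (`IsPruferSolution.pos_right`) and gets arbitrarily close
to 0 at -∞ (`eventually_prufer_lt`). Hence it takes exactly the levels β + kπ with k ≥ 0 that lie
below its current value: there are ⌊(Θ(λ) - β)/π⌋ + 1 eigenvalues ≤ λ and ⌈(Θ(λ) - β)/π⌉ eigenvalues
< λ.

Eigenvalue counts become dimensions as follows. Where Θ < β, Green's function gives a compact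
symmetric resolvent, so the normalized eigenfunctions form a Hilbert basis. This basis produces a
spectral resolution; and for an arbitrary spectral resolution the scalar measure of an eigenvector
is a point mass (`scalarMeasure_ae_eq`), so every finite-rank claim reduces to counting basis
vectors (`finiteDimensional_and_finrank_range`).

The difference of dimensions is therefore ⌈(Θ₁(λ₁) - β)/π⌉ - ⌊(Θ₀(λ₀) - β)/π⌋ - 1. For the angle θ
of a solution that satisfies either boundary condition, constancy of the Wronskian shows that θ(b) -
θ(a) - (β - α) and Θ - β have the same floor and ceiling after division by π
(`floor_ceil_pruferAngle`). In the number of sign flips, one of the two angles is known modulo π at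
each endpoint; the integers cancel and the same expression remains. -/

noncomputable section

namespace SturmLiouville

/-! ### Primitives: absolutely continuous functions with a prescribed derivative -/

/-- `f` is absolutely continuous on `[a, b]` with derivative `f'` almost everywhere. -/
structure IsPrimitive {E : Type*} [NormedAddCommGroup E] [NormedSpace ℝ E] (a b : ℝ)
    (f f' : ℝ → E) : Prop where
  ac : AbsolutelyContinuousOnInterval f a b
  hasDerivAt : ∀ᵐ x ∂(volume.restrict (Ioo a b)), HasDerivAt f (f' x) x

/-- The sums that define absolute continuity for `f` are at most `C` times those for `g`, over the
same families of intervals. -/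
theorem absolutelyContinuousOnInterval_of_dist_le {X Y : Type*} [PseudoMetricSpace X]
    [PseudoMetricSpace Y] {f : ℝ → X} {g : ℝ → Y} {a b C : ℝ}
    (hg : AbsolutelyContinuousOnInterval g a b)
    (h : ∀ x ∈ uIcc a b, ∀ y ∈ uIcc a b, dist (f x) (f y) ≤ C * dist (g x) (g y)) :
    AbsolutelyContinuousOnInterval f a b := by
  unfold AbsolutelyContinuousOnInterval at hg ⊢
  have hg' := hg.const_mul C
  rw [mul_zero] at hg'
  refine squeeze_zero' (Filter.Eventually.of_forall fun E =>
    Finset.sum_nonneg fun i _ => dist_nonneg) ?_ hg'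
  filter_upwards [Filter.mem_inf_of_right (Filter.mem_principal_self _)] with E hE
  rw [Finset.mul_sum]
  exact Finset.sum_le_sum fun i hi => h _ (hE.1 i hi).1 _ (hE.1 i hi).2

/-- An absolutely continuous function has bounded range, and a C¹ map is Lipschitz on a compact
interval. -/
theorem absolutelyContinuousOnInterval_comp {E : Type*} [NormedAddCommGroup E] [NormedSpace ℝ E]
    {φ : ℝ → E} (hφ : ContDiff ℝ 1 φ) {f : ℝ → ℝ} {a b : ℝ}
    (hf : AbsolutelyContinuousOnInterval f a b) :
    AbsolutelyContinuousOnInterval (fun x => φ (f x)) a b := by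
  obtain ⟨C, hC⟩ := hf.exists_bound
  obtain ⟨K, hK⟩ := hφ.contDiffOn.exists_lipschitzOnWith (s := Icc (-C) C) (by decide)
    (convex_Icc _ _) isCompact_Icc
  refine absolutelyContinuousOnInterval_of_dist_le (C := K) hf fun x hx y hy => ?_
  exact hK.dist_le_mul _ (abs_le.1 (hC x hx)) _ (abs_le.1 (hC y hy))

/-- Increments of the vector-valued integral are dominated by those of the real integral of ‖h‖. -/
theorem absolutelyContinuousOnInterval_integral {E : Type*} [NormedAddCommGroup E]
    [NormedSpace ℝ E] {h : ℝ → E} {a b : ℝ} (hh : IntervalIntegrable h volume a b) :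
    AbsolutelyContinuousOnInterval (fun x => ∫ t in a..x, h t) a b := by
  refine absolutelyContinuousOnInterval_of_dist_le (C := 1)
    (hh.norm.absolutelyContinuousOnInterval_intervalIntegral (c := a) left_mem_uIcc) ?_
  intro x hx y hy
  have hx' : IntervalIntegrable h volume a x := hh.mono_set (uIcc_subset_uIcc_left hx)
  have hy' : IntervalIntegrable h volume a y := hh.mono_set (uIcc_subset_uIcc_left hy)
  rw [dist_eq_norm, dist_eq_norm, one_mul, intervalIntegral.integral_interval_sub_left hx' hy',
    intervalIntegral.integral_interval_sub_left hx'.norm hy'.norm, Real.norm_eq_abs]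
  exact intervalIntegral.norm_integral_le_abs_integral_norm

theorem intervalIntegrable_of_Ioo {E : Type*} [NormedAddCommGroup E] {h : ℝ → E} {a b x y : ℝ}
    (hh : IntegrableOn h (Ioo a b)) (hx : x ∈ Icc a b) (hy : y ∈ Icc a b) :
    IntervalIntegrable h volume x y := by
  have h1 : IntervalIntegrable h volume a b := by
    rw [intervalIntegrable_iff_integrableOn_Ioo_of_le (hx.1.trans hx.2)]
    exact hh
  refine h1.mono_set ?_
  rw [uIcc_of_le (hx.1.trans hx.2)]
  exact uIcc_subset_Icc hx hy

theorem ae_mem_uIcc_of_ae_Ioo {a b : ℝ} (hab : a ≤ b) {P : ℝ → Prop}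
    (h : ∀ᵐ x ∂(volume.restrict (Ioo a b)), P x) : ∀ᵐ x, x ∈ uIcc a b → P x := by
  rw [uIcc_of_le hab, ← ae_restrict_iff' measurableSet_Icc, ← Measure.restrict_congr_set
    (Ioo_ae_eq_Icc (μ := volume) (a := a) (b := b))]
  exact h

namespace IsPrimitive

variable {E : Type*} [NormedAddCommGroup E] [NormedSpace ℝ E] {a b : ℝ} {f f' g g' : ℝ → E}

theorem continuousOn (hf : IsPrimitive a b f f') (hab : a ≤ b) : ContinuousOn f (Icc a b) := by
  simpa [uIcc_of_le hab] using hf.ac.continuousOn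

theorem congr_deriv (hf : IsPrimitive a b f f')
    (h : ∀ᵐ x ∂(volume.restrict (Ioo a b)), f' x = g' x) : IsPrimitive a b f g' where
  ac := hf.ac
  hasDerivAt := by
    filter_upwards [hf.hasDerivAt, h] with x h1 h2
    rwa [← h2]

theorem add (hf : IsPrimitive a b f f') (hg : IsPrimitive a b g g') :
    IsPrimitive a b (fun x => f x + g x) (fun x => f' x + g' x) where
  ac := hf.ac.add hg.ac
  hasDerivAt := by
    filter_upwards [hf.hasDerivAt, hg.hasDerivAt] with x h1 h2 using h1.add h2

theorem sub (hf : IsPrimitive a b f f') (hg : IsPrimitive a b g g') :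
    IsPrimitive a b (fun x => f x - g x) (fun x => f' x - g' x) where
  ac := hf.ac.sub hg.ac
  hasDerivAt := by
    filter_upwards [hf.hasDerivAt, hg.hasDerivAt] with x h1 h2 using h1.sub h2

theorem const (c : E) : IsPrimitive a b (fun _ => c) (fun _ => (0 : E)) where
  ac := (LipschitzWith.const c).lipschitzOnWith.absolutelyContinuousOnInterval
  hasDerivAt := Filter.Eventually.of_forall fun x => hasDerivAt_const x c

theorem mul {𝕜 : Type*} [RCLike 𝕜] {f f' g g' : ℝ → 𝕜} (hf : IsPrimitive a b f f')
    (hg : IsPrimitive a b g g') :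
    IsPrimitive a b (fun x => f x * g x) (fun x => f' x * g x + f x * g' x) where
  ac := hf.ac.smul hg.ac
  hasDerivAt := by
    filter_upwards [hf.hasDerivAt, hg.hasDerivAt] with x h1 h2 using h1.mul h2

theorem clm {F : Type*} [NormedAddCommGroup F] [NormedSpace ℝ F] (L : E →L[ℝ] F)
    (hf : IsPrimitive a b f f') : IsPrimitive a b (fun x => L (f x)) (fun x => L (f' x)) where
  ac := absolutelyContinuousOnInterval_of_dist_le (C := ‖L‖) hf.ac fun x _ y _ => by
    rw [dist_eq_norm, dist_eq_norm, ← map_sub]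
    exact L.le_opNorm _
  hasDerivAt := by
    filter_upwards [hf.hasDerivAt] with x h1 using L.hasFDerivAt.comp_hasDerivAt x h1

theorem comp {φ φ' : ℝ → E} (hφ : ContDiff ℝ 1 φ) (hφ' : ∀ x, HasDerivAt φ (φ' x) x)
    {f f' : ℝ → ℝ} (hf : IsPrimitive a b f f') :
    IsPrimitive a b (fun x => φ (f x)) (fun x => f' x • φ' (f x)) where
  ac := absolutelyContinuousOnInterval_comp hφ hf.ac
  hasDerivAt := by
    filter_upwards [hf.hasDerivAt] with x h1
    exact (hφ' (f x)).scomp x h1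

theorem integral [CompleteSpace E] (hab : a ≤ b) {h : ℝ → E} (hh : IntegrableOn h (Ioo a b)) :
    IsPrimitive a b (fun x => ∫ t in a..x, h t) h := by
  have hi := intervalIntegrable_of_Ioo hh (left_mem_Icc.2 hab) (right_mem_Icc.2 hab)
  refine ⟨absolutelyContinuousOnInterval_integral hi, ?_⟩
  rw [ae_restrict_iff' measurableSet_Ioo]
  filter_upwards [hi.ae_hasDerivAt_integral] with x hx hxI
  refine hx ?_ a left_mem_uIcc
  rw [uIcc_of_le hab]
  exact Ioo_subset_Icc_self hxI

theorem eq_left_of_deriv_zero (hab : a ≤ b) (hf : IsPrimitive a b f f')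
    (h : ∀ᵐ x ∂(volume.restrict (Ioo a b)), f' x = 0) : ∀ x ∈ Icc a b, f x = f a := by
  obtain ⟨C, hC⟩ := hf.ac.const_of_ae_hasDerivAt_zero
    (ae_mem_uIcc_of_ae_Ioo hab (hf.congr_deriv (g' := fun _ => 0) h).hasDerivAt)
  rw [uIcc_of_le hab] at hC
  intro x hx
  rw [hC x hx, hC a (left_mem_Icc.2 hab)]

theorem eq_add_integral [CompleteSpace E] (hab : a ≤ b) (hf : IsPrimitive a b f f')
    (hi : IntegrableOn f' (Ioo a b)) : ∀ x ∈ Icc a b, f x = f a + ∫ t in a..x, f' t := by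
  intro x hx
  have := (hf.sub (integral hab hi)).eq_left_of_deriv_zero hab (by simp) x hx
  simp only [intervalIntegral.integral_same, sub_zero] at this
  rw [← this]
  abel

/-- For real functions integrability of the derivative is part of absolute continuity, so the
real-valued fundamental theorem below needs no extra hypothesis. -/
theorem integrableOn {f f' : ℝ → ℝ} (hab : a ≤ b) (hf : IsPrimitive a b f f') :
    IntegrableOn f' (Ioo a b) := by
  have h1 := hf.ac.intervalIntegrable_deriv
  rw [intervalIntegrable_iff_integrableOn_Ioo_of_le hab] at h1
  refine h1.congr ?_
  filter_upwards [hf.hasDerivAt] with x hx using hx.deriv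

theorem sub_eq_integral {f f' : ℝ → ℝ} (hab : a ≤ b) (hf : IsPrimitive a b f f') {x y : ℝ}
    (hx : x ∈ Icc a b) (hy : y ∈ Icc a b) : f y - f x = ∫ t in x..y, f' t := by
  have hi := hf.integrableOn hab
  have ha := left_mem_Icc.2 hab
  rw [hf.eq_add_integral hab hi x hx, hf.eq_add_integral hab hi y hy, add_sub_add_left_eq_sub,
    intervalIntegral.integral_interval_sub_left (intervalIntegrable_of_Ioo hi ha hy)
      (intervalIntegrable_of_Ioo hi ha hx)]

end IsPrimitive

/-- A continuous (on `[a, b]`) bounded factor keeps integrability on `(a, b)`. -/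
theorem integrableOn_mul_continuousOn {𝕜 : Type*} [RCLike 𝕜] {a b : ℝ} {f g : ℝ → 𝕜}
    (hf : IntegrableOn f (Ioo a b)) (hg : ContinuousOn g (Icc a b)) :
    IntegrableOn (fun x => f x * g x) (Ioo a b) := by
  rw [← integrableOn_Icc_iff_integrableOn_Ioo] at hf ⊢
  exact hf.mul_continuousOn hg isCompact_Icc

/-! ### Scalar differential equations with integrable coefficients -/

theorem ae_restrict_Ioc_of_Ioo {a b t : ℝ} (ht : t ∈ Icc a b) {P : ℝ → Prop}
    (h : ∀ᵐ x ∂(volume.restrict (Ioo a b)), P x) : ∀ᵐ x ∂(volume.restrict (Ioc a t)), P x := by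
  rw [← Measure.restrict_congr_set (Ioo_ae_eq_Ioc (μ := volume) (a := a) (b := t))]
  exact ae_restrict_of_ae_restrict_of_subset (Ioo_subset_Ioo_right ht.2) h

/-- Carathéodory's existence theorem for a scalar equation with a global integrable Lipschitz
bound. -/
theorem exists_isPrimitive_of_lipschitz {a b : ℝ} (hab : a < b) {F : ℝ → ℝ → ℝ} {k : ℝ → ℝ}
    (hk : IntegrableOn k (Ioo a b))
    (hFi : ∀ θ : ℝ → ℝ, Continuous θ → IntegrableOn (fun x => F x (θ x)) (Ioo a b))
    (hF : ∀ᵐ x ∂(volume.restrict (Ioo a b)), ∀ y z, |F x y - F x z| ≤ k x * |y - z|) (θ₀ : ℝ) :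
    ∃ θ : ℝ → ℝ, θ a = θ₀ ∧ IsPrimitive a b θ (fun x => F x (θ x)) := by
  have hk0 : ∀ᵐ x ∂(volume.restrict (Ioo a b)), 0 ≤ k x := by
    filter_upwards [hF] with x hx
    have := (abs_nonneg _).trans (hx 0 1)
    simpa using this
  have ha : a ∈ Icc a b := left_mem_Icc.2 hab.le
  set K : ℝ → ℝ := fun x => ∫ t in a..x, k t with hKdef
  have hK : IsPrimitive a b K k := IsPrimitive.integral hab.le hk
  have hE : IsPrimitive a b (fun x => Real.exp (2 * K x)) (fun x => k x • (2 * Real.exp (2 * K x))) :=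
    hK.comp (φ := fun y => Real.exp (2 * y)) (φ' := fun y => 2 * Real.exp (2 * y)) (by fun_prop)
      (fun x => by simpa [mul_comm] using ((hasDerivAt_id x).const_mul 2).exp)
  set Kc : ℝ → ℝ := IccExtend hab.le ((Icc a b).domRestrict K) with hKc
  have hKcc : Continuous Kc := (continuousOn_iff_continuous_domRestrict.1 (hK.continuousOn hab.le)).Icc_extend'
  have hKce : ∀ x ∈ Icc a b, Kc x = K x := fun x hx => IccExtend_of_mem hab.le _ hx
  -- Here g stands for exp(-2K) θ. The sup norm of g is a weighted norm of θ in which the Picard map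
  -- contracts by 1/2 on the whole interval, however large ∫ k is. The extension beyond [a, b] is
  -- there because `hFi` expects functions continuous on ℝ.
  set lift : C(Icc a b, ℝ) → ℝ → ℝ := fun g x => Real.exp (2 * Kc x) * IccExtend hab.le g x with hlift
  have hlc : ∀ g, Continuous (lift g) := fun g =>
    (Real.continuous_exp.comp (hKcc.const_mul 2 |> fun h => h)).mul (g.continuous.Icc_extend' (h := hab.le))
  have hprim : ∀ g, IsPrimitive a b (fun t => θ₀ + ∫ s in a..t, F s (lift g s))
      (fun t => F t (lift g t)) := fun g => by
    simpa using (IsPrimitive.const θ₀).add (IsPrimitive.integral hab.le (hFi _ (hlc g)))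
  set T : C(Icc a b, ℝ) → C(Icc a b, ℝ) := fun g =>
    ⟨fun t => Real.exp (-(2 * K t)) * (θ₀ + ∫ s in a..(t : ℝ), F s (lift g s)),
      ((Real.continuous_exp.comp ((continuousOn_iff_continuous_domRestrict.1
        (hK.continuousOn hab.le)).const_mul 2).neg)).mul
        (continuousOn_iff_continuous_domRestrict.1 ((hprim g).continuousOn hab.le))⟩ with hT
  have hcontr : ContractingWith (1 / 2) T := by
    refine ⟨by norm_num, LipschitzWith.of_dist_le_mul fun g h => ?_⟩
    rw [ContinuousMap.dist_le (by positivity)]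
    rintro ⟨t, ht⟩
    have hat : a ≤ t := ht.1
    have hFg := intervalIntegrable_of_Ioo (hFi _ (hlc g)) ha ht
    have hFh := intervalIntegrable_of_Ioo (hFi _ (hlc h)) ha ht
    have hEi := hE.integrableOn hab.le
    have hEt := hE.sub_eq_integral hab.le ha ht
    have hKa : K a = 0 := by simp [hKdef]
    rw [hKa] at hEt
    -- The function k exp(2K) is half the derivative of exp(2K); this is the source of the factor
    -- 1/2.
    have hmain : |(∫ s in a..t, F s (lift g s)) - ∫ s in a..t, F s (lift h s)|
        ≤ ∫ s in a..t, (k s • (2 * Real.exp (2 * K s))) * (dist g h / 2) := by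
      rw [← intervalIntegral.integral_sub hFg hFh]
      rw [← Real.norm_eq_abs]
      refine intervalIntegral.norm_integral_le_of_norm_le hat ?_
        ((intervalIntegrable_of_Ioo hEi ha ht).mul_const _)
      have h1 := ae_restrict_Ioc_of_Ioo ht hF
      rw [ae_restrict_iff' measurableSet_Ioc] at h1
      have h2 := ae_restrict_Ioc_of_Ioo ht hk0
      rw [ae_restrict_iff' measurableSet_Ioc] at h2
      filter_upwards [h1, h2] with s hs hs2 hsI
      have hsab : s ∈ Icc a b := ⟨hsI.1.le, hsI.2.trans ht.2⟩
      refine (hs hsI _ _).trans ?_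
      have h3 : lift g s - lift h s = Real.exp (2 * K s) * (g ⟨s, hsab⟩ - h ⟨s, hsab⟩) := by
        simp only [hlift, hKce s hsab, IccExtend_of_mem hab.le _ hsab]
        ring
      rw [h3, abs_mul, abs_of_pos (Real.exp_pos _)]
      have h4 : |g ⟨s, hsab⟩ - h ⟨s, hsab⟩| ≤ dist g h := by
        rw [← Real.dist_eq]
        exact ContinuousMap.dist_apply_le_dist _
      have h5 : k s * (Real.exp (2 * K s) * |g ⟨s, hsab⟩ - h ⟨s, hsab⟩|)
          ≤ k s * (Real.exp (2 * K s) * dist g h) := by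
        have := hs2 hsI
        gcongr
      refine h5.trans (le_of_eq ?_)
      simp only [smul_eq_mul]
      ring
    rw [intervalIntegral.integral_mul_const, ← hEt] at hmain
    have h6 : T g ⟨t, ht⟩ - T h ⟨t, ht⟩ = Real.exp (-(2 * K t)) *
        ((∫ s in a..t, F s (lift g s)) - ∫ s in a..t, F s (lift h s)) := by
      change Real.exp (-(2 * K t)) * (θ₀ + _) - Real.exp (-(2 * K t)) * (θ₀ + _) = _
      ring
    rw [Real.dist_eq, h6, abs_mul, abs_of_pos (Real.exp_pos _)]
    have h7 : Real.exp (-(2 * K t)) * Real.exp (2 * K t) = 1 := by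
      rw [← Real.exp_add]
      simp
    calc Real.exp (-(2 * K t)) * |(∫ s in a..t, F s (lift g s)) - ∫ s in a..t, F s (lift h s)|
        ≤ Real.exp (-(2 * K t)) * ((Real.exp (2 * K t) - Real.exp (2 * 0)) * (dist g h / 2)) := by
          gcongr
      _ = (1 - Real.exp (-(2 * K t))) * (dist g h / 2) := by
          rw [mul_zero, Real.exp_zero]
          linear_combination (dist g h / 2) * h7
      _ ≤ 1 * (dist g h / 2) := by
          have := (Real.exp_pos (-(2 * K t))).le
          gcongr
          linarith
      _ = _ := by
          push_cast
          ring
  have : Nonempty C(Icc a b, ℝ) := ⟨0⟩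
  set g := hcontr.fixedPoint with hg
  have hfix : T g = g := hcontr.fixedPoint_isFixedPt
  have heq : ∀ x ∈ Icc a b, lift g x = θ₀ + ∫ s in a..x, F s (lift g s) := by
    intro x hx
    have h1 : g ⟨x, hx⟩ = Real.exp (-(2 * K x)) * (θ₀ + ∫ s in a..x, F s (lift g s)) := by
      conv_lhs => rw [← hfix]
      rfl
    have h2 : lift g x = Real.exp (2 * K x) * g ⟨x, hx⟩ := by
      simp only [hlift, hKce x hx, IccExtend_of_mem hab.le _ hx]
    rw [h2, h1, ← mul_assoc, ← Real.exp_add]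
    simp
  refine ⟨fun t => θ₀ + ∫ s in a..t, F s (lift g s), by simp, (hprim g).congr_deriv ?_⟩
  filter_upwards [ae_restrict_mem measurableSet_Ioo] with x hx
  rw [heq x (Ioo_subset_Icc_self hx)]

/-- Variation of constants for `d' = g d + h`. -/
theorem exp_neg_mul_eq_of_linear {a b : ℝ} (hab : a ≤ b) {d g h : ℝ → ℝ}
    (hg : IntegrableOn g (Ioo a b)) (hd : IsPrimitive a b d (fun x => g x * d x + h x)) :
    ∀ x ∈ Icc a b, ∀ y ∈ Icc a b,
      Real.exp (-∫ t in a..y, g t) * d y - Real.exp (-∫ t in a..x, g t) * d x =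
        ∫ t in x..y, Real.exp (-∫ s in a..t, g s) * h t := by
  intro x hx y hy
  have hG := IsPrimitive.integral hab hg
  have hE := hG.comp (φ := fun y => Real.exp (-y)) (φ' := fun y => -Real.exp (-y)) (by fun_prop)
    (fun x => by simpa using (hasDerivAt_id x).neg.exp)
  have h1 := (hE.mul hd).congr_deriv (g' := fun t => Real.exp (-∫ s in a..t, g s) * h t)
    (Filter.Eventually.of_forall fun t => by simp only [smul_eq_mul]; ring)
  exact h1.sub_eq_integral hab hx hy

/-- The integrating factor exp(-∫ g) is positive, and d multiplied by it has a nonnegative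
derivative. -/
theorem nonneg_of_linear {a b : ℝ} (hab : a ≤ b) {d g h : ℝ → ℝ} (hg : IntegrableOn g (Ioo a b))
    (hd : IsPrimitive a b d (fun x => g x * d x + h x))
    (hh : ∀ᵐ x ∂(volume.restrict (Ioo a b)), 0 ≤ h x) {x y : ℝ} (hx : x ∈ Icc a b)
    (hy : y ∈ Icc a b) (hxy : x ≤ y) (hdx : 0 ≤ d x) : 0 ≤ d y := by
  have h1 := exp_neg_mul_eq_of_linear hab hg hd x hx y hy
  have h2 : 0 ≤ ∫ t in x..y, Real.exp (-∫ s in a..t, g s) * h t := by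
    refine intervalIntegral.integral_nonneg_of_ae_restrict hxy ?_
    rw [← Measure.restrict_congr_set (Ioo_ae_eq_Icc (μ := volume) (a := x) (b := y))]
    filter_upwards [ae_restrict_of_ae_restrict_of_subset (Ioo_subset_Ioo hx.1 hy.2) hh] with t ht
    positivity
  have h3 : 0 ≤ Real.exp (-∫ t in a..x, g t) * d x := by positivity
  exact nonneg_of_mul_nonneg_right (by linarith : 0 ≤ Real.exp (-∫ t in a..y, g t) * d y)
    (Real.exp_pos _)

/-- Strict positivity at the right endpoint, unless the inhomogeneity vanishes. -/
theorem pos_of_linear {a b : ℝ} (hab : a ≤ b) {d g h : ℝ → ℝ} (hg : IntegrableOn g (Ioo a b))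
    (hd : IsPrimitive a b d (fun x => g x * d x + h x))
    (hh : ∀ᵐ x ∂(volume.restrict (Ioo a b)), 0 ≤ h x)
    (hne : ¬ ∀ᵐ x ∂(volume.restrict (Ioo a b)), h x = 0) (hda : 0 ≤ d a) : 0 < d b := by
  have ha := left_mem_Icc.2 hab
  have hb := right_mem_Icc.2 hab
  have h0 := nonneg_of_linear hab hg hd hh ha hb hab hda
  refine h0.lt_of_ne' fun hdb => hne ?_
  have h1 := exp_neg_mul_eq_of_linear hab hg hd a ha b hb
  have hG := IsPrimitive.integral hab hg
  have hE := hG.comp (φ := fun y => Real.exp (-y)) (φ' := fun y => -Real.exp (-y)) (by fun_prop)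
    (fun x => by simpa using (hasDerivAt_id x).neg.exp)
  have hint : IntegrableOn (fun t => Real.exp (-∫ s in a..t, g s) * h t) (Ioo a b) := by
    refine ((hE.mul hd).congr_deriv (g' := fun t => Real.exp (-∫ s in a..t, g s) * h t)
      (Filter.Eventually.of_forall fun t => by simp only [smul_eq_mul]; ring)).integrableOn hab
  have hnn : ∀ᵐ x ∂(volume.restrict (Ioo a b)), 0 ≤ Real.exp (-∫ s in a..x, g s) * h x := by
    filter_upwards [hh] with x hx
    positivity
  -- If d(b) = 0, variation of constants makes the integral of a nonnegative function at most 0, so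
  -- that function vanishes almost everywhere.
  have h2 : ∫ t in a..b, Real.exp (-∫ s in a..t, g s) * h t ≤ 0 := by
    rw [← h1, hdb]
    simp only [mul_zero, intervalIntegral.integral_same, neg_zero, Real.exp_zero, one_mul, zero_sub]
    linarith
  rw [intervalIntegral.integral_of_le hab, integral_Ioc_eq_integral_Ioo] at h2
  have h3 := (integral_eq_zero_iff_of_nonneg_ae hnn hint).1
    (le_antisymm h2 (integral_nonneg_of_ae hnn))
  filter_upwards [h3] with x hx
  simpa [(Real.exp_pos _).ne'] using hx

/-- In d(b) = exp(G(b)) ∫ exp(-G) h, with G = ∫ g, each exponential is at most exp(∫ |g|); hence the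
factor 2 in the exponent. -/
theorem abs_le_of_linear {a b : ℝ} (hab : a ≤ b) {d g h : ℝ → ℝ} (hg : IntegrableOn g (Ioo a b))
    (hh : IntegrableOn h (Ioo a b)) (hd : IsPrimitive a b d (fun x => g x * d x + h x))
    (hda : d a = 0) :
    |d b| ≤ Real.exp (2 * ∫ x in Ioo a b, |g x|) * ∫ x in Ioo a b, |h x| := by
  have ha := left_mem_Icc.2 hab
  have hb := right_mem_Icc.2 hab
  have h1 := exp_neg_mul_eq_of_linear hab hg hd a ha b hb
  rw [hda, mul_zero, sub_zero] at h1
  set M := ∫ x in Ioo a b, |g x| with hM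
  have hGle : ∀ x ∈ Icc a b, |∫ t in a..x, g t| ≤ M := by
    intro x hx
    refine (intervalIntegral.abs_integral_le_integral_abs hx.1).trans ?_
    rw [intervalIntegral.integral_of_le hx.1, integral_Ioc_eq_integral_Ioo]
    exact setIntegral_mono_set hg.abs (Filter.Eventually.of_forall fun _ => abs_nonneg _)
      (Ioo_subset_Ioo_right hx.2).eventuallyLE
  have h2 : |∫ t in a..b, Real.exp (-∫ s in a..t, g s) * h t| ≤ Real.exp M * ∫ x in Ioo a b, |h x| := by
    rw [← integral_const_mul, ← integral_Ioc_eq_integral_Ioo, ← intervalIntegral.integral_of_le hab]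
    rw [← Real.norm_eq_abs]
    refine intervalIntegral.norm_integral_le_of_norm_le hab ?_
      ((intervalIntegrable_of_Ioo hh.abs ha hb).const_mul _)
    refine Filter.Eventually.of_forall fun t ht => ?_
    rw [norm_mul, Real.norm_eq_abs, Real.norm_eq_abs, abs_of_pos (Real.exp_pos _)]
    gcongr
    exact (neg_le_abs _).trans (hGle t (Ioc_subset_Icc_self ht))
  have h3 : d b = Real.exp (∫ t in a..b, g t) * ∫ t in a..b, Real.exp (-∫ s in a..t, g s) * h t := by
    rw [← h1, ← mul_assoc, ← Real.exp_add]
    simp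
  rw [h3, abs_mul, abs_of_pos (Real.exp_pos _), two_mul, Real.exp_add, mul_assoc]
  gcongr
  exact (le_abs_self _).trans (hGle b hb)

/-! ### The Prüfer equation -/

/-- `θ` solves the Prüfer equation `θ' = p⁻¹ cos² θ + (μ r - q) sin² θ`. -/
def IsPruferSolution (a b : ℝ) (p q r : ℝ → ℝ) (μ : ℝ) (θ : ℝ → ℝ) : Prop :=
  IsPrimitive a b θ
    (fun x => (p x)⁻¹ * Real.cos (θ x) ^ 2 + (μ * r x - q x) * Real.sin (θ x) ^ 2)

theorem IsRegular.integrable_potential {a b : ℝ} {p q r : ℝ → ℝ} (hreg : IsRegular a b p q r)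
    (μ : ℝ) : IntegrableOn (fun x => μ * r x - q x) (Ioo a b) :=
  (hreg.integrable_r.const_mul μ).sub hreg.integrable_q

/-- Factoring out x - y makes the difference of two Prüfer angles solve a linear equation;
`Real.sinc` removes the singularity at x = y and keeps the coefficient continuous and bounded by 1.
-/
theorem sin_sq_sub_sin_sq (x y : ℝ) :
    Real.sin x ^ 2 - Real.sin y ^ 2 = Real.sin (x + y) * Real.sinc (x - y) * (x - y) := by
  have h1 : Real.sin (x + y) * Real.sin (x - y) = Real.sin x ^ 2 - Real.sin y ^ 2 := by
    rw [Real.sin_add, Real.sin_sub]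
    have h2 := Real.sin_sq_add_cos_sq x
    have h3 := Real.sin_sq_add_cos_sq y
    linear_combination Real.sin x ^ 2 * h3 - Real.sin y ^ 2 * h2
  rcases eq_or_ne (x - y) 0 with h | h
  · rw [h, mul_zero, sub_eq_zero.1 h, sub_self]
  · rw [Real.sinc_of_ne_zero h, mul_assoc, div_mul_cancel₀ _ h, h1]

theorem abs_sin_mul_sinc_le_one (x y : ℝ) : |Real.sin x * Real.sinc y| ≤ 1 := by
  rw [abs_mul]
  exact mul_le_one₀ (Real.abs_sin_le_one x) (abs_nonneg _) (Real.abs_sinc_le_one y)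

theorem abs_sin_sq_sub_sin_sq_le (x y : ℝ) :
    |Real.sin x ^ 2 - Real.sin y ^ 2| ≤ |x - y| := by
  rw [sin_sq_sub_sin_sq, abs_mul]
  exact mul_le_of_le_one_left (abs_nonneg _) (abs_sin_mul_sinc_le_one _ _)

section

variable {a b : ℝ} {p q r : ℝ → ℝ}

theorem exists_isPruferSolution (hab : a < b) (hreg : IsRegular a b p q r) (μ θ₀ : ℝ) :
    ∃ θ : ℝ → ℝ, θ a = θ₀ ∧ IsPruferSolution a b p q r μ θ := by
  refine exists_isPrimitive_of_lipschitz hab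
    (F := fun x y => (p x)⁻¹ * Real.cos y ^ 2 + (μ * r x - q x) * Real.sin y ^ 2)
    (k := fun x => |(μ * r x - q x) - (p x)⁻¹|)
    ((hreg.integrable_potential μ).sub hreg.integrable_inv_p).abs ?_ ?_ θ₀
  · intro θ hθ
    exact (integrableOn_mul_continuousOn hreg.integrable_inv_p (by fun_prop)).add
      (integrableOn_mul_continuousOn (hreg.integrable_potential μ) (by fun_prop))
  · refine Filter.Eventually.of_forall fun x y z => ?_
    have : (p x)⁻¹ * Real.cos y ^ 2 + (μ * r x - q x) * Real.sin y ^ 2 -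
        ((p x)⁻¹ * Real.cos z ^ 2 + (μ * r x - q x) * Real.sin z ^ 2) =
        ((μ * r x - q x) - (p x)⁻¹) * (Real.sin y ^ 2 - Real.sin z ^ 2) := by
      rw [Real.cos_sq', Real.cos_sq']
      ring
    rw [this, abs_mul]
    exact mul_le_mul_of_nonneg_left (abs_sin_sq_sub_sin_sq_le y z) (abs_nonneg _)

theorem volume_restrict_Ioo_ne_zero (hab : a < b) : volume.restrict (Ioo a b) ≠ 0 := by
  rw [Ne, Measure.restrict_eq_zero, Real.volume_Ioo]
  simpa using hab

theorem not_ae_eq_zero_of_ae_pos (hab : a < b) {h : ℝ → ℝ}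
    (hh : ∀ᵐ x ∂(volume.restrict (Ioo a b)), 0 < h x) :
    ¬ ∀ᵐ x ∂(volume.restrict (Ioo a b)), h x = 0 := by
  intro h0
  have := ae_neBot.2 (volume_restrict_Ioo_ne_zero hab)
  obtain ⟨x, h1, h2⟩ := (hh.and h0).exists
  exact h1.ne' h2

namespace IsPruferSolution

/-- After cos² = 1 - sin² the unknown enters the equation only through sin². The change of spectral
parameter becomes an inhomogeneity with the sign of ν - μ wherever r > 0. -/
theorem isPrimitive_sub {μ ν : ℝ} {θ₁ θ₂ : ℝ → ℝ} (h₁ : IsPruferSolution a b p q r μ θ₁)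
    (h₂ : IsPruferSolution a b p q r ν θ₂) :
    IsPrimitive a b (fun x => θ₂ x - θ₁ x) (fun x =>
      (((ν * r x - q x) - (p x)⁻¹) * (Real.sin (θ₂ x + θ₁ x) * Real.sinc (θ₂ x - θ₁ x))) *
        (θ₂ x - θ₁ x) + (ν - μ) * r x * Real.sin (θ₁ x) ^ 2) := by
  refine (IsPrimitive.sub h₂ h₁).congr_deriv (Filter.Eventually.of_forall fun x => ?_)
  rw [Real.cos_sq', Real.cos_sq']
  linear_combination ((ν * r x - q x) - (p x)⁻¹) * sin_sq_sub_sin_sq (θ₂ x) (θ₁ x)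

theorem integrable_coeff (hab : a < b) (hreg : IsRegular a b p q r) {μ ν : ℝ} {θ₁ θ₂ : ℝ → ℝ}
    (h₁ : IsPruferSolution a b p q r μ θ₁) (h₂ : IsPruferSolution a b p q r ν θ₂) :
    IntegrableOn (fun x => ((ν * r x - q x) - (p x)⁻¹) *
      (Real.sin (θ₂ x + θ₁ x) * Real.sinc (θ₂ x - θ₁ x))) (Ioo a b) := by
  have c1 := IsPrimitive.continuousOn h₁ hab.le
  have c2 := IsPrimitive.continuousOn h₂ hab.le
  exact integrableOn_mul_continuousOn
    ((hreg.integrable_potential ν).sub hreg.integrable_inv_p)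
    ((Real.continuous_sin.comp_continuousOn (c2.add c1)).mul
      (Real.continuous_sinc.comp_continuousOn (c2.sub c1)))

/-- If sin θ vanished almost everywhere it would vanish on all of (a, b) by continuity; but where
sin θ = 0 its derivative is p⁻¹ cos³ θ, which is not 0. -/
theorem not_sin_ae_eq_zero (hab : a < b) (hreg : IsRegular a b p q r) {μ : ℝ} {θ : ℝ → ℝ}
    (h : IsPruferSolution a b p q r μ θ) :
    ¬ ∀ᵐ x ∂(volume.restrict (Ioo a b)), Real.sin (θ x) = 0 := by
  intro h0
  have hc := (IsPrimitive.continuousOn h hab.le).mono Ioo_subset_Icc_self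
  have h1 : ∀ x ∈ Ioo a b, Real.sin (θ x) = 0 :=
    Measure.eqOn_open_of_ae_eq (g := fun _ => (0 : ℝ)) h0 isOpen_Ioo
      (Real.continuous_sin.comp_continuousOn hc) continuousOn_const
  have h2 := (IsPrimitive.comp (φ := Real.sin) (φ' := Real.cos) Real.contDiff_sin
    Real.hasDerivAt_sin h).hasDerivAt
  have := ae_neBot.2 (volume_restrict_Ioo_ne_zero hab)
  obtain ⟨x, ⟨⟨h3, h4⟩, hx⟩⟩ := ((h2.and hreg.p_pos).and (ae_restrict_mem measurableSet_Ioo)).exists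
  have h5 := h3.unique ((hasDerivAt_const x (0 : ℝ)).congr_of_eventuallyEq (by
    filter_upwards [isOpen_Ioo.mem_nhds hx] with y hy using h1 y hy))
  have h6 := Real.sin_sq_add_cos_sq (θ x)
  rw [h1 x hx] at h5 h6
  have h7 : Real.cos (θ x) ≠ 0 := by
    intro h8
    rw [h8] at h6
    norm_num at h6
  have h9 := inv_pos.2 h4
  simp only [smul_eq_mul, mul_eq_zero, h7, or_false] at h5
  have h10 : Real.cos (θ x) ^ 2 = 1 := by linarith
  rw [h10] at h5
  norm_num at h5
  exact h4.ne' h5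

/-- Sturm comparison: the inhomogeneity (ν - μ) r sin² θ₁ is nonnegative and not almost everywhere
zero, so the difference of the angles is strictly positive at `b`. -/
theorem lt_of_lt (hab : a < b) (hreg : IsRegular a b p q r) {μ ν : ℝ} (hμν : μ < ν)
    {θ₁ θ₂ : ℝ → ℝ} (h₁ : IsPruferSolution a b p q r μ θ₁) (h₂ : IsPruferSolution a b p q r ν θ₂)
    (ha : θ₁ a = θ₂ a) : θ₁ b < θ₂ b := by
  have h0 : 0 < ν - μ := sub_pos.2 hμν
  refine sub_pos.1 (pos_of_linear hab.le (integrable_coeff hab hreg h₁ h₂)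
    (isPrimitive_sub h₁ h₂) ?_ ?_ (by simp [ha]))
  · filter_upwards [hreg.r_pos] with x hx
    positivity
  · intro h3
    refine not_sin_ae_eq_zero hab hreg h₁ ?_
    filter_upwards [h3, hreg.r_pos] with x hx hr
    simpa [h0.ne', hr.ne'] using hx

/-- The constant depends on the parameters only through the bound `M` for |ν|, so this is a local
Lipschitz estimate in the spectral parameter. -/
theorem abs_sub_le (hab : a < b) (hreg : IsRegular a b p q r) {M μ ν : ℝ}
    (hν : |ν| ≤ M) {θ₁ θ₂ : ℝ → ℝ} (h₁ : IsPruferSolution a b p q r μ θ₁)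
    (h₂ : IsPruferSolution a b p q r ν θ₂) (ha : θ₁ a = θ₂ a) :
    |θ₂ b - θ₁ b| ≤ Real.exp (2 * ∫ x in Ioo a b, (M * |r x| + |q x| + |(p x)⁻¹|)) *
      (∫ x in Ioo a b, |r x|) * |ν - μ| := by
  have c1 := IsPrimitive.continuousOn h₁ hab.le
  have hh : IntegrableOn (fun x => (ν - μ) * r x * Real.sin (θ₁ x) ^ 2) (Ioo a b) :=
    integrableOn_mul_continuousOn (hreg.integrable_r.const_mul _)
      ((Real.continuous_sin.comp_continuousOn c1).pow 2)
  have hg := integrable_coeff hab hreg h₁ h₂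
  refine (abs_le_of_linear hab.le hg hh (isPrimitive_sub h₁ h₂) (by simp [ha])).trans ?_
  rw [mul_assoc]
  refine mul_le_mul (Real.exp_le_exp.2 (mul_le_mul_of_nonneg_left ?_ zero_le_two)) ?_
    (by positivity) (by positivity)
  · refine setIntegral_mono hg.abs (((hreg.integrable_r.abs.const_mul M).add
      hreg.integrable_q.abs).add hreg.integrable_inv_p.abs) fun x => ?_
    rw [abs_mul]
    refine (mul_le_of_le_one_right (abs_nonneg _) (abs_sin_mul_sinc_le_one _ _)).trans ?_
    refine (abs_sub _ _).trans (add_le_add_left ((abs_sub _ _).trans (add_le_add_left ?_ _)) _)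
    rw [abs_mul]
    gcongr
  · rw [← integral_mul_const]
    refine setIntegral_mono hh.abs (hreg.integrable_r.abs.mul_const _) fun x => ?_
    dsimp only
    rw [abs_mul, abs_mul, mul_comm |r x|]
    refine mul_le_of_le_one_right (by positivity) ?_
    rw [abs_of_nonneg (sq_nonneg _)]
    exact Real.sin_sq_le_one _

/-- Comparison with the constant angle 0, where the right-hand side of the Prüfer equation is p⁻¹ >
0: this is what prevents an angle from falling below 0. -/
theorem isPrimitive_self {μ : ℝ} {θ : ℝ → ℝ} (h : IsPruferSolution a b p q r μ θ) :
    IsPrimitive a b θ (fun x =>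
      (((μ * r x - q x) - (p x)⁻¹) * (Real.sin (θ x) * Real.sinc (θ x))) * θ x + (p x)⁻¹) := by
  refine IsPrimitive.congr_deriv h (Filter.Eventually.of_forall fun x => ?_)
  have h1 := sin_sq_sub_sin_sq (θ x) 0
  simp only [Real.sin_zero, add_zero, sub_zero, ne_eq, OfNat.ofNat_ne_zero, not_false_eq_true,
    zero_pow] at h1
  rw [Real.cos_sq']
  linear_combination ((μ * r x - q x) - (p x)⁻¹) * h1

theorem integrable_coeff_self (hab : a < b) (hreg : IsRegular a b p q r) {μ : ℝ} {θ : ℝ → ℝ}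
    (h : IsPruferSolution a b p q r μ θ) :
    IntegrableOn (fun x => ((μ * r x - q x) - (p x)⁻¹) * (Real.sin (θ x) * Real.sinc (θ x)))
      (Ioo a b) := by
  have c := IsPrimitive.continuousOn h hab.le
  exact integrableOn_mul_continuousOn
    ((hreg.integrable_potential μ).sub hreg.integrable_inv_p)
    ((Real.continuous_sin.comp_continuousOn c).mul (Real.continuous_sinc.comp_continuousOn c))

theorem nonneg (hab : a < b) (hreg : IsRegular a b p q r) {μ : ℝ} {θ : ℝ → ℝ}
    (h : IsPruferSolution a b p q r μ θ) (ha : 0 ≤ θ a) {x : ℝ} (hx : x ∈ Icc a b) : 0 ≤ θ x := by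
  refine nonneg_of_linear hab.le (integrable_coeff_self hab hreg h) (isPrimitive_self h) ?_
    (left_mem_Icc.2 hab.le) hx hx.1 ha
  filter_upwards [hreg.p_pos] with x hx using (inv_pos.2 hx).le

theorem pos_right (hab : a < b) (hreg : IsRegular a b p q r) {μ : ℝ} {θ : ℝ → ℝ}
    (h : IsPruferSolution a b p q r μ θ) (ha : 0 ≤ θ a) : 0 < θ b := by
  have hp : ∀ᵐ x ∂(volume.restrict (Ioo a b)), 0 < (p x)⁻¹ := by
    filter_upwards [hreg.p_pos] with x hx using inv_pos.2 hx
  refine pos_of_linear hab.le (integrable_coeff_self hab hreg h) (isPrimitive_self h)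
    (hp.mono fun x hx => hx.le) (not_ae_eq_zero_of_ae_pos hab hp) ha

/-- At most p⁻¹ + |q| can push the angle upwards; for μ ≤ 0 the weight term pushes it downwards, and
does so effectively where sin² θ stays away from 0. -/
theorem sub_le (hab : a < b) (hreg : IsRegular a b p q r) {μ δ : ℝ} (hμ : μ ≤ 0) {θ : ℝ → ℝ}
    (h : IsPruferSolution a b p q r μ θ) {x y : ℝ} (hx : x ∈ Icc a b) (hy : y ∈ Icc a b)
    (hxy : x ≤ y) (hδ : ∀ t ∈ Ioo x y, δ ≤ Real.sin (θ t) ^ 2) :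
    θ y - θ x ≤ (∫ t in x..y, ((p t)⁻¹ + |q t|)) + μ * δ * ∫ t in x..y, r t := by
  have i1 : IntervalIntegrable (fun t => (p t)⁻¹ + |q t|) volume x y :=
    intervalIntegrable_of_Ioo (hreg.integrable_inv_p.add hreg.integrable_q.abs) hx hy
  have i2 := intervalIntegrable_of_Ioo hreg.integrable_r hx hy
  rw [IsPrimitive.sub_eq_integral hab.le h hx hy, ← intervalIntegral.integral_const_mul,
    ← intervalIntegral.integral_add i1 (i2.const_mul _)]
  refine intervalIntegral.integral_mono_ae_restrict hxy
    (intervalIntegrable_of_Ioo (IsPrimitive.integrableOn hab.le h) hx hy)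
    (i1.add (i2.const_mul _)) ?_
  rw [← Measure.restrict_congr_set (Ioo_ae_eq_Icc (μ := volume) (a := x) (b := y))]
  have hsub := Ioo_subset_Ioo hx.1 hy.2
  filter_upwards [ae_restrict_of_ae_restrict_of_subset hsub hreg.p_pos,
    ae_restrict_of_ae_restrict_of_subset hsub hreg.r_pos,
    ae_restrict_mem measurableSet_Ioo] with t hp hr ht
  have hs := hδ t ht
  have hs1 := Real.sin_sq_le_one (θ t)
  have hc1 := Real.cos_sq_le_one (θ t)
  have h1 : (p t)⁻¹ * Real.cos (θ t) ^ 2 ≤ (p t)⁻¹ :=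
    mul_le_of_le_one_right (inv_pos.2 hp).le hc1
  have h2 : -q t * Real.sin (θ t) ^ 2 ≤ |q t| :=
    (mul_le_mul_of_nonneg_right (neg_le_abs _) (sq_nonneg _)).trans
      (mul_le_of_le_one_right (abs_nonneg _) hs1)
  have h3 : (-μ * r t) * δ ≤ (-μ * r t) * Real.sin (θ t) ^ 2 :=
    mul_le_mul_of_nonneg_left hs (mul_nonneg (neg_nonneg.2 hμ) hr.le)
  linarith

end IsPruferSolution

/-! ### The Prüfer angle as the spectral parameter tends to -∞ -/

theorem integral_pos_of_ae_pos {h : ℝ → ℝ} (hi : IntegrableOn h (Ioo a b))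
    (hh : ∀ᵐ x ∂(volume.restrict (Ioo a b)), 0 < h x) {x y : ℝ} (hx : x ∈ Icc a b)
    (hy : y ∈ Icc a b) (hxy : x < y) : 0 < ∫ t in x..y, h t := by
  have hsub := Ioo_subset_Ioo hx.1 hy.2
  have hh' := ae_restrict_of_ae_restrict_of_subset hsub hh
  refine pos_of_linear hxy.le (d := fun z => ∫ t in x..z, h t) (g := fun _ => 0) (h := h)
    integrableOn_zero ?_ (hh'.mono fun t ht => ht.le) (not_ae_eq_zero_of_ae_pos hxy hh') (by simp)
  simpa using IsPrimitive.integral hxy.le (hi.mono_set hsub)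

/-- As `μ → -∞`, a Prüfer angle that starts below `π` ends arbitrarily close to `0`. -/
theorem eventually_prufer_lt (hab : a < b) (hreg : IsRegular a b p q r) {α ε : ℝ} (hα0 : 0 ≤ α)
    (hα : α < Real.pi) (hε : 0 < ε) :
    ∀ᶠ M : ℝ in Filter.atTop, ∀ θ : ℝ → ℝ, θ a = α → IsPruferSolution a b p q r (-M) θ →
      θ b < ε := by
  -- The bound reached at b will be 2δ < ε. The condition 4δ ≤ π - α puts the initial value α below
  -- π - 2δ and, as α ≥ 0, gives 2δ ≤ π - 2δ, so that the estimate on one cell can be iterated.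
  set δ := min ε (Real.pi - α) / 4 with hδ
  have hδ0 : 0 < δ := by
    have : 0 < min ε (Real.pi - α) := lt_min hε (sub_pos.2 hα)
    positivity
  have hδε : 4 * δ ≤ ε := by
    rw [hδ]
    linarith [min_le_left ε (Real.pi - α)]
  have hδα : 4 * δ ≤ Real.pi - α := by
    rw [hδ]
    linarith [min_le_right ε (Real.pi - α)]
  set k : ℝ → ℝ := fun t => (p t)⁻¹ + |q t| with hk
  have hki : IntegrableOn k (Ioo a b) := hreg.integrable_inv_p.add hreg.integrable_q.abs
  have hk0 : ∀ᵐ x ∂(volume.restrict (Ioo a b)), 0 ≤ k x := by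
    filter_upwards [hreg.p_pos] with x hx
    have := inv_pos.2 hx
    positivity
  have hkk : ∀ x ∈ Icc a b, ∀ y ∈ Icc a b, x ≤ y → ∀ z ∈ Icc x y, ∫ t in x..z, k t ≤ ∫ t in x..y, k t := by
    intro x hx y hy hxy z hz
    have hz' : z ∈ Icc a b := ⟨hx.1.trans hz.1, hz.2.trans hy.2⟩
    rw [← intervalIntegral.integral_add_adjacent_intervals
      (intervalIntegrable_of_Ioo hki hx hz') (intervalIntegrable_of_Ioo hki hz' hy)]
    have : 0 ≤ ∫ t in z..y, k t := by
      refine intervalIntegral.integral_nonneg_of_ae_restrict hz.2 ?_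
      rw [← Measure.restrict_congr_set (Ioo_ae_eq_Icc (μ := volume) (a := z) (b := y))]
      exact ae_restrict_of_ae_restrict_of_subset (Ioo_subset_Ioo hz'.1 hy.2) hk0
    linarith
  -- a partition on whose cells the integral of `k` is small
  obtain ⟨η, hη, hηk⟩ := Metric.uniformContinuousOn_iff.1
    (IsPrimitive.integral hab.le hki).ac.uniformContinuousOn δ hδ0
  rw [uIcc_of_le hab.le] at hηk
  obtain ⟨N, hN⟩ := exists_nat_gt ((b - a) / η)
  have hba := sub_pos.2 hab
  have hN0 : (0 : ℝ) < N := lt_of_le_of_lt (by positivity) hN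
  set x : ℕ → ℝ := fun i => a + i * ((b - a) / N) with hx
  have hx0 : x 0 = a := by simp [hx]
  have hxN : x N = b := by
    simp only [hx]
    field_simp
    ring
  have hxs : ∀ i, x (i + 1) = x i + (b - a) / N := fun i => by
    simp only [hx]
    push_cast
    ring
  have hxlt : ∀ i, x i < x (i + 1) := fun i => by
    rw [hxs]
    have : 0 < (b - a) / N := by positivity
    linarith
  have hxm : StrictMono x := strictMono_nat_of_lt_succ hxlt
  have hxI : ∀ i ≤ N, x i ∈ Icc a b := fun i hi =>
    ⟨hx0 ▸ hxm.monotone (Nat.zero_le i), hxN ▸ hxm.monotone hi⟩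
  have hstep : (b - a) / N < η := by
    rw [div_lt_iff₀ hη] at hN
    rw [div_lt_iff₀ hN0, mul_comm]
    exact hN
  have hcell : ∀ i < N, ∫ t in x i..x (i + 1), k t ≤ δ := by
    intro i hi
    have h1 := hxI i hi.le
    have h2 := hxI (i + 1) hi
    have h3 := hηk _ h2 _ h1 (by rw [Real.dist_eq, hxs, add_sub_cancel_left, abs_of_pos (by positivity)]; exact hstep)
    have ha := left_mem_Icc.2 hab.le
    rw [Real.dist_eq, intervalIntegral.integral_interval_sub_left
      (intervalIntegrable_of_Ioo hki ha h2) (intervalIntegrable_of_Ioo hki ha h1)] at h3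
    exact ((le_abs_self _).trans_lt h3).le
  have hsin : 0 < Real.sin δ := Real.sin_pos_of_pos_of_lt_pi hδ0 (by linarith)
  -- For large M, a cell on which sin² θ ≥ sin² δ throughout would lower the angle by more than π.
  have hev : ∀ᶠ M : ℝ in Filter.atTop, ∀ i ∈ Finset.range N,
      Real.pi < M * (Real.sin δ ^ 2 * ∫ t in x i..x (i + 1), r t) := by
    rw [Filter.eventually_all_finset]
    intro i hi
    rw [Finset.mem_range] at hi
    have h1 : 0 < ∫ t in x i..x (i + 1), r t :=
      integral_pos_of_ae_pos hreg.integrable_r hreg.r_pos (hxI i hi.le) (hxI (i + 1) hi) (hxlt i)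
    exact (Filter.tendsto_id.atTop_mul_const (by positivity)).eventually_gt_atTop _
  filter_upwards [hev, Filter.eventually_ge_atTop 0] with M hM hM0 θ hθa hθ
  have hnn : ∀ z ∈ Icc a b, 0 ≤ θ z := fun z hz => hθ.nonneg hab hreg (by rw [hθa]; exact hα0) hz
  have hcont := IsPrimitive.continuousOn hθ hab.le
  have hgrow : ∀ i < N, ∀ y ∈ Icc (x i) (x (i + 1)), ∀ z ∈ Icc y (x (i + 1)), θ z - θ y ≤ δ := by
    intro i hi y hy z hz
    have h1 := hxI i hi.le
    have h2 := hxI (i + 1) hi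
    have hy' : y ∈ Icc a b := ⟨h1.1.trans hy.1, hy.2.trans h2.2⟩
    have hz' : z ∈ Icc a b := ⟨hy'.1.trans hz.1, hz.2.trans h2.2⟩
    have h3 := hθ.sub_le hab hreg (neg_nonpos.2 hM0) (δ := 0) hy' hz' hz.1
      (fun t _ => sq_nonneg _)
    rw [mul_zero, zero_mul, add_zero] at h3
    have h4 := hkk _ hy' _ h2 hy.2 z hz
    have h5 : ∫ t in y..x (i + 1), k t ≤ ∫ t in x i..x (i + 1), k t := by
      have h6 : 0 ≤ ∫ t in x i..y, k t := by
        have := hkk _ h1 _ hy' hy.1 (x i) (left_mem_Icc.2 hy.1)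
        simpa using this
      rw [← intervalIntegral.integral_add_adjacent_intervals
        (intervalIntegrable_of_Ioo hki h1 hy') (intervalIntegrable_of_Ioo hki hy' h2)]
      linarith
    exact h3.trans (h4.trans (h5.trans (hcell i hi)))
  -- Suppose the angle ends the cell above 2δ. It rises by at most δ inside the cell, so it stays
  -- between δ and π - δ there, and sin² θ ≥ sin² δ. The weight term then forces it below 0,
  -- contradicting `hnn`.
  have hdrop : ∀ i < N, θ (x i) ≤ Real.pi - 2 * δ → θ (x (i + 1)) ≤ 2 * δ := by
    intro i hi hxi
    have h1 := hxI i hi.le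
    have h2 := hxI (i + 1) hi
    by_contra! hcon
    have hbig : ∀ y ∈ Icc (x i) (x (i + 1)), δ < θ y := by
      intro y hy
      have := hgrow i hi y hy (x (i + 1)) (right_mem_Icc.2 hy.2)
      linarith
    have hsinb : ∀ t ∈ Ioo (x i) (x (i + 1)), Real.sin δ ^ 2 ≤ Real.sin (θ t) ^ 2 := by
      intro t ht
      have ht' := Ioo_subset_Icc_self ht
      have h3 := hbig t ht'
      have h4 := hgrow i hi (x i) (left_mem_Icc.2 (hxlt i).le) t ht'
      refine pow_le_pow_left₀ hsin.le ?_ 2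
      rcases le_total (θ t) (Real.pi / 2) with h5 | h5
      · exact Real.sin_le_sin_of_le_of_le_pi_div_two (by linarith) h5 h3.le
      · rw [← Real.sin_pi_sub (θ t)]
        exact Real.sin_le_sin_of_le_of_le_pi_div_two (by linarith) (by linarith) (by linarith)
    have h6 := hθ.sub_le hab hreg (neg_nonpos.2 hM0) h1 h2 (hxlt i).le hsinb
    have h7 := hM i (Finset.mem_range.2 hi)
    have h8 := hcell i hi
    have h9 := hnn _ h2
    have h10 : -M * Real.sin δ ^ 2 * ∫ t in x i..x (i + 1), r t =
      -(M * (Real.sin δ ^ 2 * ∫ t in x i..x (i + 1), r t)) := by ring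
    rw [h10] at h6
    linarith
  have hall : ∀ i ≤ N, θ (x i) ≤ Real.pi - 2 * δ := by
    intro i
    induction i with
    | zero =>
      intro _
      rw [hx0, hθa]
      linarith
    | succ i ih =>
      intro hi
      have := hdrop i hi (ih (by omega))
      linarith [hα0]
  have hNpos : 0 < N := by exact_mod_cast hN0
  have := hdrop (N - 1) (by omega) (hall _ (by omega))
  rw [Nat.sub_add_cancel hNpos, hxN] at this
  linarith

end
/-! ### Counting the values of the spectral parameter that hit the boundary angle -/

section

variable {a b : ℝ} {p q r : ℝ → ℝ} {α : ℝ} {θ : ℝ → ℝ → ℝ}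

/-- `θ μ` is, for every `μ`, a Prüfer angle for `τ u = μ u` that starts at `α`. -/
structure IsPruferFamily (a b : ℝ) (p q r : ℝ → ℝ) (α : ℝ) (θ : ℝ → ℝ → ℝ) : Prop where
  left : ∀ μ, θ μ a = α
  isPruferSolution : ∀ μ, IsPruferSolution a b p q r μ (θ μ)

theorem exists_isPruferFamily (hab : a < b) (hreg : IsRegular a b p q r) (α : ℝ) :
    ∃ θ : ℝ → ℝ → ℝ, IsPruferFamily a b p q r α θ := by
  choose θ h1 h2 using fun μ => exists_isPruferSolution hab hreg μ α
  exact ⟨θ, h1, h2⟩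

namespace IsPruferFamily

theorem strictMono (h : IsPruferFamily a b p q r α θ) (hab : a < b) (hreg : IsRegular a b p q r) :
    StrictMono (fun μ => θ μ b) := fun μ ν hμν =>
  (h.isPruferSolution μ).lt_of_lt hab hreg hμν (h.isPruferSolution ν)
    ((h.left μ).trans (h.left ν).symm)

theorem continuous (h : IsPruferFamily a b p q r α θ) (hab : a < b)
    (hreg : IsRegular a b p q r) : Continuous (fun μ => θ μ b) := by
  rw [continuous_iff_continuousAt]
  intro μ
  set M := |μ| + 1 with hM
  set C := Real.exp (2 * ∫ x in Ioo a b, (M * |r x| + |q x| + |(p x)⁻¹|)) *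
    (∫ x in Ioo a b, |r x|) with hC
  rw [ContinuousAt, tendsto_iff_dist_tendsto_zero]
  have h1 : Filter.Tendsto (fun ν => C * |ν - μ|) (nhds μ) (nhds 0) := by
    have : Continuous fun ν : ℝ => C * |ν - μ| := by fun_prop
    simpa using this.tendsto μ
  refine squeeze_zero' (Filter.Eventually.of_forall fun _ => dist_nonneg) ?_ h1
  filter_upwards [Metric.ball_mem_nhds μ one_pos] with ν hν
  rw [Metric.mem_ball, Real.dist_eq] at hν
  have h2 : |ν| ≤ M := by
    have := abs_sub_abs_le_abs_sub ν μ
    linarith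
  exact (h.isPruferSolution μ).abs_sub_le hab hreg h2 (h.isPruferSolution ν)
    ((h.left μ).trans (h.left ν).symm)

theorem pos (h : IsPruferFamily a b p q r α θ) (hab : a < b) (hreg : IsRegular a b p q r)
    (hα : 0 ≤ α) (μ : ℝ) : 0 < θ μ b :=
  (h.isPruferSolution μ).pos_right hab hreg (by rw [h.left]; exact hα)

theorem exists_lt (h : IsPruferFamily a b p q r α θ) (hab : a < b) (hreg : IsRegular a b p q r)
    (hα0 : 0 ≤ α) (hα : α < Real.pi) {ε : ℝ} (hε : 0 < ε) : ∃ μ, θ μ b < ε := by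
  obtain ⟨M, hM⟩ := (eventually_prufer_lt hab hreg hα0 hα hε).exists
  exact ⟨-M, hM _ (h.left _) (h.isPruferSolution _)⟩

end IsPruferFamily

end

section Counting

variable {Θ : ℝ → ℝ} {β lam : ℝ}

theorem floor_of_eq_add_int_mul_pi {x : ℝ} {k : ℤ} (h : x = β + k * Real.pi) :
    ⌊(x - β) / Real.pi⌋ = k := by
  have : (x - β) / Real.pi = k := by
    rw [h, add_sub_cancel_left, mul_div_cancel_right₀ _ Real.pi_ne_zero]
  rw [this, Int.floor_intCast]

/-- The index k of the level determines the point because Θ is injective, so the points correspond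
bijectively to the levels that are attained. -/
theorem finite_and_ncard_of_counting (hmono : StrictMono Θ) {T : Set ℝ} {J : Finset ℤ}
    (hJ : ∀ k : ℤ, k ∈ J ↔ ∃ μ ∈ T, Θ μ = β + k * Real.pi) :
    {μ | μ ∈ T ∧ ∃ k : ℤ, Θ μ = β + k * Real.pi}.Finite ∧
      {μ | μ ∈ T ∧ ∃ k : ℤ, Θ μ = β + k * Real.pi}.ncard = J.card := by
  set S := {μ | μ ∈ T ∧ ∃ k : ℤ, Θ μ = β + k * Real.pi} with hS
  have himg : (fun μ => ⌊(Θ μ - β) / Real.pi⌋) '' S = J := by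
    ext k
    constructor
    · rintro ⟨μ, ⟨hμ, j, hj⟩, rfl⟩
      dsimp only
      rw [floor_of_eq_add_int_mul_pi hj]
      exact (hJ j).2 ⟨μ, hμ, hj⟩
    · intro hk
      obtain ⟨μ, hμ, h⟩ := (hJ k).1 hk
      exact ⟨μ, ⟨hμ, k, h⟩, floor_of_eq_add_int_mul_pi h⟩
  have hinj : InjOn (fun μ => ⌊(Θ μ - β) / Real.pi⌋) S := by
    rintro μ ⟨-, j, hj⟩ ν ⟨-, k, hk⟩ h
    dsimp only at h
    rw [floor_of_eq_add_int_mul_pi hj, floor_of_eq_add_int_mul_pi hk] at h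
    subst h
    exact hmono.injective (hj.trans hk.symm)
  refine ⟨Set.Finite.of_finite_image (by rw [himg]; exact J.finite_toSet) hinj, ?_⟩
  rw [← hinj.ncard_image, himg, ncard_coe_finset]

variable (hmono : StrictMono Θ) (hcont : Continuous Θ) (hpos : ∀ μ, 0 < Θ μ)
  (hlim : ∀ ε > 0, ∃ μ, Θ μ < ε) (hβ0 : 0 < β) (hβ : β ≤ Real.pi)

include hmono hcont hpos hlim hβ0 hβ

/-- Levels with k < 0 are at most 0, since β ≤ π, and Θ is positive. Levels with k ≥ 0 are positive,
so Θ starts below them, and the intermediate value theorem applies. -/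
theorem exists_eq_iff_of_counting (k : ℤ) :
    (∃ μ ∈ Iic lam, Θ μ = β + k * Real.pi) ↔ 0 ≤ k ∧ β + k * Real.pi ≤ Θ lam := by
  constructor
  · rintro ⟨μ, hμ, h⟩
    refine ⟨?_, h ▸ hmono.monotone hμ⟩
    by_contra! hk
    have h1 : (k : ℝ) ≤ -1 := by exact_mod_cast Int.le_sub_one_of_lt hk
    have h2 := hpos μ
    nlinarith [Real.pi_pos]
  · rintro ⟨hk, h⟩
    have hk' : (0 : ℝ) ≤ k := by exact_mod_cast hk
    have h1 : 0 < β + k * Real.pi := by positivity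
    obtain ⟨ν, hν⟩ := hlim _ h1
    have hνl : ν < lam := hmono.lt_iff_lt.1 (hν.trans_le h)
    obtain ⟨μ, hμ, h2⟩ := intermediate_value_Icc hνl.le hcont.continuousOn ⟨hν.le, h⟩
    exact ⟨μ, hμ.2, h2⟩

/-- The formula stays correct when no level is attained: Θ > 0 ≥ β - π makes the floor at least -1.
-/
theorem finite_and_ncard_Iic :
    {μ | μ ∈ Iic lam ∧ ∃ k : ℤ, Θ μ = β + k * Real.pi}.Finite ∧
      ({μ | μ ∈ Iic lam ∧ ∃ k : ℤ, Θ μ = β + k * Real.pi}.ncard : ℤ) =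
        ⌊(Θ lam - β) / Real.pi⌋ + 1 := by
  obtain ⟨h1, h2⟩ := finite_and_ncard_of_counting (T := Iic lam) (β := β)
    (J := Finset.Ico 0 (⌊(Θ lam - β) / Real.pi⌋ + 1)) hmono fun k => by
      rw [exists_eq_iff_of_counting hmono hcont hpos hlim hβ0 hβ, Finset.mem_Ico,
        Int.lt_add_one_iff, Int.le_floor, le_div_iff₀ Real.pi_pos, le_sub_iff_add_le, add_comm β]
  refine ⟨h1, ?_⟩
  rw [h2, Int.card_Ico, sub_zero, Int.toNat_of_nonneg]
  have : -1 ≤ ⌊(Θ lam - β) / Real.pi⌋ := by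
    rw [Int.le_floor, le_div_iff₀ Real.pi_pos]
    push_cast
    have := hpos lam
    linarith
  omega

/-- A level equal to Θ lam is no longer counted, which replaces the floor plus one by the ceiling.
-/
theorem finite_and_ncard_Iio :
    {μ | μ ∈ Iio lam ∧ ∃ k : ℤ, Θ μ = β + k * Real.pi}.Finite ∧
      ({μ | μ ∈ Iio lam ∧ ∃ k : ℤ, Θ μ = β + k * Real.pi}.ncard : ℤ) =
        ⌈(Θ lam - β) / Real.pi⌉ := by
  obtain ⟨h1, h2⟩ := finite_and_ncard_of_counting (T := Iio lam) (β := β)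
    (J := Finset.Ico 0 ⌈(Θ lam - β) / Real.pi⌉) hmono fun k => by
      have key := exists_eq_iff_of_counting (lam := lam) hmono hcont hpos hlim hβ0 hβ k
      rw [Finset.mem_Ico, Int.lt_ceil, lt_div_iff₀ Real.pi_pos, lt_sub_iff_add_lt, add_comm _ β]
      constructor
      · rintro ⟨hk, h⟩
        obtain ⟨μ, -, h3⟩ := key.2 ⟨hk, h.le⟩
        exact ⟨μ, hmono.lt_iff_lt.1 (h3 ▸ h), h3⟩
      · rintro ⟨μ, hμ, h⟩
        exact ⟨(key.1 ⟨μ, (le_of_lt hμ : μ ≤ lam), h⟩).1, h ▸ hmono hμ⟩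
  refine ⟨h1, ?_⟩
  rw [h2, Int.card_Ico, sub_zero, Int.toNat_of_nonneg]
  have : -1 < ⌈(Θ lam - β) / Real.pi⌉ := by
    rw [Int.lt_ceil, lt_div_iff₀ Real.pi_pos]
    push_cast
    have := hpos lam
    linarith
  omega

end Counting

/-! ### Solutions, Wronskians and Prüfer angles -/

section

variable {a b : ℝ} {p q r : ℝ → ℝ}

theorem TauEq.isPrimitive_u {E : Type*} [NormedAddCommGroup E] [NormedSpace ℝ E] {u w g : ℝ → E}
    (h : TauEq a b p q r u w g) : IsPrimitive a b u (fun x => (p x)⁻¹ • w x) :=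
  ⟨h.ac_u, h.deriv_u⟩

theorem TauEq.isPrimitive_w {E : Type*} [NormedAddCommGroup E] [NormedSpace ℝ E] {u w g : ℝ → E}
    (h : TauEq a b p q r u w g) : IsPrimitive a b w (fun x => q x • u x - r x • g x) :=
  ⟨h.ac_w, h.deriv_w⟩

theorem TauEq.of_isPrimitive {E : Type*} [NormedAddCommGroup E] [NormedSpace ℝ E]
    {u w g : ℝ → E} (hu : IsPrimitive a b u (fun x => (p x)⁻¹ • w x))
    (hw : IsPrimitive a b w (fun x => q x • u x - r x • g x)) : TauEq a b p q r u w g :=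
  ⟨hu.ac, hw.ac, hu.hasDerivAt, hw.hasDerivAt⟩

theorem TauEq.congr_right {E : Type*} [NormedAddCommGroup E] [NormedSpace ℝ E]
    {u w g g' : ℝ → E} (h : TauEq a b p q r u w g)
    (hg : ∀ᵐ x ∂(volume.restrict (Ioo a b)), g x = g' x) : TauEq a b p q r u w g' :=
  .of_isPrimitive h.isPrimitive_u (h.isPrimitive_w.congr_deriv (by
    filter_upwards [hg] with x hx
    rw [hx]))

theorem TauEq.clm {E F : Type*} [NormedAddCommGroup E] [NormedSpace ℝ E] [NormedAddCommGroup F]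
    [NormedSpace ℝ F] (L : E →L[ℝ] F) {u w g : ℝ → E} (h : TauEq a b p q r u w g) :
    TauEq a b p q r (fun x => L (u x)) (fun x => L (w x)) (fun x => L (g x)) := by
  refine .of_isPrimitive ?_ ?_
  · simpa using h.isPrimitive_u.clm L
  · simpa using h.isPrimitive_w.clm L

theorem TauEq.ofReal {u w g : ℝ → ℝ} (h : TauEq a b p q r u w g) :
    TauEq a b p q r (fun x => (u x : ℂ)) (fun x => (w x : ℂ)) (fun x => (g x : ℂ)) :=
  h.clm Complex.ofRealCLM

/-- Lagrange's identity in differential form. -/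
theorem TauEq.lagrange {𝕜 : Type*} [RCLike 𝕜] {u w g u' w' g' : ℝ → 𝕜}
    (h : TauEq a b p q r u w g) (h' : TauEq a b p q r u' w' g') :
    IsPrimitive a b (fun x => u x * w' x - w x * u' x)
      (fun x => (r x : 𝕜) * (g x * u' x - u x * g' x)) := by
  refine ((h.isPrimitive_u.mul h'.isPrimitive_w).sub
    (h.isPrimitive_w.mul h'.isPrimitive_u)).congr_deriv (Filter.Eventually.of_forall fun x => ?_)
  simp only [RCLike.real_smul_eq_coe_mul]
  ring

theorem TauEq.wronskian_const {𝕜 : Type*} [RCLike 𝕜] (hab : a ≤ b) {u w u' w' : ℝ → 𝕜} {z : 𝕜}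
    (h : TauEq a b p q r u w (fun x => z * u x)) (h' : TauEq a b p q r u' w' (fun x => z * u' x)) :
    ∀ x ∈ Icc a b, u x * w' x - w x * u' x = u a * w' a - w a * u' a :=
  (h.lagrange h').eq_left_of_deriv_zero hab (Filter.Eventually.of_forall fun x => by ring)

/-- The vectors (u c, w c) and (u' c, w' c) are both annihilated by the nonzero row (cos γ, -sin γ),
hence are linearly dependent. -/
theorem BoundaryCond.wronskian_eq_zero {𝕜 : Type*} [RCLike 𝕜] {c γ : ℝ} {u w u' w' : ℝ → 𝕜}
    (h : BoundaryCond c γ u w) (h' : BoundaryCond c γ u' w') : u c * w' c - w c * u' c = 0 := by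
  simp only [BoundaryCond, RCLike.real_smul_eq_coe_mul] at h h'
  have h1 : (Real.cos γ : 𝕜) ^ 2 + (Real.sin γ : 𝕜) ^ 2 = 1 := by
    exact_mod_cast congrArg (fun t : ℝ => (t : 𝕜)) (Real.cos_sq_add_sin_sq γ)
  linear_combination (-(u c * w' c - w c * u' c)) * h1 +
    ((Real.cos γ : 𝕜) * w' c + (Real.sin γ : 𝕜) * u' c) * h -
    ((Real.sin γ : 𝕜) * u c + (Real.cos γ : 𝕜) * w c) * h'

theorem boundaryCond_ofReal {c γ : ℝ} {u w : ℝ → ℝ} :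
    BoundaryCond c γ (fun x => (u x : ℂ)) (fun x => (w x : ℂ)) ↔ BoundaryCond c γ u w := by
  simp only [BoundaryCond, Complex.real_smul, smul_eq_mul]
  norm_cast

theorem boundaryCond_polar {c γ R t : ℝ} {u w : ℝ → ℝ} (hR : 0 < R)
    (hu : u c = R * Real.sin t) (hw : w c = R * Real.cos t) :
    BoundaryCond c γ u w ↔ Real.sin (t - γ) = 0 := by
  have : Real.cos γ • u c - Real.sin γ • w c = R * Real.sin (t - γ) := by
    rw [hu, hw, Real.sin_sub, smul_eq_mul, smul_eq_mul]
    ring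
  rw [BoundaryCond, this, mul_eq_zero, or_iff_right hR.ne']

/-- Given the angle, the amplitude solves ρ' = (p⁻¹ - (μr - q)) sin θ cos θ · ρ, so it is the
exponential of an integral and is positive. -/
theorem IsPruferSolution.exists_tauEq (hab : a < b) (hreg : IsRegular a b p q r) {μ : ℝ}
    {θ : ℝ → ℝ} (h : IsPruferSolution a b p q r μ θ) :
    ∃ ρ : ℝ → ℝ, (∀ x, 0 < ρ x) ∧ TauEq a b p q r (fun x => ρ x * Real.sin (θ x))
      (fun x => ρ x * Real.cos (θ x)) (fun x => μ * (ρ x * Real.sin (θ x))) := by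
  have hc := IsPrimitive.continuousOn h hab.le
  have hi : IntegrableOn (fun x => ((p x)⁻¹ - (μ * r x - q x)) *
      (Real.sin (θ x) * Real.cos (θ x))) (Ioo a b) :=
    integrableOn_mul_continuousOn (hreg.integrable_inv_p.sub (hreg.integrable_potential μ))
      ((Real.continuous_sin.comp_continuousOn hc).mul (Real.continuous_cos.comp_continuousOn hc))
  have hρ := (IsPrimitive.integral hab.le hi).comp (φ := Real.exp) (φ' := Real.exp)
    Real.contDiff_exp Real.hasDerivAt_exp
  have hs := IsPrimitive.comp (φ := Real.sin) (φ' := Real.cos) Real.contDiff_sin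
    Real.hasDerivAt_sin h
  have hcs := IsPrimitive.comp (φ := Real.cos) (φ' := fun x => -Real.sin x) Real.contDiff_cos
    Real.hasDerivAt_cos h
  refine ⟨_, fun x => Real.exp_pos _, .of_isPrimitive ((hρ.mul hs).congr_deriv ?_)
    ((hρ.mul hcs).congr_deriv ?_)⟩
  · refine Filter.Eventually.of_forall fun x => ?_
    simp only [smul_eq_mul]
    have := Real.sin_sq_add_cos_sq (θ x)
    linear_combination (p x)⁻¹ * Real.exp (∫ t in a..x, ((p t)⁻¹ - (μ * r t - q t)) *
      (Real.sin (θ t) * Real.cos (θ t))) * Real.cos (θ x) * this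
  · refine Filter.Eventually.of_forall fun x => ?_
    simp only [smul_eq_mul]
    have := Real.sin_sq_add_cos_sq (θ x)
    linear_combination (-(μ * r x - q x)) * Real.exp (∫ t in a..x, ((p t)⁻¹ - (μ * r t - q t)) *
      (Real.sin (θ t) * Real.cos (θ t))) * Real.sin (θ x) * this

/-- A solution that satisfies the boundary condition at `a` is a multiple of the one given by a
Prüfer angle. -/
theorem exists_eq_const_mul (hab : a < b) (hreg : IsRegular a b p q r) {μ α : ℝ}
    {ψ ψ' : ℝ → ℝ} (hψ : TauEq a b p q r ψ ψ' (fun x => μ * ψ x)) (hψa : BoundaryCond a α ψ ψ')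
    (hne : ψ a ≠ 0 ∨ ψ' a ≠ 0) {u w : ℝ → ℂ} (hu : TauEq a b p q r u w (fun x => (μ : ℂ) * u x))
    (hua : BoundaryCond a α u w) : ∃ c : ℂ, ∀ x ∈ Icc a b, u x = c * ψ x ∧ w x = c * ψ' x := by
  -- A second solution φ, started at right angles to the boundary direction α, is certain to be
  -- independent of ψ.
  obtain ⟨θ, hθa, hθ⟩ := exists_isPruferSolution hab hreg μ (α + Real.pi / 2)
  obtain ⟨ρ, hρ, hφ⟩ := hθ.exists_tauEq hab hreg
  set φ := fun x => ρ x * Real.sin (θ x) with hφdef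
  set φ' := fun x => ρ x * Real.cos (θ x) with hφ'def
  have hψC := hψ.ofReal
  have hφC := hφ.ofReal
  simp only [Complex.ofReal_mul (r := μ)] at hψC hφC
  have hW1 := hu.wronskian_const hab.le hψC
  have hW2 := hu.wronskian_const hab.le hφC
  have hW3 := hψC.wronskian_const hab.le hφC
  rw [hua.wronskian_eq_zero (boundaryCond_ofReal.2 hψa)] at hW1
  set D : ℂ := (ψ a : ℂ) * φ' a - ψ' a * φ a with hD
  have hD0 : D ≠ 0 := by
    have h1 : Real.cos α * ψ a = Real.sin α * ψ' a := by
      simpa [BoundaryCond, sub_eq_zero] using hψa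
    have h2 : D = ((-(ρ a) * (ψ a * Real.sin α + ψ' a * Real.cos α) : ℝ) : ℂ) := by
      rw [hD]
      simp only [hφdef, hφ'def, hθa, Real.sin_add_pi_div_two, Real.cos_add_pi_div_two]
      push_cast
      ring
    rw [h2]
    intro h3
    have h4 : ψ a * Real.sin α + ψ' a * Real.cos α = 0 := by
      have := Complex.ofReal_eq_zero.1 h3
      simpa [(hρ a).ne'] using this
    have h5 := Real.sin_sq_add_cos_sq α
    have h6 : ψ a = 0 := by
      linear_combination (-ψ a) * h5 + Real.sin α * h4 + Real.cos α * h1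
    have h7 : ψ' a = 0 := by
      linear_combination (-ψ' a) * h5 + Real.cos α * h4 - Real.sin α * h1
    exact hne.elim (fun h => h h6) fun h => h h7
  -- With W denoting Wronskians, u W(ψ, φ) = ψ W(u, φ) - φ W(u, ψ). The last term vanishes by the
  -- boundary condition at a, and the two remaining Wronskians are constant; the same identity holds
  -- for w.
  refine ⟨(u a * φ' a - w a * φ a) / D, fun x hx => ?_⟩
  have e1 := hW1 x hx
  have e2 := hW2 x hx
  have e3 := hW3 x hx
  rw [div_mul_eq_mul_div, div_mul_eq_mul_div, eq_div_iff hD0, eq_div_iff hD0]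
  constructor
  · linear_combination (-u x) * e3 + ψ x * e2 - φ x * e1
  · linear_combination (-w x) * e3 + ψ' x * e2 - φ' x * e1

/-- The values lie in the discrete set πℤ. A change would, by the intermediate value theorem,
produce a value at distance strictly between 0 and π from the initial one. -/
theorem eq_of_sin_eq_zero_on (hab : a ≤ b) {δ : ℝ → ℝ} (hδ : ContinuousOn δ (Icc a b))
    (h : ∀ x ∈ Icc a b, Real.sin (δ x) = 0) : δ a = δ b := by
  have key : ∀ {δ : ℝ → ℝ}, ContinuousOn δ (Icc a b) → (∀ x ∈ Icc a b, Real.sin (δ x) = 0) →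
      ¬ δ a < δ b := by
    intro δ hδ h hlt
    set t := min (δ b - δ a) Real.pi / 2 with ht
    have hm : 0 < min (δ b - δ a) Real.pi := lt_min (sub_pos.2 hlt) Real.pi_pos
    have h1 := min_le_left (δ b - δ a) Real.pi
    have h2 := min_le_right (δ b - δ a) Real.pi
    obtain ⟨x, hx, hxt⟩ := intermediate_value_Icc hab hδ
      (show δ a + t ∈ Icc (δ a) (δ b) from ⟨by linarith, by linarith⟩)
    have h3 := h x hx
    have h4 := h a (left_mem_Icc.2 hab)
    have h5 : Real.sin t ≠ 0 := (Real.sin_pos_of_pos_of_lt_pi (by linarith)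
      (by linarith)).ne'
    have h6 := Real.sin_sq_add_cos_sq (δ a)
    rw [hxt, Real.sin_add, h4, zero_mul, zero_add] at h3
    rcases mul_eq_zero.1 h3 with h7 | h7
    · rw [h4, h7] at h6
      norm_num at h6
    · exact h5 h7
  rcases lt_trichotomy (δ a) (δ b) with h1 | h1 | h1
  · exact absurd h1 (key hδ h)
  · exact h1
  · exact absurd (neg_lt_neg h1) (key hδ.neg fun x hx => by simp [h x hx])

theorem exists_mem_Ioo_of_sin_ne_zero_on (hab : a ≤ b) {δ : ℝ → ℝ}
    (hδ : ContinuousOn δ (Icc a b)) (h : ∀ x ∈ Icc a b, Real.sin (δ x) ≠ 0) :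
    ∃ j : ℤ, ∀ x ∈ Icc a b, δ x ∈ Ioo (j * Real.pi) ((j + 1) * Real.pi) := by
  have hpi := Real.pi_pos
  have ha := left_mem_Icc.2 hab
  refine ⟨⌊δ a / Real.pi⌋, fun x hx => ?_⟩
  have h1 := Int.floor_le (δ a / Real.pi)
  have h2 := Int.lt_floor_add_one (δ a / Real.pi)
  rw [le_div_iff₀ hpi] at h1
  rw [div_lt_iff₀ hpi] at h2
  have hsub : Icc a x ⊆ Icc a b := Icc_subset_Icc_right hx.2
  constructor
  · by_contra! hcon
    obtain ⟨y, hy, hy2⟩ := intermediate_value_Icc' hx.1 (hδ.mono hsub) ⟨hcon, h1⟩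
    exact h y (hsub hy) (by rw [hy2]; exact Real.sin_int_mul_pi _)
  · by_contra! hcon
    obtain ⟨y, hy, hy2⟩ := intermediate_value_Icc hx.1 (hδ.mono hsub) ⟨h2.le, hcon⟩
    refine h y (hsub hy) ?_
    rw [hy2]
    exact_mod_cast Real.sin_int_mul_pi (⌊δ a / Real.pi⌋ + 1)

theorem floor_ceil_eq_of_mem_Ioo {x y : ℝ} {n : ℤ} (hx : x ∈ Ioo (n : ℝ) (n + 1))
    (hy : y ∈ Ioo (n : ℝ) (n + 1)) : ⌊x⌋ = ⌊y⌋ ∧ ⌈x⌉ = ⌈y⌉ := by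
  have hf : ∀ {x : ℝ}, x ∈ Ioo (n : ℝ) (n + 1) → ⌊x⌋ = n ∧ ⌈x⌉ = n + 1 := fun {x} hx =>
    ⟨Int.floor_eq_iff.2 ⟨hx.1.le, hx.2⟩, Int.ceil_eq_iff.2 (by push_cast; exact ⟨by linarith [hx.1], hx.2.le⟩)⟩
  rw [(hf hx).1, (hf hx).2, (hf hy).1, (hf hy).2]
  exact ⟨rfl, rfl⟩

/-- The total variation of a Prüfer angle of a solution satisfying one of the two boundary
conditions has the same rounded value, relative to `β - α`, as that of the solution starting at
`a`. -/
theorem floor_ceil_pruferAngle (hab : a < b) (hreg : IsRegular a b p q r) {μ α β : ℝ}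
    {θ₀ : ℝ → ℝ} (h₀ : IsPruferSolution a b p q r μ θ₀) (h₀a : θ₀ a = α) {u w θ : ℝ → ℝ}
    (hu : TauEq a b p q r u w (fun x => μ * u x)) (hθ : IsPruferAngle a b u w θ)
    (hbc : BoundaryCond a α u w ∨ BoundaryCond b β u w) :
    ⌊(θ b - θ a - (β - α)) / Real.pi⌋ = ⌊(θ₀ b - β) / Real.pi⌋ ∧
      ⌈(θ b - θ a - (β - α)) / Real.pi⌉ = ⌈(θ₀ b - β) / Real.pi⌉ := by
  have hpi := Real.pi_pos
  have ha := left_mem_Icc.2 hab.le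
  have hb := right_mem_Icc.2 hab.le
  obtain ⟨ρ₀, hρ₀, hv⟩ := h₀.exists_tauEq hab hreg
  obtain ⟨hθc, ρ, hρ⟩ := hθ
  have hW := hu.wronskian_const hab.le hv
  have hWs : ∀ x ∈ Icc a b, u x * (ρ₀ x * Real.cos (θ₀ x)) - w x * (ρ₀ x * Real.sin (θ₀ x)) =
      ρ x * ρ₀ x * Real.sin (θ x - θ₀ x) := by
    intro x hx
    rw [(hρ x hx).2.1, (hρ x hx).2.2, Real.sin_sub]
    ring
  have hδ : ContinuousOn (fun x => θ x - θ₀ x) (Icc a b) :=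
    hθc.sub (IsPrimitive.continuousOn h₀ hab.le)
  by_cases hsa : Real.sin (θ a - θ₀ a) = 0
  -- Zero Wronskian: the two solutions are proportional, and their angles differ by a constant.
  · have h1 := eq_of_sin_eq_zero_on hab.le hδ fun x hx => by
      have h2 := hW x hx
      rw [hWs x hx, hWs a ha, hsa, mul_zero, mul_eq_zero] at h2
      exact h2.resolve_left (mul_pos (hρ x hx).1 (hρ₀ x)).ne'
    have h3 : θ b - θ a - (β - α) = θ₀ b - β := by
      linarith
    rw [h3]
    exact ⟨rfl, rfl⟩
  -- Nonzero Wronskian: the boundary condition at a is excluded, so the one at b holds, and θ - θ₀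
  -- never meets πℤ.
  · have hbβ : Real.sin (θ b - β) = 0 := by
      rcases hbc with h | h
      · rw [boundaryCond_polar (hρ a ha).1 (hρ a ha).2.1 (hρ a ha).2.2, ← h₀a] at h
        exact absurd h hsa
      · rwa [boundaryCond_polar (hρ b hb).1 (hρ b hb).2.1 (hρ b hb).2.2] at h
    obtain ⟨m, hm⟩ := Real.sin_eq_zero_iff.1 hbβ
    obtain ⟨j, hj⟩ := exists_mem_Ioo_of_sin_ne_zero_on hab.le hδ fun x hx h => by
      have h2 := hW x hx
      rw [hWs x hx, hWs a ha, h, mul_zero] at h2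
      exact mul_ne_zero (mul_pos (hρ a ha).1 (hρ₀ a)).ne' hsa h2.symm
    obtain ⟨ja1, ja2⟩ := hj a ha
    obtain ⟨jb1, jb2⟩ := hj b hb
    -- The two quantities are mπ - (θ - θ₀)(a) and mπ - (θ - θ₀)(b), and θ - θ₀ stays in (jπ,
    -- (j+1)π).
    refine floor_ceil_eq_of_mem_Ioo (n := m - j - 1) ⟨?_, ?_⟩ ⟨?_, ?_⟩
    · rw [lt_div_iff₀ hpi]
      push_cast
      linarith
    · rw [div_lt_iff₀ hpi]
      push_cast
      linarith
    · rw [lt_div_iff₀ hpi]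
      push_cast
      linarith
    · rw [div_lt_iff₀ hpi]
      push_cast
      linarith

end

end SturmLiouville

namespace ProjValuedMeasure

variable {𝓗 : Type*} [NormedAddCommGroup 𝓗] [InnerProductSpace ℂ 𝓗] [CompleteSpace 𝓗]

/-! ### Elementary properties of projection-valued measures -/

section Basic

variable (E : ProjValuedMeasure 𝓗) {s t : Set ℝ}

theorem scalarMeasure_apply (x : 𝓗) (hs : MeasurableSet s) :
    E.scalarMeasure x s = ENNReal.ofReal (‖E.proj s x‖ ^ 2) :=
  Measure.ofMeasurable_apply s hs

theorem proj_proj (hs : MeasurableSet s) (ht : MeasurableSet t) (x : 𝓗) :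
    E.proj s (E.proj t x) = E.proj (s ∩ t) x := by
  rw [E.proj_inter s t hs ht]
  rfl

/-- Countable additivity applied to the sequence s, sᶜ, ∅, ∅, …. -/
theorem proj_add_compl (hs : MeasurableSet s) (x : 𝓗) : E.proj s x + E.proj sᶜ x = x := by
  set f : ℕ → Set ℝ := fun n => if n = 0 then s else if n = 1 then sᶜ else ∅ with hf
  have hfm : ∀ n, MeasurableSet (f n) := by
    intro n
    simp only [hf]
    split_ifs
    exacts [hs, hs.compl, MeasurableSet.empty]
  have hfd : Pairwise (Function.onFun Disjoint f) := by
    intro m n hmn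
    simp only [Function.onFun, hf]
    split_ifs with h1 h2 h3 h3 h4 h5 <;> first | omega | simp [disjoint_compl_right, disjoint_compl_left]
  have hfu : ⋃ n, f n = Set.univ := by
    refine Set.eq_univ_of_forall fun y => ?_
    by_cases hy : y ∈ s
    · exact mem_iUnion.2 ⟨0, by simpa [hf] using hy⟩
    · exact mem_iUnion.2 ⟨1, by simpa [hf] using hy⟩
  have h1 := E.hasSum_proj f hfm hfd x
  rw [hfu, E.proj_univ] at h1
  have h2 := hasSum_sum_of_ne_finset_zero (L := .unconditional _) (f := fun n => E.proj (f n) x) (s := {0, 1}) (by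
    intro n hn
    simp only [Finset.mem_insert, Finset.mem_singleton, not_or] at hn
    simp [hf, hn.1, hn.2, E.proj_empty])
  have h3 := h2.unique h1
  simpa [hf] using h3

theorem inner_proj_proj (hs : MeasurableSet s) (ht : MeasurableSet t) (x y : 𝓗) :
    inner ℂ (E.proj s x) (E.proj t y) = inner ℂ x (E.proj (s ∩ t) y) := by
  have h3 := ContinuousLinearMap.adjoint_inner_left (E.proj s) (E.proj t y) x
  rw [← ContinuousLinearMap.star_eq_adjoint, (E.isStarProjection s hs).isSelfAdjoint.star_eq] at h3
  rw [h3, E.proj_proj hs ht]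

theorem norm_sq_proj_add_compl (hs : MeasurableSet s) {c : ℂ} (hc : ‖c‖ = 1) (x : 𝓗) :
    ‖E.proj s x + c • E.proj sᶜ x‖ ^ 2 = ‖x‖ ^ 2 := by
  have h0 : inner ℂ (E.proj s x) (E.proj sᶜ x) = 0 := by
    rw [E.inner_proj_proj hs hs.compl, inter_compl_self, E.proj_empty]
    simp
  have h1 : ∀ {c : ℂ}, ‖c‖ = 1 → ‖E.proj s x + c • E.proj sᶜ x‖ ^ 2 =
      ‖E.proj s x‖ ^ 2 + ‖E.proj sᶜ x‖ ^ 2 := by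
    intro c hc
    rw [sq, sq, sq, norm_add_sq_eq_norm_sq_add_norm_sq_of_inner_eq_zero (𝕜 := ℂ) _ _
      (by rw [inner_smul_right, h0, mul_zero]), norm_smul, hc, one_mul]
  rw [h1 hc, ← h1 (c := 1) (by simp), one_smul, E.proj_add_compl hs]

/-- The quadratic form of H is a function of the scalar measure alone, so this invariance makes the
form insensitive to the phase c; that will show that H has no cross terms between the ranges of
complementary projections. -/
theorem scalarMeasure_rotate (hs : MeasurableSet s) {c : ℂ} (hc : ‖c‖ = 1) (x : 𝓗) :
    E.scalarMeasure (E.proj s x + c • E.proj sᶜ x) = E.scalarMeasure x := by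
  ext t ht
  rw [E.scalarMeasure_apply _ ht, E.scalarMeasure_apply _ ht, map_add, map_smul,
    E.proj_proj ht hs, E.proj_proj ht hs.compl, inter_comm t, inter_comm t, ← E.proj_proj hs ht,
    ← E.proj_proj hs.compl ht, E.norm_sq_proj_add_compl hs hc]

theorem scalarMeasure_proj (hs : MeasurableSet s) (x : 𝓗) :
    E.scalarMeasure (E.proj s x) = (E.scalarMeasure x).restrict s := by
  ext t ht
  rw [E.scalarMeasure_apply _ ht, Measure.restrict_apply ht, E.scalarMeasure_apply _ (ht.inter hs),
    E.proj_proj ht hs]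

theorem scalarMeasure_univ (x : 𝓗) : E.scalarMeasure x Set.univ = ENNReal.ofReal (‖x‖ ^ 2) := by
  rw [E.scalarMeasure_apply _ MeasurableSet.univ, E.proj_univ]
  rfl

instance isFiniteMeasure_scalarMeasure (x : 𝓗) : IsFiniteMeasure (E.scalarMeasure x) :=
  ⟨by rw [E.scalarMeasure_univ]; exact ENNReal.ofReal_lt_top⟩

theorem measureReal_scalarMeasure (x : 𝓗) (hs : MeasurableSet s) :
    (E.scalarMeasure x).real s = ‖E.proj s x‖ ^ 2 := by
  rw [measureReal_def, E.scalarMeasure_apply x hs, ENNReal.toReal_ofReal (by positivity)]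

end Basic

theorem integrable_id_of_sq {ν : Measure ℝ} [IsFiniteMeasure ν]
    (h : Integrable (fun t : ℝ => t ^ 2) ν) : Integrable (fun t : ℝ => t) ν := by
  refine ((integrable_const (1 : ℝ)).add h).mono' (by fun_prop)
    (Filter.Eventually.of_forall fun t => ?_)
  simp only [Pi.add_apply, Real.norm_eq_abs]
  nlinarith [sq_abs t, abs_nonneg t, sq_nonneg (|t| - 1)]

/-! ### Eigenvectors under an arbitrary spectral resolution -/

namespace IsSpectralResolution

variable {E : ProjValuedMeasure 𝓗} {H : 𝓗 →ₗ.[ℂ] 𝓗}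

/-- The spectral measure of an eigenvector is concentrated in the eigenvalue. -/
theorem scalarMeasure_ae_eq (hE : E.IsSpectralResolution H) {μ : ℝ} (x : H.domain)
    (hx : H x = (μ : ℂ) • (x : 𝓗)) : ∀ᵐ t ∂(E.scalarMeasure (x : 𝓗)), t = μ := by
  have hsq := (hE.mem_domain_iff x).1 x.2
  have hid := integrable_id_of_sq hsq
  have key : ∀ s : Set ℝ, MeasurableSet s → ∫ t in s, (t - μ) ∂(E.scalarMeasure (x : 𝓗)) = 0 := by
    intro s hs
    have hdom : ∀ s : Set ℝ, MeasurableSet s → E.proj s (x : 𝓗) ∈ H.domain := by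
      intro s hs
      rw [hE.mem_domain_iff, E.scalarMeasure_proj hs]
      exact hsq.restrict
    set y : H.domain := ⟨E.proj s x, hdom s hs⟩ with hy
    set z : H.domain := ⟨E.proj sᶜ x, hdom _ hs.compl⟩ with hz
    have hyz : y + z = x := Subtype.ext (E.proj_add_compl hs x)
    set A : ℂ := inner ℂ (y : 𝓗) (H y) + inner ℂ (z : 𝓗) (H z) with hA
    set Y : ℂ := inner ℂ (y : 𝓗) (H z) with hY
    set Z : ℂ := inner ℂ (z : 𝓗) (H y) with hZ
    -- The form evaluated at P_s x + c P_{sᶜ} x does not depend on the phase c; the values c = 1,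
    -- -1, i then isolate the cross term Y and give Y = 0.
    have hrot : ∀ c : ℂ, ‖c‖ = 1 → A + c * Y + (starRingEnd ℂ) c * Z = inner ℂ (x : 𝓗) (H x) := by
      intro c hc
      have h1 := hE.inner_apply (y + c • z)
      have h2 : ((y + c • z : H.domain) : 𝓗) = E.proj s x + c • E.proj sᶜ x := rfl
      rw [h2, E.scalarMeasure_rotate hs hc, ← hE.inner_apply x, ← h2, H.map_add, H.map_smul,
        Submodule.coe_add, Submodule.coe_smul, inner_add_left, inner_add_right, inner_add_right,
        inner_smul_left, inner_smul_left, inner_smul_right, inner_smul_right] at h1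
      have h3 : (starRingEnd ℂ) c * c = 1 := by
        rw [← Complex.normSq_eq_conj_mul_self, Complex.normSq_eq_norm_sq, hc]
        simp
      rw [← h1, hA]
      linear_combination (-inner ℂ (z : 𝓗) (H z)) * h3
    have e1 := hrot 1 (by simp)
    have e2 := hrot (-1) (by simp)
    have e3 := hrot Complex.I (by simp)
    simp only [map_one, map_neg, Complex.conj_I] at e1 e2 e3
    have hI := Complex.I_mul_I
    have hY0 : Y = 0 := by
      linear_combination (1 / 4 + Complex.I / 4) * e1 - (1 / 4 - Complex.I / 4) * e2 -
        Complex.I / 2 * e3 + (Y / 2 - Z / 2) * hI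
    -- Without cross terms ⟨P_s x, Hx⟩ is the integral of t over s, while Hx = μx makes it μ‖P_s
    -- x‖². Thus t - μ integrates to 0 over every Borel set.
    have h4 : inner ℂ (y : 𝓗) (H x) = inner ℂ (y : 𝓗) (H y) := by
      rw [← hyz, H.map_add, inner_add_right, ← hY, hY0, add_zero]
    rw [hE.inner_apply y, hx, inner_smul_right] at h4
    have h5 : inner ℂ (y : 𝓗) (x : 𝓗) = ((‖E.proj s (x : 𝓗)‖ ^ 2 : ℝ) : ℂ) := by
      rw [← inner_conj_symm, ← E.inner_proj_self hs (x : 𝓗), E.inner_proj_self hs (x : 𝓗),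
        Complex.conj_ofReal]
    rw [h5] at h4
    have h6 : μ * ‖E.proj s (x : 𝓗)‖ ^ 2 = ∫ t in s, t ∂(E.scalarMeasure (x : 𝓗)) := by
      rw [← E.scalarMeasure_proj hs]
      exact_mod_cast h4
    rw [integral_sub hid.integrableOn (integrable_const _), ← h6, setIntegral_const,
      E.measureReal_scalarMeasure _ hs, smul_eq_mul]
    ring
  have h7 := ae_eq_zero_of_forall_setIntegral_eq_of_sigmaFinite (μ := E.scalarMeasure (x : 𝓗))
    (f := fun t => t - μ) (fun s _ _ => (hid.sub (integrable_const _)).integrableOn)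
    (fun s hs _ => key s hs)
  filter_upwards [h7] with t ht
  exact sub_eq_zero.1 ht

theorem proj_eigenvector_of_notMem (hE : E.IsSpectralResolution H) {μ : ℝ} (x : H.domain)
    (hx : H x = (μ : ℂ) • (x : 𝓗)) {s : Set ℝ} (hs : MeasurableSet s) (hμ : μ ∉ s) :
    E.proj s (x : 𝓗) = 0 := by
  have h1 : E.scalarMeasure (x : 𝓗) s = 0 := by
    refine measure_mono_null (fun t ht => ?_) (hE.scalarMeasure_ae_eq x hx)
    rintro rfl
    exact hμ ht
  rw [E.scalarMeasure_apply _ hs, ENNReal.ofReal_eq_zero] at h1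
  have h2 : ‖E.proj s (x : 𝓗)‖ ^ 2 = 0 := le_antisymm h1 (by positivity)
  simpa using h2

theorem proj_eigenvector_of_mem (hE : E.IsSpectralResolution H) {μ : ℝ} (x : H.domain)
    (hx : H x = (μ : ℂ) • (x : 𝓗)) {s : Set ℝ} (hs : MeasurableSet s) (hμ : μ ∈ s) :
    E.proj s (x : 𝓗) = x := by
  have h1 := E.proj_add_compl hs (x : 𝓗)
  rwa [hE.proj_eigenvector_of_notMem x hx hs.compl (by simpa using hμ), add_zero] at h1

/-- Given an orthonormal basis of eigenvectors, finite-dimensional spectral subspaces are spanned by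
basis vectors. -/
theorem finiteDimensional_and_finrank_range {ι : Type*} (hE : E.IsSpectralResolution H)
    (e : HilbertBasis ι ℂ 𝓗) (m : ι → ℝ) (he : ∀ i, ∃ h : e i ∈ H.domain, H ⟨e i, h⟩ = (m i : ℂ) • e i)
    {s : Set ℝ} (hs : MeasurableSet s) (hfin : {i | m i ∈ s}.Finite) :
    FiniteDimensional ℂ (E.proj s).range ∧
      Module.finrank ℂ (E.proj s).range = {i | m i ∈ s}.ncard := by
  have hmem : ∀ i, m i ∈ s → E.proj s (e i) = e i := fun i hi => by
    obtain ⟨h1, h2⟩ := he i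
    exact hE.proj_eigenvector_of_mem ⟨e i, h1⟩ h2 hs hi
  have hnot : ∀ i, m i ∉ s → E.proj s (e i) = 0 := fun i hi => by
    obtain ⟨h1, h2⟩ := he i
    exact hE.proj_eigenvector_of_notMem ⟨e i, h1⟩ h2 hs hi
  have hrange : (E.proj s).range =
      Submodule.span ℂ (Set.range fun i : {i | m i ∈ s} => e (i : ι)) := by
    refine le_antisymm ?_ (Submodule.span_le.2 ?_)
    · rintro _ ⟨x, rfl⟩
      have h1 := (e.hasSum_repr x).mapL (E.proj s)
      have h2 := hasSum_sum_of_ne_finset_zero (L := .unconditional _) (f := fun i => E.proj s (e.repr x i • e i))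
        (s := hfin.toFinset) (fun i hi => by
          rw [map_smul, hnot i (by simpa using hi), smul_zero])
      change E.proj s x ∈ _
      rw [h1.unique h2]
      refine Submodule.sum_mem _ fun i hi => ?_
      have hi' : m i ∈ s := by simpa using hi
      rw [map_smul, hmem i hi']
      exact Submodule.smul_mem _ _ (Submodule.subset_span ⟨⟨i, hi'⟩, rfl⟩)
    · rintro _ ⟨i, rfl⟩
      exact ⟨e i, hmem i i.2⟩
  have := hfin.fintype
  have hli : LinearIndependent ℂ (fun i : {i | m i ∈ s} => e (i : ι)) :=
    e.orthonormal.linearIndependent.comp _ Subtype.val_injective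
  rw [hrange]
  refine ⟨FiniteDimensional.span_of_finite ℂ (Set.finite_range _), ?_⟩
  rw [finrank_span_eq_card hli, ← Nat.card_eq_fintype_card, Nat.card_coe_set_eq]

end IsSpectralResolution

/-! ### The spectral resolution of a diagonal operator -/

section Diagonal

variable {ι : Type*} (e : HilbertBasis ι ℂ 𝓗) (m : ι → ℝ)

/-- The projection onto the closed span of the basis vectors `e i` with `m i ∈ s`. -/
def diagonalProj (s : Set ℝ) : 𝓗 →L[ℂ] 𝓗 :=
  (Submodule.span ℂ (e '' {i | m i ∉ s}))ᗮ.starProjection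

theorem diagonalProj_of_mem {s : Set ℝ} {i : ι} (hi : m i ∈ s) : diagonalProj e m s (e i) = e i := by
  rw [diagonalProj, Submodule.starProjection_eq_self_iff, Submodule.mem_orthogonal]
  intro u hu
  induction hu using Submodule.span_induction with
  | mem x hx =>
    obtain ⟨j, hj, rfl⟩ := hx
    exact e.orthonormal.inner_eq_zero fun h => hj (h ▸ hi)
  | zero => simp
  | add x y _ _ hx hy => rw [inner_add_left, hx, hy, add_zero]
  | smul c x _ hx => rw [inner_smul_left, hx, mul_zero]

theorem diagonalProj_of_notMem {s : Set ℝ} {i : ι} (hi : m i ∉ s) : diagonalProj e m s (e i) = 0 := by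
  rw [diagonalProj, Submodule.starProjection_apply_eq_zero_iff]
  exact Submodule.le_orthogonal_orthogonal _ (Submodule.subset_span ⟨i, hi, rfl⟩)

theorem hasSum_diagonalProj (s : Set ℝ) (x : 𝓗) :
    HasSum (({i | m i ∈ s} : Set ι).indicator fun i => e.repr x i • e i) (diagonalProj e m s x) := by
  convert (e.hasSum_repr x).mapL (diagonalProj e m s) using 2 with i
  by_cases hi : m i ∈ s
  · rw [indicator_of_mem (by exact hi), map_smul, diagonalProj_of_mem e m hi]
  · rw [indicator_of_notMem (by exact hi), map_smul, diagonalProj_of_notMem e m hi, smul_zero]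

theorem repr_diagonalProj (s : Set ℝ) (x : 𝓗) (i : ι) :
    e.repr (diagonalProj e m s x) i = ({i | m i ∈ s} : Set ι).indicator (fun i => e.repr x i) i := by
  have hsa : inner ℂ (e i) (diagonalProj e m s x) = inner ℂ (diagonalProj e m s (e i)) x :=
    (Submodule.inner_starProjection_left_eq_right _ _ _).symm
  rw [e.repr_apply_apply, hsa]
  by_cases hi : m i ∈ s
  · rw [indicator_of_mem (by exact hi), diagonalProj_of_mem e m hi, e.repr_apply_apply]
  · rw [indicator_of_notMem (by exact hi), diagonalProj_of_notMem e m hi, inner_zero_left]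

/-- The projection-valued measure of the diagonal operator with eigenvectors `e i` and eigenvalues
`m i`. -/
def diagonal : ProjValuedMeasure 𝓗 where
  proj := diagonalProj e m
  isStarProjection _ _ := isStarProjection_starProjection
  proj_empty := by
    ext x
    have h := hasSum_diagonalProj e m ∅ x
    simp only [mem_empty_iff_false, ofPred_false, indicator_empty] at h
    simpa using h.unique hasSum_zero
  proj_univ := by
    ext x
    have h := hasSum_diagonalProj e m Set.univ x
    simp only [mem_univ, ofPred_true, indicator_univ] at h
    simpa using h.unique (e.hasSum_repr x)
  proj_inter s t _ _ := by
    ext x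
    apply e.repr.injective
    ext i
    change _ = e.repr (diagonalProj e m s (diagonalProj e m t x)) i
    rw [repr_diagonalProj, repr_diagonalProj]
    by_cases h1 : m i ∈ s <;> by_cases h2 : m i ∈ t <;> simp [indicator, h1, h2, repr_diagonalProj]
  hasSum_proj f _ hd x := by
    have hd' : ∀ i j, i ≠ j → Disjoint {k | m k ∈ f i} {k | m k ∈ f j} := fun i j hij =>
      Disjoint.preimage m (hd hij)
    have hU : {k | m k ∈ ⋃ n, f n} = ⋃ n, {k | m k ∈ f n} := by
      ext k
      simp
    have h1 := hasSum_diagonalProj e m (⋃ n, f n) x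
    rw [← hasSum_subtype_iff_indicator, hU, ← (Set.unionEqSigmaOfDisjoint hd').symm.hasSum_iff] at h1
    refine h1.sigma fun n => ?_
    have h2 := hasSum_diagonalProj e m (f n) x
    rw [← hasSum_subtype_iff_indicator] at h2
    exact h2

end Diagonal

end ProjValuedMeasure

/-! ### Operators with compact resolvent are diagonal -/

section HilbertBasis

variable {𝓗 : Type*} [NormedAddCommGroup 𝓗] [InnerProductSpace ℂ 𝓗] {ι : Type*}

theorem HilbertBasis.hasSum_inner_self_weighted (e : HilbertBasis ι ℂ 𝓗) {x y : 𝓗} {m : ι → ℝ}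
    (h : ∀ i, e.repr y i = m i * e.repr x i) :
    HasSum (fun i => ((‖e.repr x i‖ ^ 2 * m i : ℝ) : ℂ)) (inner ℂ x y) := by
  have heq : (fun i => ((‖e.repr x i‖ ^ 2 * m i : ℝ) : ℂ)) =
      fun i => inner ℂ x (e i) * inner ℂ (e i) y := by
    funext i
    rw [← inner_conj_symm, ← e.repr_apply_apply, ← e.repr_apply_apply, h]
    have := Complex.conj_mul' (e.repr x i)
    push_cast
    linear_combination (-(m i : ℂ)) * this
  rw [heq]
  exact e.hasSum_inner_mul_inner x y

theorem HilbertBasis.hasSum_norm_sq (e : HilbertBasis ι ℂ 𝓗) (x : 𝓗) :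
    HasSum (fun i => ‖e.repr x i‖ ^ 2) (‖x‖ ^ 2) := by
  have h := e.hasSum_inner_self_weighted (x := x) (y := x) (m := fun _ => 1) (by simp)
  rw [inner_self_eq_norm_sq_to_K] at h
  simp only [mul_one] at h
  refine Complex.hasSum_ofReal.1 ?_
  rw [Complex.ofReal_pow]
  exact h

end HilbertBasis

namespace ProjValuedMeasure

variable {𝓗 : Type*} [NormedAddCommGroup 𝓗] [InnerProductSpace ℂ 𝓗] [CompleteSpace 𝓗] {ι : Type*}

theorem scalarMeasure_diagonal (e : HilbertBasis ι ℂ 𝓗) (m : ι → ℝ) (x : 𝓗) :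
    (diagonal e m).scalarMeasure x =
      Measure.sum (fun i => ENNReal.ofReal (‖e.repr x i‖ ^ 2) • Measure.dirac (m i)) := by
  ext s hs
  rw [scalarMeasure_apply _ _ hs, Measure.sum_apply _ hs]
  have h := e.hasSum_norm_sq (diagonalProj e m s x)
  change ENNReal.ofReal (‖diagonalProj e m s x‖ ^ 2) = _
  rw [← h.tsum_eq, ENNReal.ofReal_tsum_of_nonneg (fun _ => by positivity) h.summable]
  refine tsum_congr fun i => ?_
  rw [repr_diagonalProj, Measure.smul_apply, Measure.dirac_apply' _ hs]
  by_cases hi : m i ∈ s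
  · simp [indicator, hi]
  · simp [indicator, hi]

theorem isSpectralResolution_diagonal [Countable ι] (e : HilbertBasis ι ℂ 𝓗) (m : ι → ℝ)
    {H : 𝓗 →ₗ.[ℂ] 𝓗} (hdom : ∀ x, x ∈ H.domain ↔ Summable fun i => m i ^ 2 * ‖e.repr x i‖ ^ 2)
    (hH : ∀ (x : H.domain) i, e.repr (H x) i = m i * e.repr (x : 𝓗) i) :
    (diagonal e m).IsSpectralResolution H where
  mem_domain_iff x := by
    rw [hdom, scalarMeasure_diagonal, integrable_sum_dirac_iff fun i => ENNReal.ofReal_ne_top]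
    refine summable_congr fun i => ?_
    rw [ENNReal.toReal_ofReal (by positivity), Real.norm_of_nonneg (by positivity), mul_comm]
  inner_apply x := by
    have hint : Integrable (fun t : ℝ => t ^ 2) ((diagonal e m).scalarMeasure (x : 𝓗)) := by
      rw [scalarMeasure_diagonal, integrable_sum_dirac_iff fun i => ENNReal.ofReal_ne_top]
      refine ((hdom x).1 x.2).congr fun i => ?_
      rw [ENNReal.toReal_ofReal (by positivity), Real.norm_of_nonneg (by positivity), mul_comm]
    have h1 := integrable_id_of_sq hint
    rw [scalarMeasure_diagonal] at h1 ⊢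
    have h2 := hasSum_integral_measure h1
    simp only [integral_smul_measure, integral_dirac, smul_eq_mul,
      ENNReal.toReal_ofReal (sq_nonneg _)] at h2
    exact (e.hasSum_inner_self_weighted (hH x)).unique (Complex.hasSum_ofReal.2 h2)

end ProjValuedMeasure

/-- `T` is the resolvent `(H - lam)⁻¹`. -/
structure LinearPMap.IsResolventAt {𝓗 : Type*} [NormedAddCommGroup 𝓗] [InnerProductSpace ℂ 𝓗]
    (H : 𝓗 →ₗ.[ℂ] 𝓗) (lam : ℝ) (T : 𝓗 →L[ℂ] 𝓗) : Prop where
  mem_domain : ∀ f, T f ∈ H.domain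
  apply_self : ∀ f, H ⟨T f, mem_domain f⟩ = (lam : ℂ) • T f + f
  apply_sub : ∀ x : H.domain, T (H x - (lam : ℂ) • (x : 𝓗)) = x

namespace LinearPMap.IsResolventAt

variable {𝓗 : Type*} [NormedAddCommGroup 𝓗] [InnerProductSpace ℂ 𝓗]
  {H : 𝓗 →ₗ.[ℂ] 𝓗} {lam : ℝ} {T : 𝓗 →L[ℂ] 𝓗}

theorem symmetric (hT : H.IsResolventAt lam T) (hsymm : T.IsSymmetric) (x y : H.domain) :
    inner ℂ (H x) (y : 𝓗) = inner ℂ (x : 𝓗) (H y) := by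
  have h := hsymm (H x - (lam : ℂ) • (x : 𝓗)) (H y - (lam : ℂ) • (y : 𝓗))
  simp only [ContinuousLinearMap.coe_coe] at h
  rw [hT.apply_sub, hT.apply_sub, inner_sub_right, inner_sub_left, inner_smul_left,
    inner_smul_right, Complex.conj_ofReal] at h
  linear_combination -h

/-- The spectral theorem for compact symmetric operators makes the eigenvectors of T total. T is
injective, so its eigenvalues κ are nonzero; they are real, and Tf = κf gives Hf = (lam + κ⁻¹) f.
Simplicity allows the basis to be indexed by the eigenvalues themselves. -/
theorem exists_hilbertBasis [CompleteSpace 𝓗] (hT : H.IsResolventAt lam T) (hsymm : T.IsSymmetric)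
    (hcomp : IsCompactOperator T) {M : Set ℝ} (v : M → 𝓗) (hnorm : ∀ μ, ‖v μ‖ = 1)
    (hv : ∀ μ : M, ∃ h : v μ ∈ H.domain, H ⟨v μ, h⟩ = ((μ : ℝ) : ℂ) • v μ)
    (hsimple : ∀ (μ : ℝ) (x : H.domain), H x = (μ : ℂ) • (x : 𝓗) → (x : 𝓗) ≠ 0 →
      ∃ hμ : μ ∈ M, ∃ c : ℂ, (x : 𝓗) = c • v ⟨μ, hμ⟩) :
    ∃ e : HilbertBasis M ℂ 𝓗, ∀ μ, e μ = v μ := by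
  have hortho : Orthonormal ℂ v := by
    refine ⟨hnorm, fun μ ν hμν => ?_⟩
    obtain ⟨h1, h2⟩ := hv μ
    obtain ⟨h3, h4⟩ := hv ν
    have h5 := hT.symmetric hsymm ⟨v μ, h1⟩ ⟨v ν, h3⟩
    rw [h2, h4, inner_smul_left, inner_smul_right, Complex.conj_ofReal] at h5
    have h6 : ((μ : ℝ) : ℂ) - ((ν : ℝ) : ℂ) ≠ 0 := by
      rw [sub_ne_zero]
      exact fun h => hμν (Subtype.ext (Complex.ofReal_injective h))
    exact (mul_eq_zero.1 (by linear_combination h5 :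
      (((μ : ℝ) : ℂ) - ((ν : ℝ) : ℂ)) * inner ℂ (v μ) (v ν) = 0)).resolve_left h6
  have hle : ⨆ κ, Module.End.eigenspace (T : Module.End ℂ 𝓗) κ ≤ Submodule.span ℂ (Set.range v) := by
    refine iSup_le fun κ f hf => ?_
    by_cases hf0 : f = 0
    · rw [hf0]
      exact zero_mem _
    have hTf : T f = κ • f := Module.End.mem_eigenspace_iff.1 hf
    have hκ0 : κ ≠ 0 := by
      rintro rfl
      rw [zero_smul] at hTf
      have h1 := hT.apply_self f
      have h2 : (⟨T f, hT.mem_domain f⟩ : H.domain) = 0 := Subtype.ext hTf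
      rw [h2, H.map_zero, hTf, smul_zero, zero_add] at h1
      exact hf0 h1.symm
    have hκr : (starRingEnd ℂ) κ = κ :=
      hsymm.conj_eigenvalue_eq_self (Module.End.hasEigenvalue_of_hasEigenvector ⟨hf, hf0⟩)
    obtain ⟨k, rfl⟩ := Complex.conj_eq_iff_real.1 hκr
    have hfd : f ∈ H.domain := by
      have h1 := H.domain.smul_mem (k : ℂ)⁻¹ (hT.mem_domain f)
      rwa [hTf, smul_smul, inv_mul_cancel₀ hκ0, one_smul] at h1
    have hHf : H ⟨f, hfd⟩ = ((lam + k⁻¹ : ℝ) : ℂ) • f := by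
      have h1 := hT.apply_self f
      have h2 : (⟨T f, hT.mem_domain f⟩ : H.domain) = (k : ℂ) • ⟨f, hfd⟩ := Subtype.ext hTf
      rw [h2, H.map_smul, hTf] at h1
      have h3 := congrArg (fun y => (k : ℂ)⁻¹ • y) h1
      simp only [smul_add, smul_smul, inv_mul_cancel₀ hκ0, one_smul] at h3
      rw [h3, ← add_smul]
      congr 1
      push_cast
      field_simp
    obtain ⟨hμ, c, hc⟩ := hsimple _ ⟨f, hfd⟩ hHf hf0
    change f = _ at hc
    rw [hc]
    exact Submodule.smul_mem _ _ (Submodule.subset_span ⟨_, rfl⟩)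
  have hbot : (Submodule.span ℂ (Set.range v))ᗮ = ⊥ := by
    refine le_bot_iff.1 ((Submodule.orthogonal_le hle).trans_eq ?_)
    exact ContinuousLinearMap.orthogonalComplement_iSup_eigenspaces_eq_bot hcomp hsymm
  exact ⟨HilbertBasis.mkOfOrthogonalEqBot hortho hbot, fun μ => by simp⟩

theorem repr_apply (hT : H.IsResolventAt lam T) (hsymm : T.IsSymmetric) {ι : Type*}
    (e : HilbertBasis ι ℂ 𝓗) (m : ι → ℝ)
    (he : ∀ i, ∃ h : e i ∈ H.domain, H ⟨e i, h⟩ = (m i : ℂ) • e i) (x : H.domain) (i : ι) :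
    e.repr (H x) i = m i * e.repr (x : 𝓗) i := by
  obtain ⟨h1, h2⟩ := he i
  rw [e.repr_apply_apply, e.repr_apply_apply, ← hT.symmetric hsymm ⟨e i, h1⟩ x, h2,
    inner_smul_left, Complex.conj_ofReal]

/-- If the sum is finite, the series with coefficients m i · x i defines a vector y. Comparing
coefficients gives T (y - lam x) = x, so x lies in the range of T, which is contained in the domain.
-/
theorem mem_domain_iff_summable (hT : H.IsResolventAt lam T) (hsymm : T.IsSymmetric) {ι : Type*}
    (e : HilbertBasis ι ℂ 𝓗) (m : ι → ℝ)
    (he : ∀ i, ∃ h : e i ∈ H.domain, H ⟨e i, h⟩ = (m i : ℂ) • e i) (x : 𝓗) :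
    x ∈ H.domain ↔ Summable fun i => m i ^ 2 * ‖e.repr x i‖ ^ 2 := by
  constructor
  · intro hx
    refine (e.hasSum_norm_sq (H ⟨x, hx⟩)).summable.congr fun i => ?_
    rw [hT.repr_apply hsymm e m he, norm_mul, mul_pow, Complex.norm_real, Real.norm_eq_abs, sq_abs]
  · intro hx
    have hmem : Memℓp (fun i => (m i : ℂ) * e.repr x i) 2 := by
      rw [memℓp_gen_iff (by norm_num)]
      refine hx.congr fun i => ?_
      rw [norm_mul, Complex.norm_real, Real.norm_eq_abs]
      norm_num
      rw [mul_pow, sq_abs]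
    set y : 𝓗 := e.repr.symm ⟨_, hmem⟩ with hy
    have hyr : ∀ i, e.repr y i = m i * e.repr x i := fun i => by
      rw [hy, LinearIsometryEquiv.apply_symm_apply]
    suffices h : T (y - (lam : ℂ) • x) = x from h ▸ hT.mem_domain _
    apply e.repr.injective
    ext i
    obtain ⟨h1, h2⟩ := he i
    have h3 := hT.apply_sub ⟨e i, h1⟩
    have hs : T (((m i : ℂ) - lam) • e i) = ((m i : ℂ) - lam) • T (e i) := T.map_smul _ _
    rw [h2, ← sub_smul, hs] at h3
    change _ = e i at h3
    have h4 : (m i : ℂ) - lam ≠ 0 := by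
      intro h
      rw [h, zero_smul] at h3
      exact e.orthonormal.ne_zero i h3.symm
    have h5 : inner ℂ (T (e i)) (y - (lam : ℂ) • x) = inner ℂ (e i) (T (y - (lam : ℂ) • x)) :=
      hsymm _ _
    have h6 : T (e i) = ((m i : ℂ) - lam)⁻¹ • e i := by
      rw [eq_inv_smul_iff₀ h4, h3]
    rw [e.repr_apply_apply, ← h5, h6, inner_smul_left, inner_sub_right, inner_smul_right,
      ← e.repr_apply_apply, ← e.repr_apply_apply, hyr]
    have h7 : (starRingEnd ℂ) (((m i : ℂ) - lam)⁻¹) = ((m i : ℂ) - lam)⁻¹ := by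
      rw [map_inv₀, _root_.map_sub, Complex.conj_ofReal, Complex.conj_ofReal]
    rw [h7]
    field_simp

end LinearPMap.IsResolventAt

namespace SturmLiouville

/-! ### The weighted space and Lagrange's identity -/

section

variable {a b : ℝ} {p q r : ℝ → ℝ} {α β : ℝ}

namespace IsRegular

theorem aemeasurable_r (hreg : IsRegular a b p q r) :
    AEMeasurable (fun x => ENNReal.ofReal (r x)) (volume.restrict (Ioo a b)) :=
  hreg.integrable_r.aestronglyMeasurable.aemeasurable.ennreal_ofReal

theorem ae_toReal_ofReal (hreg : IsRegular a b p q r) :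
    ∀ᵐ x ∂(volume.restrict (Ioo a b)), (ENNReal.ofReal (r x)).toReal = r x := by
  filter_upwards [hreg.r_pos] with x hx using ENNReal.toReal_ofReal hx.le

theorem integrable_weight_iff {E : Type*} [NormedAddCommGroup E] [NormedSpace ℝ E]
    (hreg : IsRegular a b p q r) {f : ℝ → E} :
    Integrable f (weight a b r) ↔ IntegrableOn (fun x => r x • f x) (Ioo a b) := by
  rw [weight, integrable_withDensity_iff_integrable_smul₀' hreg.aemeasurable_r
    (Filter.Eventually.of_forall fun _ => ENNReal.ofReal_lt_top)]
  refine integrable_congr ?_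
  filter_upwards [hreg.ae_toReal_ofReal] with x hx
  rw [hx]

theorem integral_weight {E : Type*} [NormedAddCommGroup E] [NormedSpace ℝ E]
    (hreg : IsRegular a b p q r) (f : ℝ → E) :
    ∫ x, f x ∂(weight a b r) = ∫ x in Ioo a b, r x • f x := by
  rw [weight, integral_withDensity_eq_integral_toReal_smul₀ hreg.aemeasurable_r
    (Filter.Eventually.of_forall fun _ => ENNReal.ofReal_lt_top)]
  refine integral_congr_ae ?_
  filter_upwards [hreg.ae_toReal_ofReal] with x hx
  rw [hx]

theorem isFiniteMeasure_weight (hreg : IsRegular a b p q r) : IsFiniteMeasure (weight a b r) := by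
  have h := (hreg.integrable_weight_iff (f := fun _ => (1 : ℝ))).2
    (by simpa using hreg.integrable_r)
  rwa [integrable_const_iff_isFiniteMeasure one_ne_zero] at h

/-- The weight is a finite measure, so L² embeds continuously in L¹; this makes r f a legitimate
integrand on (a, b). -/
theorem exists_integral_norm_le (hreg : IsRegular a b p q r) :
    ∃ c : ℝ, 0 ≤ c ∧ ∀ f : L2 a b r, IntegrableOn (fun x => r x • f x) (Ioo a b) ∧
      ∫ x in Ioo a b, ‖r x • f x‖ ≤ c * ‖f‖ := by
  have := hreg.isFiniteMeasure_weight
  set C : ENNReal := weight a b r Set.univ ^ (1 / (1 : ENNReal).toReal - 1 / (2 : ENNReal).toReal)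
    with hC
  have hCtop : C ≠ ⊤ := ENNReal.rpow_ne_top_of_nonneg (by norm_num) (measure_ne_top _ _)
  refine ⟨C.toReal, ENNReal.toReal_nonneg, fun f => ?_⟩
  have hi : Integrable f (weight a b r) := (Lp.memLp f).integrable (by norm_num)
  refine ⟨hreg.integrable_weight_iff.1 hi, ?_⟩
  have h1 : ∫ x in Ioo a b, ‖r x • f x‖ = ∫ x, ‖f x‖ ∂(weight a b r) := by
    rw [hreg.integral_weight]
    refine integral_congr_ae ?_
    filter_upwards [hreg.r_pos] with x hx
    rw [norm_smul, Real.norm_of_nonneg hx.le, smul_eq_mul]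
  rw [h1, integral_norm_eq_lintegral_enorm hi.aestronglyMeasurable, ← eLpNorm_one_eq_lintegral_enorm,
    Lp.norm_def, mul_comm, ← ENNReal.toReal_mul]
  refine ENNReal.toReal_mono (ENNReal.mul_ne_top (Lp.eLpNorm_ne_top f) hCtop) ?_
  exact eLpNorm_le_eLpNorm_mul_rpow_measure_univ (by norm_num) hi.aestronglyMeasurable

end IsRegular

theorem BoundaryCond.clm {E F : Type*} [NormedAddCommGroup E] [NormedSpace ℝ E]
    [NormedAddCommGroup F] [NormedSpace ℝ F] (L : E →L[ℝ] F) {c γ : ℝ} {u w : ℝ → E}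
    (h : BoundaryCond c γ u w) : BoundaryCond c γ (fun x => L (u x)) (fun x => L (w x)) := by
  unfold BoundaryCond at *
  rw [← map_smul, ← map_smul, ← map_sub, h, map_zero]

theorem ae_weight_of_ae {P : ℝ → Prop} (h : ∀ᵐ x ∂(volume.restrict (Ioo a b)), P x) :
    ∀ᵐ x ∂(weight a b r), P x :=
  (withDensity_absolutelyContinuous _ _).ae_le h

/-- The Sturm–Liouville operator is symmetric. -/
theorem graph_symmetric (hab : a < b) (hreg : IsRegular a b p q r) {F G : L2 a b r × L2 a b r}
    (hF : F ∈ graph a b p q r α β) (hG : G ∈ graph a b p q r α β) :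
    inner ℂ F.2 G.1 = inner ℂ F.1 G.2 := by
  obtain ⟨u, w, g, hu, hg, h, ha, hb⟩ := hF
  obtain ⟨u', w', g', hu', hg', h', ha', hb'⟩ := hG
  have hC := h.clm (Complex.conjCLE : ℂ →L[ℝ] ℂ)
  have hL := hC.lagrange h'
  have hbdry : ∀ {c γ : ℝ}, BoundaryCond c γ u w → BoundaryCond c γ u' w' →
      Complex.conjCLE (u c) * w' c - Complex.conjCLE (w c) * u' c = 0 := fun h1 h2 =>
    (h1.clm (Complex.conjCLE : ℂ →L[ℝ] ℂ)).wronskian_eq_zero h2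
  -- Apart from the factor r, the integrand is the derivative of the Wronskian of conj u and u',
  -- which vanishes at both endpoints.
  have e1 : (fun x => inner ℂ (F.2 x) (G.1 x) - inner ℂ (F.1 x) (G.2 x)) =ᵐ[weight a b r]
      fun x => Complex.conjCLE (g x) * u' x - Complex.conjCLE (u x) * g' x := by
    filter_upwards [hu, hg, hu', hg'] with x h1 h2 h3 h4
    rw [h1, h2, h3, h4, RCLike.inner_apply, RCLike.inner_apply]
    simp only [Complex.conjCLE_apply]
    ring
  have hint : Integrable (fun x => inner ℂ (F.2 x) (G.1 x) - inner ℂ (F.1 x) (G.2 x))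
      (weight a b r) := (L2.integrable_inner F.2 G.1).sub (L2.integrable_inner F.1 G.2)
  rw [← sub_eq_zero, L2.inner_def, L2.inner_def, ← integral_sub (L2.integrable_inner F.2 G.1)
    (L2.integrable_inner F.1 G.2), integral_congr_ae e1, hreg.integral_weight]
  have hint' := hreg.integrable_weight_iff.1 (hint.congr e1)
  simp only [Complex.real_smul] at hint' ⊢
  have h5 := hL.eq_add_integral hab.le hint' b (right_mem_Icc.2 hab.le)
  rw [intervalIntegral.integral_of_le hab.le, integral_Ioc_eq_integral_Ioo] at h5
  have h6 := hbdry ha ha'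
  have h7 := hbdry hb hb'
  have h8 : (0 : ℂ) = 0 + ∫ t in Ioo a b, (r t : ℂ) * (Complex.conjCLE (g t) * u' t -
      Complex.conjCLE (u t) * g' t) := by
    calc (0 : ℂ) = _ := h7.symm
      _ = _ := h5
      _ = _ := by
        congr 1
  rw [zero_add] at h8
  exact h8.symm

/-! ### Green's function -/

/-- A parameter `lam` with a solution `ψ` satisfying the boundary condition at `a` and a solution
`χ` satisfying the boundary condition at `b` that are linearly independent. -/
structure GreenPair (a b : ℝ) (p q r : ℝ → ℝ) (α β lam : ℝ) (ψ ψ' χ χ' : ℝ → ℝ) : Prop where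
  tauEq_left : TauEq a b p q r ψ ψ' (fun x => lam * ψ x)
  tauEq_right : TauEq a b p q r χ χ' (fun x => lam * χ x)
  boundary_left : BoundaryCond a α ψ ψ'
  boundary_right : BoundaryCond b β χ χ'
  wronskian_ne_zero : ψ a * χ' a - ψ' a * χ a ≠ 0

theorem tauEq_bounded (hab : a < b) {E : Type*} [NormedAddCommGroup E] [NormedSpace ℝ E]
    {u w g : ℝ → E} (h : TauEq a b p q r u w g) :
    ∃ C, 0 ≤ C ∧ ∀ x ∈ Icc a b, ‖u x‖ ≤ C ∧ ‖w x‖ ≤ C := by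
  obtain ⟨C, hC⟩ := h.ac_u.exists_bound
  obtain ⟨D, hD⟩ := h.ac_w.exists_bound
  rw [uIcc_of_le hab.le] at hC hD
  refine ⟨max C D, ((norm_nonneg _).trans (hC a (left_mem_Icc.2 hab.le))).trans (le_max_left _ _),
    fun x hx => ⟨(hC x hx).trans (le_max_left _ _), (hD x hx).trans (le_max_right _ _)⟩⟩

/-- Solvability of `(H - lam) u = f` with bounds, by variation of constants. -/
theorem GreenPair.exists_solution (hab : a < b) (hreg : IsRegular a b p q r) {lam : ℝ}
    {ψ ψ' χ χ' : ℝ → ℝ} (h : GreenPair a b p q r α β lam ψ ψ' χ χ') :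
    ∃ C : ℝ, 0 ≤ C ∧ ∀ f : L2 a b r, ∃ u w : ℝ → ℂ,
      TauEq a b p q r u w (fun x => (lam : ℂ) * u x + f x) ∧ BoundaryCond a α u w ∧
        BoundaryCond b β u w ∧ ∀ x ∈ Icc a b, ‖u x‖ ≤ C * ‖f‖ ∧ ‖w x‖ ≤ C * ‖f‖ := by
  obtain ⟨c, hc0, hc⟩ := hreg.exists_integral_norm_le
  have hl := h.tauEq_left.ofReal
  have hr := h.tauEq_right.ofReal
  obtain ⟨Cl, hCl0, hCl⟩ := tauEq_bounded hab hl
  obtain ⟨Cr, hCr0, hCr⟩ := tauEq_bounded hab hr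
  set W : ℝ := ψ a * χ' a - ψ' a * χ a with hW
  have hW0 : (W : ℂ) ≠ 0 := Complex.ofReal_ne_zero.2 h.wronskian_ne_zero
  have hWx : ∀ x ∈ Icc a b, ((ψ x : ℂ) * χ' x - ψ' x * χ x) = W := fun x hx => by
    exact_mod_cast h.tauEq_left.wronskian_const hab.le h.tauEq_right x hx
  refine ⟨‖(-(W : ℂ)⁻¹)‖ * (2 * (Cl * (Cr * c))), by positivity, fun f => ?_⟩
  obtain ⟨hfi, hfn⟩ := hc f
  have ha := left_mem_Icc.2 hab.le
  have hb := right_mem_Icc.2 hab.le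
  have hil : IntegrableOn (fun x => (r x • f x) * (ψ x : ℂ)) (Ioo a b) :=
    integrableOn_mul_continuousOn hfi (hl.isPrimitive_u.continuousOn hab.le)
  have hir : IntegrableOn (fun x => (r x • f x) * (χ x : ℂ)) (Ioo a b) :=
    integrableOn_mul_continuousOn hfi (hr.isPrimitive_u.continuousOn hab.le)
  -- The solution is u = -W⁻¹ (χ A + ψ B) with A = ∫ₐˣ r f ψ and B = ∫ₓᵇ r f χ. Since A(a) = 0 and
  -- B(b) = 0, it inherits the boundary condition of ψ at a and of χ at b.
  set A : ℝ → ℂ := fun x => ∫ t in a..x, (r t • f t) * (ψ t : ℂ) with hA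
  set B : ℝ → ℂ := fun x => (∫ t in a..b, (r t • f t) * (χ t : ℂ)) -
    ∫ t in a..x, (r t • f t) * (χ t : ℂ) with hB
  have hAp : IsPrimitive a b A (fun x => (r x • f x) * (ψ x : ℂ)) :=
    IsPrimitive.integral hab.le hil
  have hBp : IsPrimitive a b B (fun x => -((r x • f x) * (χ x : ℂ))) := by
    simpa only [zero_sub] using (IsPrimitive.const (a := a) (b := b)
      (∫ t in a..b, (r t • f t) * (χ t : ℂ))).sub (IsPrimitive.integral hab.le hir)
  have hAa : A a = 0 := by simp [hA]
  have hBb : B b = 0 := by simp [hB]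
  have hbound : ∀ {φ : ℝ → ℝ} {D : ℝ}, 0 ≤ D → (∀ x ∈ Icc a b, ‖(φ x : ℂ)‖ ≤ D) →
      ∀ x ∈ Icc a b, ∀ y ∈ Icc a b, x ≤ y →
        ‖∫ t in x..y, (r t • f t) * (φ t : ℂ)‖ ≤ D * (c * ‖f‖) := by
    intro φ D hD hφ x hx y hy hxy
    have h1 : ‖∫ t in x..y, (r t • f t) * (φ t : ℂ)‖ ≤ ∫ t in x..y, D * ‖r t • f t‖ := by
      refine intervalIntegral.norm_integral_le_of_norm_le hxy ?_
        ((intervalIntegrable_of_Ioo hfi.norm hx hy).const_mul D)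
      refine Filter.Eventually.of_forall fun t ht => ?_
      rw [norm_mul, mul_comm]
      exact mul_le_mul_of_nonneg_right (hφ t ⟨hx.1.trans ht.1.le, ht.2.trans hy.2⟩) (norm_nonneg _)
    refine h1.trans ?_
    rw [intervalIntegral.integral_const_mul, intervalIntegral.integral_of_le hxy,
      integral_Ioc_eq_integral_Ioo]
    refine mul_le_mul_of_nonneg_left (le_trans ?_ hfn) hD
    exact setIntegral_mono_set hfi.norm (Filter.Eventually.of_forall fun _ => norm_nonneg _)
      (Ioo_subset_Ioo hx.1 hy.2).eventuallyLE
  have hAn : ∀ x ∈ Icc a b, ‖A x‖ ≤ Cl * (c * ‖f‖) := fun x hx =>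
    hbound hCl0 (fun y hy => (hCl y hy).1) a ha x hx hx.1
  have hBn : ∀ x ∈ Icc a b, ‖B x‖ ≤ Cr * (c * ‖f‖) := fun x hx => by
    have h2 : B x = ∫ t in x..b, (r t • f t) * (χ t : ℂ) :=
      intervalIntegral.integral_interval_sub_left (intervalIntegrable_of_Ioo hir ha hb)
        (intervalIntegrable_of_Ioo hir ha hx)
    rw [h2]
    exact hbound hCr0 (fun y hy => (hCr y hy).1) x hx b hb hx.2
  have hnorm : ∀ {X Y : ℂ}, ‖X‖ ≤ Cl → ‖Y‖ ≤ Cr → ∀ x ∈ Icc a b,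
      ‖-(W : ℂ)⁻¹ * (Y * A x + X * B x)‖ ≤ ‖(-(W : ℂ)⁻¹)‖ * (2 * (Cl * (Cr * c))) * ‖f‖ := by
    intro X Y hX hY x hx
    rw [norm_mul, mul_assoc]
    refine mul_le_mul_of_nonneg_left ((norm_add_le _ _).trans ?_) (norm_nonneg _)
    rw [norm_mul, norm_mul]
    have h3 : ‖Y‖ * ‖A x‖ ≤ Cr * (Cl * (c * ‖f‖)) :=
      mul_le_mul hY (hAn x hx) (norm_nonneg _) hCr0
    have h4 : ‖X‖ * ‖B x‖ ≤ Cl * (Cr * (c * ‖f‖)) :=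
      mul_le_mul hX (hBn x hx) (norm_nonneg _) hCl0
    linarith
  refine ⟨fun x => -(W : ℂ)⁻¹ * (χ x * A x + ψ x * B x),
    fun x => -(W : ℂ)⁻¹ * (χ' x * A x + ψ' x * B x), .of_isPrimitive ?_ ?_, ?_, ?_,
    fun x hx => ⟨hnorm (hCl x hx).1 (hCr x hx).1 x hx, hnorm (hCl x hx).2 (hCr x hx).2 x hx⟩⟩
  · refine ((IsPrimitive.const (-(W : ℂ)⁻¹)).mul ((hr.isPrimitive_u.mul hAp).add
      (hl.isPrimitive_u.mul hBp))).congr_deriv (Filter.Eventually.of_forall fun x => ?_)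
    simp only [Complex.real_smul]
    ring
  · refine ((IsPrimitive.const (-(W : ℂ)⁻¹)).mul ((hr.isPrimitive_w.mul hAp).add
      (hl.isPrimitive_w.mul hBp))).congr_deriv ?_
    filter_upwards [ae_restrict_mem measurableSet_Ioo] with x hx
    have h5 := hWx x (Ioo_subset_Icc_self hx)
    simp only [Complex.real_smul]
    push_cast
    have h6 : (W : ℂ)⁻¹ * W = 1 := inv_mul_cancel₀ hW0
    linear_combination (-(r x : ℂ) * f x * (W : ℂ)⁻¹) * h5 + (-(r x : ℂ) * f x) * h6
  · have h7 := (boundaryCond_ofReal.2 h.boundary_left)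
    simp only [BoundaryCond, Complex.real_smul, hAa, mul_zero, zero_add] at h7 ⊢
    linear_combination (-(W : ℂ)⁻¹ * B a) * h7
  · have h7 := (boundaryCond_ofReal.2 h.boundary_right)
    simp only [BoundaryCond, Complex.real_smul, hBb, mul_zero, add_zero] at h7 ⊢
    linear_combination (-(W : ℂ)⁻¹ * A b) * h7

end

/-! ### The resolvent -/

section

variable {a b : ℝ} {p q r : ℝ → ℝ} {α β : ℝ}

theorem mem_graph_iff_operator (hab : a < b) (hreg : IsRegular a b p q r) {x y : L2 a b r} :
    (x, y) ∈ graph a b p q r α β ↔ ∃ h : x ∈ (operator a b p q r α β).domain,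
      operator a b p q r α β ⟨x, h⟩ = y := by
  rw [← operator_graph hab hreg, LinearPMap.mem_graph_iff]
  constructor
  · rintro ⟨z, rfl, rfl⟩
    exact ⟨z.2, rfl⟩
  · rintro ⟨h, rfl⟩
    exact ⟨⟨x, h⟩, rfl, rfl⟩

theorem exists_tauEq_of_mem_graph (hreg : IsRegular a b p q r) {x : L2 a b r} {z : ℂ}
    (h : (x, z • x) ∈ graph a b p q r α β) :
    ∃ u w : ℝ → ℂ, x =ᵐ[weight a b r] u ∧ TauEq a b p q r u w (fun t => z * u t) ∧
      BoundaryCond a α u w ∧ BoundaryCond b β u w := by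
  obtain ⟨u, w, g, hu, hg, ht, ha, hb⟩ := h
  refine ⟨u, w, hu, ht.congr_right (ae_of_ae_weight hreg ?_), ha, hb⟩
  filter_upwards [hu, hg, Lp.coeFn_smul z x] with t h1 h2 h3
  change (z • x : L2 a b r) t = g t at h2
  rw [← h2, h3, Pi.smul_apply, smul_eq_mul, h1]

/-- An eigenfunction would have zero Wronskian with ψ, by the condition at a, and with χ, by the
condition at b; these two are independent. -/
theorem GreenPair.eq_zero_of_mem_graph (hab : a < b) (hreg : IsRegular a b p q r) {lam : ℝ}
    {ψ ψ' χ χ' : ℝ → ℝ} (h : GreenPair a b p q r α β lam ψ ψ' χ χ') {x : L2 a b r}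
    (hx : (x, (lam : ℂ) • x) ∈ graph a b p q r α β) : x = 0 := by
  obtain ⟨u, w, hu, ht, hua, hub⟩ := exists_tauEq_of_mem_graph hreg hx
  have hl := h.tauEq_left.ofReal
  have hr := h.tauEq_right.ofReal
  simp only [Complex.ofReal_mul (r := lam)] at hl hr
  have ha := left_mem_Icc.2 hab.le
  have hb := right_mem_Icc.2 hab.le
  have hWl := ht.wronskian_const hab.le hl
  have hWr := ht.wronskian_const hab.le hr
  have hW := hl.wronskian_const hab.le hr
  rw [hua.wronskian_eq_zero (boundaryCond_ofReal.2 h.boundary_left)] at hWl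
  rw [← hWr b hb, hub.wronskian_eq_zero (boundaryCond_ofReal.2 h.boundary_right)] at hWr
  have hne : (ψ a : ℂ) * χ' a - ψ' a * χ a ≠ 0 := by
    exact_mod_cast h.wronskian_ne_zero
  have hu0 : ∀ t ∈ Icc a b, u t = 0 := by
    intro t ht
    refine (mul_eq_zero.1 (?_ : u t * ((ψ a : ℂ) * χ' a - ψ' a * χ a) = 0)).resolve_right hne
    rw [← hW t ht]
    linear_combination ψ t * hWr t ht - χ t * hWl t ht
  refine Lp.ext ?_
  filter_upwards [hu, ae_weight_of_ae (ae_restrict_mem measurableSet_Ioo),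
    Lp.coeFn_zero ℂ 2 (weight a b r)] with t h1 h2 h3
  rw [h1, hu0 t (Ioo_subset_Icc_self h2), h3, Pi.zero_apply]

/-- Continuous functions on `[a, b]` as elements of the weighted space. -/
def ofBounded (hab : a ≤ b) (r : ℝ → ℝ) [IsFiniteMeasure (weight a b r)] :
    BoundedContinuousFunction (Icc a b) ℂ →L[ℂ] L2 a b r :=
  (BoundedContinuousFunction.toLp 2 (weight a b r) ℂ).comp
    (BoundedContinuousFunction.compContinuousCLM ℂ ℂ ⟨projIcc a b hab, continuous_projIcc⟩)

theorem coeFn_ofBounded (hab : a ≤ b) [IsFiniteMeasure (weight a b r)]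
    (g : BoundedContinuousFunction (Icc a b) ℂ) :
    ofBounded hab r g =ᵐ[weight a b r] fun x => g (projIcc a b hab x) :=
  BoundedContinuousFunction.coeFn_toLp 2 (weight a b r) ℂ
    (g.compContinuous ⟨projIcc a b hab, continuous_projIcc⟩)

/-- Since u' = p⁻¹ w, a bound on w alone gives u the modulus of continuity of ∫ |p⁻¹|: this is the
source of equicontinuity. -/
theorem tauEq_norm_sub_le (hab : a < b) (hreg : IsRegular a b p q r) {u w g : ℝ → ℂ} {C : ℝ}
    (h : TauEq a b p q r u w g) (hC : ∀ x ∈ Icc a b, ‖w x‖ ≤ C) {x y : ℝ} (hx : x ∈ Icc a b)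
    (hy : y ∈ Icc a b) :
    ‖u y - u x‖ ≤ C * |(∫ t in a..y, ‖(p t)⁻¹‖) - ∫ t in a..x, ‖(p t)⁻¹‖| := by
  have ha := left_mem_Icc.2 hab.le
  have hi : IntegrableOn (fun x => (p x)⁻¹ • w x) (Ioo a b) := by
    have h1 : IntegrableOn (fun x => (((p x)⁻¹ : ℝ) : ℂ) * w x) (Ioo a b) :=
      integrableOn_mul_continuousOn (hreg.integrable_inv_p.ofReal)
        (h.isPrimitive_w.continuousOn hab.le)
    simpa only [Complex.real_smul] using h1
  have hip := hreg.integrable_inv_p.norm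
  have hC0 : 0 ≤ C := (norm_nonneg _).trans (hC a ha)
  rw [h.isPrimitive_u.eq_add_integral hab.le hi x hx, h.isPrimitive_u.eq_add_integral hab.le hi y hy,
    add_sub_add_left_eq_sub, intervalIntegral.integral_interval_sub_left
      (intervalIntegrable_of_Ioo hi ha hy) (intervalIntegrable_of_Ioo hi ha hx),
    intervalIntegral.integral_interval_sub_left
      (intervalIntegrable_of_Ioo hip ha hy) (intervalIntegrable_of_Ioo hip ha hx),
    show C * |∫ t in x..y, ‖(p t)⁻¹‖| = |C * ∫ t in x..y, ‖(p t)⁻¹‖| by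
      rw [abs_mul, abs_of_nonneg hC0],
    ← intervalIntegral.integral_const_mul]
  refine intervalIntegral.norm_integral_le_abs_of_norm_le ?_
    ((intervalIntegrable_of_Ioo hip hx hy).const_mul C)
  filter_upwards [ae_restrict_mem measurableSet_uIoc] with t ht
  rw [norm_smul, mul_comm]
  exact mul_le_mul_of_nonneg_right (hC t (uIcc_subset_Icc hx hy (uIoc_subset_uIcc ht)))
    (norm_nonneg _)

theorem GreenPair.exists_bounded_solution (hab : a < b) (hreg : IsRegular a b p q r)
    [IsFiniteMeasure (weight a b r)] {lam : ℝ}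
    {ψ ψ' χ χ' : ℝ → ℝ} (h : GreenPair a b p q r α β lam ψ ψ' χ χ') :
    ∃ C : ℝ, 0 ≤ C ∧ ∀ f : L2 a b r, ∃ g : BoundedContinuousFunction (Icc a b) ℂ,
      (ofBounded hab.le r g, (lam : ℂ) • ofBounded hab.le r g + f) ∈ graph a b p q r α β ∧
        (∀ x, ‖g x‖ ≤ C * ‖f‖) ∧ ∀ x y : Icc a b, ‖g y - g x‖ ≤ C * ‖f‖ *
          |(∫ t in a..(y : ℝ), ‖(p t)⁻¹‖) - ∫ t in a..(x : ℝ), ‖(p t)⁻¹‖| := by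
  obtain ⟨C, hC0, hC⟩ := h.exists_solution hab hreg
  refine ⟨C, hC0, fun f => ?_⟩
  obtain ⟨u, w, ht, hua, hub, hbd⟩ := hC f
  set g : BoundedContinuousFunction (Icc a b) ℂ := BoundedContinuousFunction.mkOfCompact
    ⟨(Icc a b).domRestrict u, continuousOn_iff_continuous_domRestrict.1
      (ht.isPrimitive_u.continuousOn hab.le)⟩ with hg
  have hgu : ofBounded hab.le r g =ᵐ[weight a b r] u := by
    filter_upwards [coeFn_ofBounded (r := r) hab.le g,
      ae_weight_of_ae (ae_restrict_mem measurableSet_Ioo)] with x h1 h2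
    rw [h1, projIcc_of_mem hab.le (Ioo_subset_Icc_self h2)]
    rfl
  refine ⟨g, ⟨u, w, fun x => (lam : ℂ) * u x + f x, hgu, ?_, ht, hua, hub⟩,
    fun x => (hbd x x.2).1, fun x y => tauEq_norm_sub_le hab hreg ht
      (fun z hz => (hbd z hz).2) x.2 y.2⟩
  filter_upwards [hgu, Lp.coeFn_add ((lam : ℂ) • ofBounded hab.le r g) f,
    Lp.coeFn_smul (lam : ℂ) (ofBounded hab.le r g)] with x h1 h2 h3
  rw [h2, Pi.add_apply, h3, Pi.smul_apply, h1, smul_eq_mul]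

/-- Off the spectrum the resolvent is a compact symmetric operator. -/
theorem GreenPair.exists_resolvent (hab : a < b) (hreg : IsRegular a b p q r) {lam : ℝ}
    {ψ ψ' χ χ' : ℝ → ℝ} (h : GreenPair a b p q r α β lam ψ ψ' χ χ') :
    ∃ T : L2 a b r →L[ℂ] L2 a b r, (operator a b p q r α β).IsResolventAt lam T ∧
      T.IsSymmetric ∧ IsCompactOperator T := by
  have := hreg.isFiniteMeasure_weight
  obtain ⟨C, hC0, hC⟩ := h.exists_bounded_solution hab hreg
  choose S hS hS1 hS2 using hC
  have huniq : ∀ x y f : L2 a b r, (x, (lam : ℂ) • x + f) ∈ graph a b p q r α β →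
      (y, (lam : ℂ) • y + f) ∈ graph a b p q r α β → x = y := by
    intro x y f hx hy
    have h1 := Submodule.sub_mem _ hx hy
    rw [Prod.mk_sub_mk, add_sub_add_right_eq_sub, ← smul_sub] at h1
    exact sub_eq_zero.1 (h.eq_zero_of_mem_graph hab hreg h1)
  -- `S` is only a choice of solutions; linearity comes from their uniqueness.
  set T₀ : L2 a b r →ₗ[ℂ] L2 a b r :=
    { toFun := fun f => ofBounded hab.le r (S f)
      map_add' := fun f g => by
        refine huniq _ _ (f + g) (hS _) ?_
        have h1 := Submodule.add_mem _ (hS f) (hS g)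
        rw [Prod.mk_add_mk] at h1
        rwa [add_add_add_comm, ← smul_add] at h1
      map_smul' := fun c f => by
        refine huniq _ _ (c • f) (hS _) ?_
        have h1 := Submodule.smul_mem _ c (hS f)
        rw [Prod.smul_mk] at h1
        rw [smul_add, smul_comm] at h1
        exact h1 } with hT₀
  have hT₀g : ∀ f, (T₀ f, (lam : ℂ) • T₀ f + f) ∈ graph a b p q r α β := hS
  have hsymm : T₀.IsSymmetric := by
    intro f g
    have h1 := graph_symmetric hab hreg (hT₀g f) (hT₀g g)
    dsimp only at h1
    rw [inner_add_left, inner_add_right, inner_smul_left, inner_smul_right,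
      Complex.conj_ofReal] at h1
    linear_combination -h1
  -- A symmetric operator defined on the whole Hilbert space is bounded (Hellinger–Toeplitz).
  refine ⟨⟨T₀, hsymm.continuous⟩, ⟨fun f => ?_, fun f => ?_, fun x => ?_⟩, hsymm, ?_⟩
  · exact ((mem_graph_iff_operator hab hreg).1 (hT₀g f)).1
  · exact ((mem_graph_iff_operator hab hreg).1 (hT₀g f)).2
  · refine huniq _ _ _ (hT₀g _) ?_
    rw [add_sub_cancel]
    exact (mem_graph_iff_operator hab hreg).2 ⟨x.2, rfl⟩
  -- Arzelà–Ascoli makes the image of the unit ball relatively compact in the sup norm, and the map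
  -- into L² is continuous.
  · set A : Set (BoundedContinuousFunction (Icc a b) ℂ) := S '' Metric.ball 0 1 with hA
    have hK : ContinuousOn (fun x => ∫ t in a..x, ‖(p t)⁻¹‖) (Icc a b) :=
      (IsPrimitive.integral hab.le hreg.integrable_inv_p.norm).continuousOn hab.le
    have hK' := continuousOn_iff_continuous_domRestrict.1 hK
    have hcompact : IsCompact (closure A) := by
      refine BoundedContinuousFunction.arzela_ascoli (Metric.closedBall 0 C)
        (isCompact_closedBall _ _) A ?_ ?_
      · rintro _ x ⟨f, hf, rfl⟩
        rw [mem_ball_zero_iff] at hf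
        rw [mem_closedBall_zero_iff]
        exact (hS1 f x).trans (mul_le_of_le_one_right hC0 hf.le)
      · intro x₀
        rw [Metric.equicontinuousAt_iff]
        intro ε hε
        obtain ⟨δ, hδ, hδK⟩ := Metric.continuousAt_iff.1 (hK'.continuousAt (x := x₀)) (ε / (C + 1))
          (by positivity)
        refine ⟨δ, hδ, ?_⟩
        rintro x hx ⟨_, f, hf, rfl⟩
        rw [mem_ball_zero_iff] at hf
        have h1 := hδK hx
        rw [Real.dist_eq] at h1
        rw [dist_comm, dist_eq_norm]
        refine (hS2 f x₀ x).trans_lt ?_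
        have h2 : C * ‖f‖ ≤ C := mul_le_of_le_one_right hC0 hf.le
        calc _ ≤ C * (ε / (C + 1)) := mul_le_mul h2 h1.le (abs_nonneg _) hC0
          _ < (C + 1) * (ε / (C + 1)) := by
            have : 0 < ε / (C + 1) := by positivity
            nlinarith
          _ = ε := by field_simp
    refine ⟨ofBounded hab.le r '' closure A, hcompact.image (ofBounded hab.le r).continuous, ?_⟩
    refine Filter.mem_of_superset (Metric.ball_mem_nhds 0 one_pos) fun f hf => ?_
    exact ⟨S f, subset_closure ⟨f, hf, rfl⟩, rfl⟩

end

/-! ### Eigenvalues and the dimension of spectral subspaces -/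

section

variable {a b : ℝ} {p q r : ℝ → ℝ} {α β : ℝ} {θ : ℝ → ℝ → ℝ}

theorem boundaryCond_right_iff {t R : ℝ} {u w : ℝ → ℝ} {c γ : ℝ} (hR : 0 < R)
    (hu : u c = R * Real.sin t) (hw : w c = R * Real.cos t) :
    BoundaryCond c γ u w ↔ ∃ k : ℤ, t = γ + k * Real.pi := by
  rw [boundaryCond_polar hR hu hw, Real.sin_eq_zero_iff]
  exact exists_congr fun k => ⟨fun h => by linarith, fun h => by linarith⟩

/-- Choose lam with 0 < θ lam b < β. The angle at `b` then misses β + πℤ, so the solution from the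
left violates the condition at `b`. -/
theorem IsPruferFamily.exists_greenPair (h : IsPruferFamily a b p q r α θ) (hab : a < b)
    (hreg : IsRegular a b p q r) (hα0 : 0 ≤ α) (hα : α < Real.pi) (hβ0 : 0 < β)
    (hβ : β ≤ Real.pi) : ∃ (lam : ℝ) (ψ ψ' χ χ' : ℝ → ℝ), GreenPair a b p q r α β lam ψ ψ' χ χ' := by
  obtain ⟨lam, hlam⟩ := h.exists_lt hab hreg hα0 hα hβ0
  have hpos := h.pos hab hreg hα0 lam
  obtain ⟨ρ, hρ, hψ⟩ := (h.isPruferSolution lam).exists_tauEq hab hreg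
  obtain ⟨η, hηa, hη⟩ := exists_isPruferSolution hab hreg lam (α + Real.pi / 2)
  obtain ⟨σ, hσ, hφ⟩ := hη.exists_tauEq hab hreg
  set ψ := fun x => ρ x * Real.sin (θ lam x) with hψd
  set ψ' := fun x => ρ x * Real.cos (θ lam x) with hψ'd
  set φ := fun x => σ x * Real.sin (η x) with hφd
  set φ' := fun x => σ x * Real.cos (η x) with hφ'd
  -- These coefficients make c₁ψ + c₂φ satisfy the condition at b; c₂ ≠ 0 keeps it independent of ψ.
  set c₁ := Real.cos β * φ b - Real.sin β * φ' b with hc₁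
  set c₂ := -(Real.cos β * ψ b - Real.sin β * ψ' b) with hc₂
  have hc₂0 : c₂ ≠ 0 := by
    have h1 : c₂ = ρ b * Real.sin (β - θ lam b) := by
      rw [Real.sin_sub]
      simp only [hc₂, hψd, hψ'd]
      ring
    rw [h1]
    exact (mul_pos (hρ b) (Real.sin_pos_of_pos_of_lt_pi (by linarith) (by linarith))).ne'
  have hχ := (hψ.clm (c₁ • ContinuousLinearMap.id ℝ ℝ)).add (hφ.clm (c₂ • ContinuousLinearMap.id ℝ ℝ))
  refine ⟨lam, ψ, ψ', fun x => c₁ * ψ x + c₂ * φ x, fun x => c₁ * ψ' x + c₂ * φ' x, hψ,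
    hχ.congr_right (Filter.Eventually.of_forall fun x => ?_), ?_, ?_, ?_⟩
  · simp only [Pi.add_apply, smul_apply, ContinuousLinearMap.id_apply,
      smul_eq_mul]
    ring
  · exact (boundaryCond_right_iff (t := θ lam a) (R := ρ a) (u := ψ) (w := ψ') (hρ a) rfl rfl).2 ⟨0, by rw [h.left]; simp⟩
  · simp only [BoundaryCond, smul_eq_mul, hc₁, hc₂]
    ring
  · have h2 : ψ a * (c₁ * ψ' a + c₂ * φ' a) - ψ' a * (c₁ * ψ a + c₂ * φ a) =
        -(c₂ * (ρ a * σ a)) := by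
      simp only [hψd, hψ'd, hφd, hφ'd, h.left, hηa, Real.sin_add_pi_div_two,
        Real.cos_add_pi_div_two]
      linear_combination (-c₂ * ρ a * σ a) * Real.sin_sq_add_cos_sq α
    rw [h2]
    exact neg_ne_zero.2 (mul_ne_zero hc₂0 (mul_pos (hρ a) (hσ a)).ne')

/-- The eigenspaces of the Sturm–Liouville operator in terms of the Prüfer angle. -/
theorem IsPruferFamily.exists_eigenvector (h : IsPruferFamily a b p q r α θ) (hab : a < b)
    (hreg : IsRegular a b p q r) (β μ : ℝ) :
    ∃ y : L2 a b r, y ≠ 0 ∧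
      ((∃ k : ℤ, θ μ b = β + k * Real.pi) → (y, (μ : ℂ) • y) ∈ graph a b p q r α β) ∧
      ∀ x : L2 a b r, (x, (μ : ℂ) • x) ∈ graph a b p q r α β → x ≠ 0 →
        (∃ k : ℤ, θ μ b = β + k * Real.pi) ∧ ∃ c : ℂ, x = c • y := by
  have := hreg.isFiniteMeasure_weight
  obtain ⟨ρ, hρ, hψ⟩ := (h.isPruferSolution μ).exists_tauEq hab hreg
  set ψ := fun x => ρ x * Real.sin (θ μ x) with hψd
  set ψ' := fun x => ρ x * Real.cos (θ μ x) with hψ'd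
  have hψC := hψ.ofReal
  have hψa : BoundaryCond a α ψ ψ' :=
    (boundaryCond_right_iff (t := θ μ a) (R := ρ a) (u := ψ) (w := ψ') (hρ a) rfl rfl).2 ⟨0, by rw [h.left]; simp⟩
  have hψb : BoundaryCond b β ψ ψ' ↔ ∃ k : ℤ, θ μ b = β + k * Real.pi :=
    boundaryCond_right_iff (t := θ μ b) (R := ρ b) (u := ψ) (w := ψ') (hρ b) rfl rfl
  set g : BoundedContinuousFunction (Icc a b) ℂ := BoundedContinuousFunction.mkOfCompact
    ⟨(Icc a b).domRestrict fun x => (ψ x : ℂ), continuousOn_iff_continuous_domRestrict.1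
      (hψC.isPrimitive_u.continuousOn hab.le)⟩ with hg
  set y : L2 a b r := ofBounded hab.le r g with hy
  have hyψ : y =ᵐ[weight a b r] fun x => (ψ x : ℂ) := by
    filter_upwards [coeFn_ofBounded (r := r) hab.le g,
      ae_weight_of_ae (ae_restrict_mem measurableSet_Ioo)] with x h1 h2
    rw [h1, projIcc_of_mem hab.le (Ioo_subset_Icc_self h2)]
    rfl
  refine ⟨y, fun hy0 => ?_, fun hk => ?_, fun x hx hx0 => ?_⟩
  · refine (h.isPruferSolution μ).not_sin_ae_eq_zero hab hreg (ae_of_ae_weight hreg ?_)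
    rw [hy0] at hyψ
    filter_upwards [hyψ, Lp.coeFn_zero ℂ 2 (weight a b r)] with x h1 h2
    rw [h2] at h1
    have h3 : ψ x = 0 := by
      rw [← Complex.ofReal_eq_zero, ← h1, Pi.zero_apply]
    exact (mul_eq_zero.1 h3).resolve_left (hρ x).ne'
  · refine ⟨_, _, _, hyψ, ?_, hψC, boundaryCond_ofReal.2 hψa, boundaryCond_ofReal.2 (hψb.2 hk)⟩
    filter_upwards [hyψ, Lp.coeFn_smul (μ : ℂ) y] with x h1 h2
    rw [h2, Pi.smul_apply, h1, smul_eq_mul]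
    exact (Complex.ofReal_mul _ _).symm
  · obtain ⟨u, w, hu, ht, hua, hub⟩ := exists_tauEq_of_mem_graph hreg hx
    have hne : ψ a ≠ 0 ∨ ψ' a ≠ 0 := by
      by_contra! hcon
      have h1 := Real.sin_sq_add_cos_sq (θ μ a)
      rw [(mul_eq_zero.1 hcon.1).resolve_left (hρ a).ne',
        (mul_eq_zero.1 hcon.2).resolve_left (hρ a).ne'] at h1
      norm_num at h1
    obtain ⟨c, hc⟩ := exists_eq_const_mul hab hreg hψ hψa hne ht hua
    have hxy : x = c • y := by
      refine Lp.ext ?_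
      filter_upwards [hu, hyψ, Lp.coeFn_smul c y,
        ae_weight_of_ae (ae_restrict_mem measurableSet_Ioo)] with t h1 h2 h3 h4
      rw [h1, h3, Pi.smul_apply, h2, (hc t (Ioo_subset_Icc_self h4)).1, smul_eq_mul]
    refine ⟨hψb.1 ?_, c, hxy⟩
    have hc0 : c ≠ 0 := by
      rintro rfl
      exact hx0 (by rw [hxy, zero_smul])
    obtain ⟨h5, h6⟩ := hc b (right_mem_Icc.2 hab.le)
    rw [← boundaryCond_ofReal]
    simp only [BoundaryCond, Complex.real_smul] at hub ⊢
    rw [h5, h6] at hub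
    refine (mul_eq_zero.1 ?_).resolve_left hc0
    linear_combination hub

theorem ncard_subtype_mem {M T : Set ℝ} : {i : M | (i : ℝ) ∈ T}.ncard = {μ | μ ∈ T ∧ μ ∈ M}.ncard := by
  rw [← Set.ncard_image_of_injective _ Subtype.val_injective]
  congr 1
  ext μ
  constructor
  · rintro ⟨i, hi, rfl⟩
    exact ⟨hi, i.2⟩
  · rintro ⟨h1, h2⟩
    exact ⟨⟨μ, h2⟩, h1, rfl⟩

theorem finite_subtype_mem {M T : Set ℝ} (h : {μ | μ ∈ T ∧ μ ∈ M}.Finite) :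
    {i : M | (i : ℝ) ∈ T}.Finite := by
  refine Set.Finite.of_finite_image (f := Subtype.val) (h.subset ?_) Subtype.val_injective.injOn
  rintro _ ⟨i, hi, rfl⟩
  exact ⟨hi, i.2⟩

/-- Sturm's oscillation theorem: the dimensions of the spectral subspaces below `lam` are counted
by the Prüfer angle at `b`. -/
theorem IsPruferFamily.finrank_spectral (h : IsPruferFamily a b p q r α θ) (hab : a < b)
    (hreg : IsRegular a b p q r) (hα0 : 0 ≤ α) (hα : α < Real.pi) (hβ0 : 0 < β)
    (hβ : β ≤ Real.pi) :
    (∃ E : ProjValuedMeasure (L2 a b r), E.IsSpectralResolution (operator a b p q r α β)) ∧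
    ∀ P : ProjValuedMeasure (L2 a b r), P.IsSpectralResolution (operator a b p q r α β) →
      ∀ lam : ℝ,
        (FiniteDimensional ℂ (P.proj (Set.Iic lam)).range ∧
          (Module.finrank ℂ (P.proj (Set.Iic lam)).range : ℤ) =
            ⌊(θ lam b - β) / Real.pi⌋ + 1) ∧
        (FiniteDimensional ℂ (P.proj (Set.Iio lam)).range ∧
          (Module.finrank ℂ (P.proj (Set.Iio lam)).range : ℤ) =
            ⌈(θ lam b - β) / Real.pi⌉) := by
  have hmono := h.strictMono hab hreg
  have hcont := h.continuous hab hreg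
  have hpos := h.pos hab hreg hα0
  have hlim : ∀ ε > 0, ∃ μ, θ μ b < ε := fun ε hε => h.exists_lt hab hreg hα0 hα hε
  have hIic := fun lam : ℝ => finite_and_ncard_Iic (lam := lam) hmono hcont hpos hlim hβ0 hβ
  have hIio := fun lam : ℝ => finite_and_ncard_Iio (lam := lam) hmono hcont hpos hlim hβ0 hβ
  obtain ⟨lam₀, ψ, ψ', χ, χ', hG⟩ := h.exists_greenPair (β := β) hab hreg hα0 hα hβ0 hβ
  obtain ⟨T, hT, hsymm, hcomp⟩ := hG.exists_resolvent hab hreg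
  set M : Set ℝ := {μ | ∃ k : ℤ, θ μ b = β + k * Real.pi} with hM
  -- The function y μ is nonzero for every real μ, whether or not μ is an eigenvalue, so it can be
  -- chosen and normalized before M is considered.
  choose y hy0 hyM hysimple using h.exists_eigenvector hab hreg β
  set v : M → L2 a b r := fun μ => ((‖y μ‖ : ℂ)⁻¹) • y μ with hv
  have hny : ∀ μ, (‖y μ‖ : ℂ) ≠ 0 := fun μ =>
    Complex.ofReal_ne_zero.2 (norm_ne_zero_iff.2 (hy0 μ))
  obtain ⟨e, he⟩ := hT.exists_hilbertBasis hsymm hcomp v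
    (fun μ => by
      rw [hv, norm_smul, norm_inv, Complex.norm_real, norm_norm,
        inv_mul_cancel₀ (norm_ne_zero_iff.2 (hy0 _))])
    (fun μ => by
      refine (mem_graph_iff_operator hab hreg).1 ?_
      have h1 := Submodule.smul_mem _ ((‖y μ‖ : ℂ)⁻¹) (hyM μ μ.2)
      rw [Prod.smul_mk, smul_comm] at h1
      exact h1)
    (fun μ x hx hx0 => by
      have h1 := (mem_graph_iff_operator hab hreg).2 ⟨x.2, hx⟩
      obtain ⟨h2, c, h3⟩ := hysimple μ x h1 hx0
      refine ⟨h2, c * ‖y μ‖, ?_⟩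
      rw [h3, hv, smul_smul, mul_assoc, mul_inv_cancel₀ (hny μ), mul_one])
  set m : M → ℝ := Subtype.val with hm
  have hem : ∀ i, ∃ h : e i ∈ (operator a b p q r α β).domain,
      operator a b p q r α β ⟨e i, h⟩ = (m i : ℂ) • e i := by
    intro μ
    refine (mem_graph_iff_operator hab hreg).1 ?_
    have h1 := Submodule.smul_mem _ ((‖y μ‖ : ℂ)⁻¹) (hyM μ μ.2)
    rw [Prod.smul_mk, smul_comm] at h1
    rw [he]
    exact h1
  -- Each half-line (-∞, n] contains only finitely many eigenvalues.
  have hcount : Countable M := by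
    have h1 : M ⊆ ⋃ n : ℕ, {μ | μ ∈ Iic (n : ℝ) ∧ μ ∈ M} := fun μ hμ => by
      obtain ⟨n, hn⟩ := exists_nat_ge μ
      exact mem_iUnion.2 ⟨n, hn, hμ⟩
    exact ((Set.countable_iUnion fun n : ℕ => (hIic n).1.countable).mono h1).to_subtype
  refine ⟨⟨ProjValuedMeasure.diagonal e m, ProjValuedMeasure.isSpectralResolution_diagonal e m
    (hT.mem_domain_iff_summable hsymm e m hem) (hT.repr_apply hsymm e m hem)⟩,
    fun P hP lam => ⟨?_, ?_⟩⟩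
  · obtain ⟨h1, h2⟩ := hP.finiteDimensional_and_finrank_range e m hem
      (measurableSet_Iic (a := lam)) (finite_subtype_mem (hIic lam).1)
    refine ⟨h1, ?_⟩
    rw [h2, ← (hIic lam).2]
    exact congrArg _ ncard_subtype_mem
  · obtain ⟨h1, h2⟩ := hP.finiteDimensional_and_finrank_range e m hem
      (measurableSet_Iio (a := lam)) (finite_subtype_mem (hIio lam).1)
    refine ⟨h1, ?_⟩
    rw [h2, ← (hIio lam).2]
    exact congrArg _ ncard_subtype_mem

/-! ### Normalization of the boundary angles -/

theorem boundaryCond_add_int_mul_pi {E : Type*} [NormedAddCommGroup E] [NormedSpace ℝ E]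
    (c γ : ℝ) (n : ℤ) (u w : ℝ → E) :
    BoundaryCond c (γ + n * Real.pi) u w ↔ BoundaryCond c γ u w := by
  have h : ((-1 : ℝ) ^ n) ≠ 0 := zpow_ne_zero _ (by norm_num)
  simp only [BoundaryCond, Real.cos_add_int_mul_pi, Real.sin_add_int_mul_pi]
  rw [mul_smul, mul_smul, ← smul_sub, smul_eq_zero, or_iff_right h]

theorem operator_add_int_mul_pi (a b : ℝ) (p q r : ℝ → ℝ) (α β : ℝ) (n k : ℤ) :
    operator a b p q r (α + n * Real.pi) (β + k * Real.pi) = operator a b p q r α β := by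
  have h : graph a b p q r (α + n * Real.pi) (β + k * Real.pi) = graph a b p q r α β := by
    ext F
    simp only [graph, Submodule.mem_mk, AddSubmonoid.mem_mk, AddSubsemigroup.mem_mk, mem_ofPred_eq,
      boundaryCond_add_int_mul_pi]
  rw [operator, operator, h]

theorem exists_int_mul_pi_Ico (α : ℝ) :
    ∃ (n : ℤ) (α' : ℝ), 0 ≤ α' ∧ α' < Real.pi ∧ α = α' + n * Real.pi := by
  have h1 := toIcoMod_mem_Ico Real.pi_pos 0 α
  refine ⟨toIcoDiv Real.pi_pos 0 α, toIcoMod Real.pi_pos 0 α, h1.1, by simpa using h1.2, ?_⟩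
  simp

theorem exists_int_mul_pi_Ioc (β : ℝ) :
    ∃ (n : ℤ) (β' : ℝ), 0 < β' ∧ β' ≤ Real.pi ∧ β = β' + n * Real.pi := by
  have h1 := toIocMod_mem_Ioc Real.pi_pos 0 β
  refine ⟨toIocDiv Real.pi_pos 0 β, toIocMod Real.pi_pos 0 β, h1.1, by simpa using h1.2, ?_⟩
  simp

/-- At `b` the angle θ₀ is β modulo π, which leaves the ceiling for θ₁; at `a` the angle θ₁ is α
modulo π, which leaves the floor for θ₀. The integers m and n cancel. -/
theorem weightedSignFlips_eq_of_right_left {θ₀ θ₁ : ℝ → ℝ} {m n : ℤ}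
    (h₀ : θ₀ b = β + m * Real.pi) (h₁ : θ₁ a = α + n * Real.pi) :
    weightedSignFlips a b θ₀ θ₁ = ⌈(θ₁ b - θ₁ a - (β - α)) / Real.pi⌉ -
      (⌊(θ₀ b - θ₀ a - (β - α)) / Real.pi⌋ + 1) := by
  have hpi := Real.pi_ne_zero
  have e1 : (θ₁ b - θ₀ b) / Real.pi = (θ₁ b - β) / Real.pi - m := by
    rw [h₀]
    field_simp
    ring
  have e2 : (θ₁ a - θ₀ a) / Real.pi = (α - θ₀ a) / Real.pi + n := by
    rw [h₁]
    field_simp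
    ring
  have e3 : (θ₁ b - θ₁ a - (β - α)) / Real.pi = (θ₁ b - β) / Real.pi - n := by
    rw [h₁]
    field_simp
    ring
  have e4 : (θ₀ b - θ₀ a - (β - α)) / Real.pi = (α - θ₀ a) / Real.pi + m := by
    rw [h₀]
    field_simp
    ring
  rw [weightedSignFlips, e1, e2, e3, e4, Int.ceil_sub_intCast, Int.ceil_sub_intCast,
    Int.floor_add_intCast, Int.floor_add_intCast]
  ring

/-- The endpoints exchange roles: by ⌈-x⌉ = -⌊x⌋ the ceiling at `b` yields the floor for θ₀, and the
floor at `a` yields the ceiling for θ₁. -/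
theorem weightedSignFlips_eq_of_left_right {θ₀ θ₁ : ℝ → ℝ} {m n : ℤ}
    (h₀ : θ₀ a = α + n * Real.pi) (h₁ : θ₁ b = β + m * Real.pi) :
    weightedSignFlips a b θ₀ θ₁ = ⌈(θ₁ b - θ₁ a - (β - α)) / Real.pi⌉ -
      (⌊(θ₀ b - θ₀ a - (β - α)) / Real.pi⌋ + 1) := by
  have hpi := Real.pi_ne_zero
  have e1 : (θ₁ b - θ₀ b) / Real.pi = -((θ₀ b - β) / Real.pi) + m := by
    rw [h₁]
    field_simp
    ring
  have e2 : (θ₁ a - θ₀ a) / Real.pi = (θ₁ a - α) / Real.pi - n := by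
    rw [h₀]
    field_simp
    ring
  have e3 : (θ₁ b - θ₁ a - (β - α)) / Real.pi = -((θ₁ a - α) / Real.pi) + m := by
    rw [h₁]
    field_simp
    ring
  have e4 : (θ₀ b - θ₀ a - (β - α)) / Real.pi = (θ₀ b - β) / Real.pi - n := by
    rw [h₀]
    field_simp
    ring
  rw [weightedSignFlips, e1, e2, e3, e4, Int.ceil_add_intCast, Int.ceil_add_intCast, Int.ceil_neg,
    Int.ceil_neg, Int.floor_sub_intCast, Int.floor_sub_intCast]
  ring

theorem IsPruferAngle.eq_add_int_mul_pi {u w θ : ℝ → ℝ} (hθ : IsPruferAngle a b u w θ) {c γ : ℝ}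
    (hc : c ∈ Icc a b) (h : BoundaryCond c γ u w) : ∃ k : ℤ, θ c = γ + k * Real.pi := by
  obtain ⟨-, ρ, hρ⟩ := hθ
  exact (boundaryCond_right_iff (hρ c hc).1 (hρ c hc).2.1 (hρ c hc).2.2).1 h

end

end SturmLiouville

end

/-! ### The difference of dimensions as a number of weighted sign flips -/

open SturmLiouville in
theorem theorem2p3 (a b : ℝ) (hab : a < b) (p q₀ q₁ r : ℝ → ℝ)
    (hreg₀ : IsRegular a b p q₀ r) (hreg₁ : IsRegular a b p q₁ r)
    (α β lam₀ lam₁ : ℝ) :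
    (∃ E : ProjValuedMeasure (L2 a b r), E.IsSpectralResolution (operator a b p q₀ r α β)) ∧
    (∃ E : ProjValuedMeasure (L2 a b r), E.IsSpectralResolution (operator a b p q₁ r α β)) ∧
    ∀ P₀ P₁ : ProjValuedMeasure (L2 a b r),
      P₀.IsSpectralResolution (operator a b p q₀ r α β) →
      P₁.IsSpectralResolution (operator a b p q₁ r α β) →
      FiniteDimensional ℂ (P₀.proj (Set.Iic lam₀)).range ∧
      FiniteDimensional ℂ (P₁.proj (Set.Iio lam₁)).range ∧
      (∀ u₀ w₀ u₁ w₁ θ₀ θ₁ : ℝ → ℝ,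
        IsBoundarySolution a b p q₀ r lam₀ b β u₀ w₀ →
        IsBoundarySolution a b p q₁ r lam₁ a α u₁ w₁ →
        IsPruferAngle a b u₀ w₀ θ₀ → IsPruferAngle a b u₁ w₁ θ₁ →
        (Module.finrank ℂ (P₁.proj (Set.Iio lam₁)).range : ℤ)
            - Module.finrank ℂ (P₀.proj (Set.Iic lam₀)).range
          = weightedSignFlips a b θ₀ θ₁) ∧
      (∀ u₀ w₀ u₁ w₁ θ₀ θ₁ : ℝ → ℝ,
        IsBoundarySolution a b p q₀ r lam₀ a α u₀ w₀ →
        IsBoundarySolution a b p q₁ r lam₁ b β u₁ w₁ →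
        IsPruferAngle a b u₀ w₀ θ₀ → IsPruferAngle a b u₁ w₁ θ₁ →
        (Module.finrank ℂ (P₁.proj (Set.Iio lam₁)).range : ℤ)
            - Module.finrank ℂ (P₀.proj (Set.Iic lam₀)).range
          = weightedSignFlips a b θ₀ θ₁) := by
  -- Shifts by multiples of π change neither the operators nor the boundary conditions. The
  -- half-open ranges [0, π) for α and (0, π] for β make the count of levels start at k = 0.
  obtain ⟨n, α', hα0, hα, rfl⟩ := exists_int_mul_pi_Ico α
  obtain ⟨k, β', hβ0, hβ, rfl⟩ := exists_int_mul_pi_Ioc β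
  rw [operator_add_int_mul_pi, operator_add_int_mul_pi]
  have ha := left_mem_Icc.2 hab.le
  have hb := right_mem_Icc.2 hab.le
  obtain ⟨η₀, h₀⟩ := exists_isPruferFamily hab hreg₀ α'
  obtain ⟨η₁, h₁⟩ := exists_isPruferFamily hab hreg₁ α'
  obtain ⟨hE₀, hd₀⟩ := h₀.finrank_spectral hab hreg₀ hα0 hα hβ0 hβ
  obtain ⟨hE₁, hd₁⟩ := h₁.finrank_spectral hab hreg₁ hα0 hα hβ0 hβ
  refine ⟨hE₀, hE₁, fun P₀ P₁ hP₀ hP₁ => ?_⟩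
  obtain ⟨⟨hf₀, hn₀⟩, -⟩ := hd₀ P₀ hP₀ lam₀
  obtain ⟨-, ⟨hf₁, hn₁⟩⟩ := hd₁ P₁ hP₁ lam₁
  refine ⟨hf₀, hf₁, ?_, ?_⟩
  · intro u₀ w₀ u₁ w₁ θ₀ θ₁ hu₀ hu₁ hθ₀ hθ₁
    have hb₀ := (boundaryCond_add_int_mul_pi _ _ _ _ _).1 hu₀.boundary
    have hb₁ := (boundaryCond_add_int_mul_pi _ _ _ _ _).1 hu₁.boundary
    obtain ⟨i, hi⟩ := hθ₀.eq_add_int_mul_pi hb hb₀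
    obtain ⟨j, hj⟩ := hθ₁.eq_add_int_mul_pi ha hb₁
    rw [weightedSignFlips_eq_of_right_left hi hj, hn₀, hn₁,
      (floor_ceil_pruferAngle hab hreg₀ (h₀.isPruferSolution lam₀) (h₀.left lam₀) hu₀.tauEq hθ₀
        (Or.inr hb₀)).1,
      (floor_ceil_pruferAngle hab hreg₁ (h₁.isPruferSolution lam₁) (h₁.left lam₁) hu₁.tauEq hθ₁
        (Or.inl hb₁ : _ ∨ BoundaryCond b β' u₁ w₁)).2]
  · intro u₀ w₀ u₁ w₁ θ₀ θ₁ hu₀ hu₁ hθ₀ hθ₁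
    have hb₀ := (boundaryCond_add_int_mul_pi _ _ _ _ _).1 hu₀.boundary
    have hb₁ := (boundaryCond_add_int_mul_pi _ _ _ _ _).1 hu₁.boundary
    obtain ⟨i, hi⟩ := hθ₀.eq_add_int_mul_pi ha hb₀
    obtain ⟨j, hj⟩ := hθ₁.eq_add_int_mul_pi hb hb₁
    rw [weightedSignFlips_eq_of_left_right hi hj, hn₀, hn₁,
      (floor_ceil_pruferAngle hab hreg₀ (h₀.isPruferSolution lam₀) (h₀.left lam₀) hu₀.tauEq hθ₀
        (Or.inl hb₀ : _ ∨ BoundaryCond b β' u₀ w₀)).1,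
      (floor_ceil_pruferAngle hab hreg₁ (h₁.isPruferSolution lam₁) (h₁.left lam₁) hu₁.tauEq hθ₁
        (Or.inr hb₁)).2]
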